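/- **Theorem 2.8.** Call $u_\infty:(0,R_\infty]\to\mathbb R$ (with $R_\infty>0$) a *singular disk solution* if $u_\infty$ is continuous on $(0,R_\infty]$, smooth and positive on $(0,R_\infty)$, $u_\infty(R_\infty)=0$, $$-u_\infty''-\frac{u_\infty'}{r}=u_\infty\,(e^{u_\infty^2}-1)\quad\text{on }(0,R_\infty),$$ and, as $r\to0^+$, $$u_\infty(r)=\bigl(-2\log r-2\log(-\log r)-2\log 2\bigr)^{1/2}+O\bigl((-\log r)^{-3/2}\log(-\log r)\bigr).$$ Singular disk solutions exist. Let $u_\infty$ be any one of them. Then there is exactly one $R\in(0,R_\infty)$ with $u_\infty(R)=2$. Let $\chi\in C^\infty(\mathbb R)$ satisfy $\chi(t)=1$ for $|t|\le1$, $\chi(t)=0$ for $|t|\ge2$ and $t\chi'(t)\le0$ for all $t$, and put $f_m(s)=s(e^{s^2}-1)-m\chi(s)s$ for $m\ge0$. Then for every $m\ge0$ there is a unique function $\phi_m:(0,\infty)\to\mathbb R$ which equals $u_\infty$ on $(0,R]$ and which on $[R,\infty)$ is the solution of $$-\phi_m''-\frac{\phi_m'}{r}=f_m(\phi_m)\quad(r>R),\qquad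 \phi_m(R)=u_\infty(R)=2,\quad \phi_m'(R)=u_\infty'(R).$$ The set $\{m>0:\phi_m(r)>0\text{ for all }r>R\}$ is non-empty, and its infimum $m_*$ satisfies $0<m_*<\infty$. Moreover: 1. The function $\Phi(x)=\phi_{m_*}(|x|)$ is a positive radial singular solution of $$-\Delta\Phi=f_{m_*}(\Phi)\ \text{ in }\mathbb R^2,\qquad \lim_{|x|\to\infty}\Phi(x)=0,$$ that is, $\Phi$ is smooth and positive on $\mathbb R^2\setminus\{0\}$ and satisfies the equation there pointwise, $\Phi$ and $f_{m_*}(\Phi)$ are locally integrable on $\mathbb R^2$ and the equation holds on all of $\mathbb R^2$ in the sense of distributions, $\Phi(x)\to\infty$ as $x\to0$, and $\Phi(x)\to0$ as $|x|\to\infty$. 2. $\phi_{m_*}$ is strictly decreasing on $(0,\infty)$. 3. For every $m\in(0,m_*)$ there is $C_m\in(0,\infty)$ such that $$\phi_{m_*}(r)+|\phi_{m_*}'(r)|\le C_m\,e^{-\sqrt m\,r}\qquad\text{for all }r\ge R.$$ -/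

import Mathlib

open Real Set Filter Topology MeasureTheory Asymptotics
open scoped ContDiff Laplacian

noncomputable section

/-- The Euclidean plane. -/
abbrev Plane : Type := EuclideanSpace ℝ (Fin 2)

/-- `χ` is a smooth cut-off function with `χ = 1` on `[-1, 1]`, `χ = 0` outside `(-2, 2)`
and `t χ'(t) ≤ 0` for all `t`. -/
structure IsCutoff (χ : ℝ → ℝ) : Prop where
  smooth : ContDiff ℝ ∞ χ
  eq_one : ∀ t, |t| ≤ 1 → χ t = 1
  eq_zero : ∀ t, 2 ≤ |t| → χ t = 0
  mul_deriv_nonpos : ∀ t, t * deriv χ t ≤ 0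

/-- The nonlinearity `f_m(s) = s (e^{s²} - 1) - m χ(s) s`. -/
def nonlin (χ : ℝ → ℝ) (m s : ℝ) : ℝ :=
  s * (exp (s ^ 2) - 1) - m * χ s * s

/-- `u` is the radial profile of a singular solution, positive in the disk, of the Dirichlet
problem `-Δu = u (e^{u²} - 1)` in the disk of radius `Rinf`, `u = 0` on its boundary, smooth
away from the origin, with the asymptotic expansion
`u(r) = (-2 log r - 2 log (-log r) - 2 log 2)^{1/2} + O((-log r)^{-3/2} log (-log r))`
as `r → 0`. -/
structure IsSingularDiskSolution (Rinf : ℝ) (u : ℝ → ℝ) : Prop where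
  radius_pos : 0 < Rinf
  smooth : ContDiffOn ℝ ∞ u (Ioo 0 Rinf)
  ode : ∀ r ∈ Ioo 0 Rinf,
    -deriv (deriv u) r - deriv u r / r = u r * (exp (u r ^ 2) - 1)
  pos : ∀ r ∈ Ioo 0 Rinf, 0 < u r
  continuousOn : ContinuousOn u (Ioc 0 Rinf)
  boundary : u Rinf = 0
  asymptotic :
    (fun r : ℝ => u r - √(-2 * log r - 2 * log (-log r) - 2 * log 2)) =O[𝓝[>] 0]
      (fun r : ℝ => (-log r) ^ (-(3 / 2) : ℝ) * log (-log r))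

/-- `φ` is the shooting solution for the mass `m`: it coincides with `u` on `(0, R]`, and on
`[R, ∞)` it solves the initial value problem
`-φ'' - φ'/r = f_m(φ)` for `r > R`, `φ(R) = u(R)`, `φ'(R) = u'(R)`
(`φ` being `C¹` up to `r = R` from the right). Values at `r ≤ 0` are irrelevant. -/
structure IsShootingSolution (χ : ℝ → ℝ) (u : ℝ → ℝ) (R m : ℝ) (φ : ℝ → ℝ) : Prop where
  eq_inner : ∀ r ∈ Ioc 0 R, φ r = u r
  c1 : ContDiffOn ℝ 1 φ (Ici R)
  c2 : ContDiffOn ℝ 2 φ (Ioi R)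
  initial_deriv : derivWithin φ (Ici R) R = deriv u R
  ode : ∀ r ∈ Ioi R, -deriv (deriv φ) r - deriv φ r / r = nonlin χ m (φ r)

/-- The set of masses `m > 0` whose shooting solution `φ m` stays positive on `r > R`. -/
def positiveMasses (R : ℝ) (φ : ℝ → ℝ → ℝ) : Set ℝ :=
  {m | 0 < m ∧ ∀ r, R < r → 0 < φ m r}

/-- The critical mass `m_*`. -/
def criticalMass (R : ℝ) (φ : ℝ → ℝ → ℝ) : ℝ :=
  sInf (positiveMasses R φ)

/-- `Φ` satisfies `-ΔΦ = f(Φ)` on the whole plane in the sense of distributions. -/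
def IsDistributionalSolution (f : ℝ → ℝ) (Φ : Plane → ℝ) : Prop :=
  LocallyIntegrable Φ volume ∧
  LocallyIntegrable (fun x => f (Φ x)) volume ∧
  ∀ ψ : Plane → ℝ, ContDiff ℝ ∞ ψ → HasCompactSupport ψ →
    -(∫ x, Φ x * (Δ ψ) x) = ∫ x, f (Φ x) * ψ x

/-- `Φ` is a positive singular solution on the plane of `-ΔΦ = f(Φ)`, `Φ → 0` at infinity,
with singularity at the origin: the equation holds in the sense of distributions on the whole
plane and classically away from the origin, where `Φ` is smooth and positive, and `Φ` diverges
at the origin. -/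
structure IsPositiveSingularSolution (f : ℝ → ℝ) (Φ : Plane → ℝ) : Prop where
  smooth : ContDiffOn ℝ ∞ Φ {0}ᶜ
  classical : ∀ x, x ≠ 0 → -(Δ Φ) x = f (Φ x)
  distributional : IsDistributionalSolution f Φ
  pos : ∀ x, x ≠ 0 → 0 < Φ x
  singular : Tendsto Φ (𝓝[≠] 0) atTop
  decay : Tendsto Φ (cocompact Plane) (𝓝 0)

end

/-!
The proof works with the first order system `φ' = ψ`, `ψ' = -ψ / r - f(φ)` (`IsRadialSolution`).
Three quantities carry the argument: the energy `ψ² / 2 + F(φ)`, with `F` the primitive of `f` that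
vanishes at zero, which is nonincreasing; the flux `r ψ`, which is nonincreasing where `f(φ) ≥ 0`;
and the oscillation of `φ` on shells around the origin.

**Existence of a singular disk solution.** Near the singularity the unknown is the inverse function:
`t = -log r` as a function `T` of the value `x = u(r)` solves
`T'' = T'³ e^{-2T} x (e^{x²} - 1)`. The ansatz
`T = x² / 2 + 2 log x + 4 / x² - 26 / x⁴ + h` turns this into `h'' + 2 h = N(x, h, h')` with
`N(x, 0, 0) = O(x⁻⁶)`. The solution of `h'' + 2 h = G` that decays at infinity is an explicit
integral, and for large `x` the contraction principle applies to the source, in a space with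
weight `x⁵` (`exists_inverse_correction`). Inverting `T` gives a solution near `0` with the required
expansion (`exists_singular_near_zero`). The energy provides its forward continuation, and
the monotone flux forces a zero (`IsRadialSolution.exists_first_zero`).

**Shape of singular disk solutions.** The flux of any singular disk solution `u` is nonincreasing,
and the expansion at the origin shows that `u → ∞` while `u` grows more slowly than `-log r`. Hence
`u' < 0`, and the flux tends to zero at the origin. In particular `u = 2` at a single radius `R`,
and on `(0, R]` the cut-off term vanishes, so that `u` solves the equation for every mass.

**Shooting.** For large masses the energy at `R` is negative, and a solution of negative energy
cannot vanish. For `m = 0` the solution crosses zero transversally, hence so it does for small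
masses. So `0 < m_* < ∞`. At `m_*` the solution is positive, as it is a limit of positive solutions
without double zeros. Its energy never becomes negative: otherwise it would be negative at some
radius for slightly smaller masses too, and these would be positive masses. As `f_m(s) / s` is
increasing in `s > 0`, the potential is nonnegative only where `f_m` is positive
(`nonlin_pos_of_massPotential_nonneg`); therefore the critical solution has no critical point and
its limit at infinity is zero. Where it is small, `φ'' ≥ m φ` for every `m < m_*`, which gives the
exponential decay.

**The equation across the origin.** `Φ` is truncated smoothly at height `k`. The truncated function
is `C²` on the plane, so Green's formula applies. The only term of its Laplacian that is not
dominated by `f(Φ)` is supported in the shell `k ≤ Φ ≤ k + 1` and of size `ψ²`. Since `Φ` oscillates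
by `1` on the shell, the integral of `r ψ²` over it is at most the supremum of `|r ψ|` there, which
tends to zero as `k → ∞` because the flux vanishes at the origin
(`IsRadialSolution.isDistributionalSolution`).
-/

/-! ### Radial solutions: uniqueness, perturbation and global existence -/

/-- `φ` solves the radial equation `-φ'' - φ'/r = f(φ)` on `S`, with derivative `ψ`. The
derivatives are two-sided, also at boundary points of `S`. -/
def IsRadialSolution (f φ ψ : ℝ → ℝ) (S : Set ℝ) : Prop :=
  ∀ r ∈ S, HasDerivAt φ (ψ r) r ∧ HasDerivAt ψ (-ψ r / r - f (φ r)) r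

lemma IsRadialSolution.mono {f φ ψ : ℝ → ℝ} {S S' : Set ℝ} (h : IsRadialSolution f φ ψ S)
    (hS : S' ⊆ S) : IsRadialSolution f φ ψ S' := fun r hr => h r (hS hr)

/-- The vector field of the radial equation, written as a first order system for `(φ, φ')`. -/
noncomputable def radialField (f : ℝ → ℝ) (r : ℝ) (y : ℝ × ℝ) : ℝ × ℝ := (y.2, -y.2 / r - f y.1)

lemma lipschitzOnWith_radialField {f : ℝ → ℝ} {L c r : ℝ} {s : Set ℝ} (hc : 0 < c) (hcr : c ≤ r)
    (hL : 0 ≤ L) (hf : ∀ x ∈ s, ∀ y ∈ s, |f x - f y| ≤ L * |x - y|) :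
    LipschitzOnWith (1 + 1 / c + L).toNNReal (radialField f r) (Prod.fst ⁻¹' s) := by
  have hc' : 0 ≤ 1 / c := by positivity
  refine LipschitzOnWith.of_dist_le_mul fun x hx y hy => ?_
  rw [Real.coe_toNNReal _ (by positivity)]
  have h1 : |x.1 - y.1| ≤ dist x y := by rw [Prod.dist_eq, ← Real.dist_eq]; exact le_max_left _ _
  have h2 : |x.2 - y.2| ≤ dist x y := by rw [Prod.dist_eq, ← Real.dist_eq]; exact le_max_right _ _
  have hd : 0 ≤ dist x y := dist_nonneg
  have h3 : |(-x.2 / r - f x.1) - (-y.2 / r - f y.1)| ≤ 1 / c * |x.2 - y.2| + L * |x.1 - y.1| := by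
    have e : (-x.2 / r - f x.1) - (-y.2 / r - f y.1)
        = -((1 / r) * (x.2 - y.2)) - (f x.1 - f y.1) := by ring
    rw [e]
    refine (abs_sub _ _).trans (add_le_add ?_ (hf _ hx _ hy))
    have hr : 0 < r := hc.trans_le hcr
    rw [abs_neg, abs_mul, abs_of_nonneg (by positivity : 0 ≤ 1 / r)]
    gcongr
  rw [Prod.dist_eq]
  refine max_le ?_ ?_
  · simp only [radialField, Real.dist_eq]
    nlinarith [mul_nonneg hc' hd, mul_nonneg hL hd]
  · simp only [radialField, Real.dist_eq]
    nlinarith [mul_le_mul_of_nonneg_left h2 hc', mul_le_mul_of_nonneg_left h1 hL]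

/-- Grönwall's inequality for the radial equation: two solutions with the same initial data,
for nonlinearities that differ by at most `ε`, are `O(ε)`-close in `C¹`. -/
lemma radial_gronwall {f g φ ψ φ' ψ' : ℝ → ℝ} {L a b ε : ℝ} {s : Set ℝ} (ha : 0 < a)
    (hL : 0 ≤ L) (hf : ∀ x ∈ s, ∀ y ∈ s, |f x - f y| ≤ L * |x - y|)
    (hfg : ∀ x ∈ s, |g x - f x| ≤ ε)
    (hφc : ContinuousOn φ (Icc a b)) (hψc : ContinuousOn ψ (Icc a b))
    (hφ'c : ContinuousOn φ' (Icc a b)) (hψ'c : ContinuousOn ψ' (Icc a b))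
    (hφ : ∀ r ∈ Ico a b, HasDerivWithinAt φ (ψ r) (Ici r) r)
    (hψ : ∀ r ∈ Ico a b, HasDerivWithinAt ψ (-ψ r / r - f (φ r)) (Ici r) r)
    (hφ' : ∀ r ∈ Ico a b, HasDerivWithinAt φ' (ψ' r) (Ici r) r)
    (hψ' : ∀ r ∈ Ico a b, HasDerivWithinAt ψ' (-ψ' r / r - g (φ' r)) (Ici r) r)
    (hs : ∀ r ∈ Ico a b, φ r ∈ s) (hs' : ∀ r ∈ Ico a b, φ' r ∈ s)
    (h0 : φ a = φ' a) (h1 : ψ a = ψ' a) (hε : 0 ≤ ε) :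
    ∀ r ∈ Icc a b, |φ r - φ' r| ≤ ε * exp ((1 + 1 / a + L) * (b - a)) ∧
      |ψ r - ψ' r| ≤ ε * exp ((1 + 1 / a + L) * (b - a)) := by
  intro r hr
  have ha' : 0 ≤ 1 / a := by positivity
  have key := dist_le_of_approx_trajectories_ODE_of_mem (E := ℝ × ℝ)
    (v := radialField f) (K := (1 + 1 / a + L).toNNReal) (s := fun _ => Prod.fst ⁻¹' s)
    (f := fun r => (φ r, ψ r)) (g := fun r => (φ' r, ψ' r))
    (f' := fun r => (ψ r, -ψ r / r - f (φ r))) (g' := fun r => (ψ' r, -ψ' r / r - g (φ' r)))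
    (a := a) (b := b) (εf := 0) (εg := ε) (δ := 0)
    (fun t ht => lipschitzOnWith_radialField ha ht.1 hL hf)
    (hφc.prodMk hψc) (fun t ht => (hφ t ht).prodMk (hψ t ht))
    (fun t ht => by simp [radialField])
    (fun t ht => hs t ht)
    (hφ'c.prodMk hψ'c) (fun t ht => (hφ' t ht).prodMk (hψ' t ht))
    (fun t ht => by
      simp only [radialField, Prod.dist_eq, dist_self, Real.dist_eq]
      refine max_le hε ?_
      rw [show -ψ' t / t - g (φ' t) - (-ψ' t / t - f (φ' t)) = -(g (φ' t) - f (φ' t)) by ring,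
        abs_neg]
      exact hfg _ (hs' t ht))
    (fun t ht => hs' t ht)
    (by simp [h0, h1]) r hr
  have hK : (1 + 1 / a + L) ≠ 0 := by positivity
  rw [Real.coe_toNNReal _ (by positivity), gronwallBound_of_K_ne_0 hK] at key
  have hle : dist (φ r, ψ r) (φ' r, ψ' r) ≤ ε * exp ((1 + 1 / a + L) * (b - a)) := by
    refine key.trans ?_
    simp only [zero_mul, zero_add]
    have e1 : exp ((1 + 1 / a + L) * (r - a)) ≤ exp ((1 + 1 / a + L) * (b - a)) := by
      apply exp_le_exp.mpr
      have := hr.2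
      gcongr
    have e2 : 0 ≤ exp ((1 + 1 / a + L) * (r - a)) - 1 := by
      have : 0 ≤ (1 + 1 / a + L) * (r - a) := mul_nonneg (by positivity) (by linarith [hr.1])
      linarith [add_one_le_exp ((1 + 1 / a + L) * (r - a))]
    have e3 : ε / (1 + 1 / a + L) ≤ ε := div_le_self hε (by linarith)
    calc ε / (1 + 1 / a + L) * (exp ((1 + 1 / a + L) * (r - a)) - 1)
        ≤ ε * (exp ((1 + 1 / a + L) * (r - a)) - 1) := mul_le_mul_of_nonneg_right e3 e2
      _ ≤ ε * exp ((1 + 1 / a + L) * (b - a)) := by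
        apply mul_le_mul_of_nonneg_left _ hε; linarith
  rw [Prod.dist_eq] at hle
  exact ⟨by rw [← Real.dist_eq]; exact (le_max_left _ _).trans hle,
    by rw [← Real.dist_eq]; exact (le_max_right _ _).trans hle⟩

/-- A `C¹` function is Lipschitz on bounded intervals. -/
lemma exists_lipschitz_on_Icc {f : ℝ → ℝ} (hf : ContDiff ℝ 1 f) (B : ℝ) :
    ∃ L, 0 ≤ L ∧ ∀ x ∈ Icc (-B) B, ∀ y ∈ Icc (-B) B, |f x - f y| ≤ L * |x - y| := by
  obtain ⟨K, hK⟩ := hf.locallyLipschitz.locallyLipschitzOn.exists_lipschitzOnWith_of_compact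
    (isCompact_Icc (a := -B) (b := B))
  exact ⟨K, K.2, fun x hx y hy => by simpa [Real.dist_eq] using hK.dist_le_mul x hx y hy⟩

/-- Two-sided uniqueness for globally Lipschitz nonlinearities, from Cauchy data at an interior
point. -/
lemma radial_unique_of_lipschitz {f φ ψ φ' ψ' : ℝ → ℝ} {L c a b t₀ : ℝ} (hc : 0 < c)
    (hca : c ≤ a) (hL : 0 ≤ L) (hf : ∀ x y, |f x - f y| ≤ L * |x - y|) (ht : t₀ ∈ Ioo a b)
    (h : IsRadialSolution f φ ψ (Ioo a b)) (h' : IsRadialSolution f φ' ψ' (Ioo a b))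
    (h0 : φ t₀ = φ' t₀) (h1 : ψ t₀ = ψ' t₀) :
    ∀ r ∈ Ioo a b, φ r = φ' r ∧ ψ r = ψ' r := by
  have := ODE_solution_unique_of_mem_Ioo (E := ℝ × ℝ) (v := radialField f)
    (K := (1 + 1 / c + L).toNNReal) (s := fun _ => Prod.fst ⁻¹' univ)
    (f := fun r => (φ r, ψ r)) (g := fun r => (φ' r, ψ' r)) (t₀ := t₀)
    (fun t ht => lipschitzOnWith_radialField hc (hca.trans ht.1.le) hL
      (fun x _ y _ => hf x y)) ht
    (fun t ht => ⟨(h t ht).1.prodMk (h t ht).2, trivial⟩)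
    (fun t ht => ⟨(h' t ht).1.prodMk (h' t ht).2, trivial⟩)
    (by simp [h0, h1])
  intro r hr
  simpa using this hr

/-- Existence on bounded intervals for bounded Lipschitz nonlinearities. In the variables
`p = φ - r φ' log r` and `q = r φ'` the system reads `p' = r log r f(p + q log r)`,
`q' = -r f(p + q log r)`; its right-hand side is bounded, so that the Picard–Lindelöf theorem
applies on the whole interval at once. -/
lemma exists_radial_of_bounded {f : ℝ → ℝ} {L M : ℝ} (hL : 0 ≤ L)
    (hf : ∀ x y, |f x - f y| ≤ L * |x - y|) (hM : ∀ x, |f x| ≤ M) {R : ℝ} (hR : 0 < R)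
    (a b : ℝ) {n : ℝ} (hn : R < n) :
    ∃ φ ψ : ℝ → ℝ, φ R = a ∧ ψ R = b ∧ IsRadialSolution f φ ψ (Ioo (R / 2) n) := by
  have hM0 : 0 ≤ M := (abs_nonneg _).trans (hM 0)
  have hn0 : 0 < n := hR.trans hn
  set Λ : ℝ := |log (R / 2)| + |log n| with hΛ
  have hΛ0 : 0 ≤ Λ := by positivity
  have hlog : ∀ r ∈ Icc (R / 2) n, |log r| ≤ Λ := by
    intro r hr
    have h1 : log (R / 2) ≤ log r := log_le_log (by positivity) hr.1
    have h2 : log r ≤ log n := log_le_log (by linarith [hr.1]) hr.2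
    rw [abs_le]
    constructor
    · linarith [neg_abs_le (log (R / 2)), abs_nonneg (log n)]
    · linarith [le_abs_self (log n), abs_nonneg (log (R / 2))]
  let v : ℝ → ℝ × ℝ → ℝ × ℝ := fun r y =>
    (r * f (y.1 + y.2 * log r) * log r, -(r * f (y.1 + y.2 * log r)))
  have hvb : ∀ r ∈ Icc (R / 2) n, ∀ y, ‖v r y‖ ≤ n * M * (1 + Λ) := by
    intro r hr y
    have hr0 : 0 < r := by linarith [hr.1]
    have h1 : |r * f (y.1 + y.2 * log r)| ≤ n * M := by
      rw [abs_mul, abs_of_pos hr0]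
      exact mul_le_mul hr.2 (hM _) (abs_nonneg _) hn0.le
    rw [Prod.norm_def]
    refine max_le ?_ ?_
    · simp only [v, Real.norm_eq_abs]
      rw [abs_mul]
      exact mul_le_mul h1 ((hlog r hr).trans (by linarith)) (abs_nonneg _) (by positivity)
    · simp only [v, Real.norm_eq_abs, abs_neg]
      exact h1.trans (le_mul_of_one_le_right (by positivity) (by linarith))
  have hvl : ∀ r ∈ Icc (R / 2) n, ∀ x y, dist (v r x) (v r y) ≤
      n * L * (1 + Λ) * (1 + Λ) * dist x y := by
    intro r hr x y
    have hr0 : 0 < r := by linarith [hr.1]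
    have hx1 : |x.1 - y.1| ≤ dist x y := by
      rw [Prod.dist_eq, ← Real.dist_eq]; exact le_max_left _ _
    have hx2 : |x.2 - y.2| ≤ dist x y := by
      rw [Prod.dist_eq, ← Real.dist_eq]; exact le_max_right _ _
    have h0 : |(x.1 + x.2 * log r) - (y.1 + y.2 * log r)| ≤ (1 + Λ) * dist x y := by
      rw [show (x.1 + x.2 * log r) - (y.1 + y.2 * log r) = (x.1 - y.1) + (x.2 - y.2) * log r by
        ring]
      refine (abs_add_le _ _).trans ?_
      rw [abs_mul]
      have := mul_le_mul hx2 (hlog r hr) (abs_nonneg _) dist_nonneg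
      linarith
    have h1 : |r * f (x.1 + x.2 * log r) - r * f (y.1 + y.2 * log r)|
        ≤ n * (L * ((1 + Λ) * dist x y)) := by
      rw [← mul_sub, abs_mul, abs_of_pos hr0]
      exact mul_le_mul hr.2 ((hf _ _).trans (mul_le_mul_of_nonneg_left h0 hL)) (abs_nonneg _)
        hn0.le
    have h2 : 0 ≤ n * (L * ((1 + Λ) * dist x y)) := by positivity
    rw [Prod.dist_eq]
    refine max_le ?_ ?_
    · simp only [v, Real.dist_eq]
      rw [← sub_mul, abs_mul]
      calc _ ≤ n * (L * ((1 + Λ) * dist x y)) * (1 + Λ) :=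
            mul_le_mul h1 ((hlog r hr).trans (by linarith)) (abs_nonneg _) h2
        _ = _ := by ring
    · simp only [v, Real.dist_eq]
      rw [← neg_sub', abs_neg]
      refine h1.trans ?_
      calc _ ≤ n * (L * ((1 + Λ) * dist x y)) * (1 + Λ) :=
            le_mul_of_one_le_right h2 (by linarith)
        _ = _ := by ring
  have hfc : Continuous f := by
    have : LipschitzWith L.toNNReal f := LipschitzWith.of_dist_le_mul fun x y => by
      rw [Real.coe_toNNReal _ hL]; simpa [Real.dist_eq] using hf x y
    exact this.continuous
  have hpl : IsPicardLindelof v (tmin := R / 2) (tmax := n) ⟨R, by constructor <;> linarith⟩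
      (a - b * R * log R, b * R) (n * M * (1 + Λ) * n).toNNReal 0 (n * M * (1 + Λ)).toNNReal
      (n * L * (1 + Λ) * (1 + Λ)).toNNReal := by
    refine ⟨fun t ht => ?_, fun x _ => ?_, fun t ht x _ => ?_, ?_⟩
    · refine LipschitzOnWith.of_dist_le_mul fun x _ y _ => ?_
      rw [Real.coe_toNNReal _ (by positivity)]
      exact hvl t ht x y
    · have hlc : ContinuousOn log (Icc (R / 2) n) := fun r hr =>
        (Real.continuousAt_log (by linarith [hr.1])).continuousWithinAt
      have hfl : ContinuousOn (fun r => f (x.1 + x.2 * log r)) (Icc (R / 2) n) :=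
        hfc.comp_continuousOn (by fun_prop)
      exact ((continuousOn_id.mul hfl).mul hlc).prodMk (continuousOn_id.mul hfl).neg
    · rw [Real.coe_toNNReal _ (by positivity)]
      exact hvb t ht x
    · rw [Real.coe_toNNReal _ (by positivity), Real.coe_toNNReal _ (by positivity)]
      simp only [NNReal.coe_zero, sub_zero]
      refine mul_le_mul_of_nonneg_left (max_le ?_ ?_) (by positivity) <;> linarith
  obtain ⟨α, hα0, hα⟩ := hpl.exists_eq_forall_mem_Icc_hasDerivWithinAt₀
  change α R = _ at hα0
  refine ⟨fun r => (α r).1 + (α r).2 * log r, fun r => (α r).2 / r, ?_, ?_, ?_⟩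
  · simp only [hα0]; ring
  · simp only [hα0]; field_simp
  · intro r hr
    have hr0 : 0 < r := by linarith [hr.1]
    have hd := (hα r (Ioo_subset_Icc_self hr)).hasDerivAt (Icc_mem_nhds hr.1 hr.2)
    have h1 : HasDerivAt (fun r => (α r).1) _ r := hd.fst
    have h2 : HasDerivAt (fun r => (α r).2) _ r := hd.snd
    constructor
    · refine (h1.add (h2.mul (hasDerivAt_log hr0.ne'))).congr_deriv ?_
      simp only [v]; field_simp; ring
    · refine (h2.div (hasDerivAt_id r) hr0.ne').congr_deriv ?_
      simp only [v, id]; field_simp; ring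

/-- The solutions on the intervals `(R / 2, R + n + 1)` agree with each other by uniqueness, so
they patch together to a solution on `(R / 2, ∞)`. -/
lemma exists_radial_global_of_bounded {f : ℝ → ℝ} {L M : ℝ} (hL : 0 ≤ L)
    (hf : ∀ x y, |f x - f y| ≤ L * |x - y|) (hM : ∀ x, |f x| ≤ M) {R : ℝ} (hR : 0 < R)
    (a b : ℝ) :
    ∃ φ ψ : ℝ → ℝ, φ R = a ∧ ψ R = b ∧ IsRadialSolution f φ ψ (Ioi (R / 2)) := by
  have hn : ∀ n : ℕ, R < R + n + 1 := fun n => by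
    have : (0 : ℝ) ≤ n := n.cast_nonneg
    linarith
  choose φ ψ h0 h1 hsol using fun n : ℕ => exists_radial_of_bounded hL hf hM hR a b (hn n)
  have hagree : ∀ m n : ℕ, m ≤ n → ∀ r ∈ Ioo (R / 2) (R + m + 1),
      φ m r = φ n r ∧ ψ m r = ψ n r := by
    intro m n hmn
    have hmn' : (m : ℝ) ≤ n := by exact_mod_cast hmn
    exact radial_unique_of_lipschitz (c := R / 2) (by positivity) le_rfl hL hf
      ⟨by linarith, hn m⟩ (hsol m) ((hsol n).mono (Ioo_subset_Ioo_right (by linarith)))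
      (by rw [h0, h0]) (by rw [h1, h1])
  have hagree' : ∀ m n : ℕ, ∀ r, R / 2 < r → r < R + m + 1 → r < R + n + 1 →
      φ m r = φ n r ∧ ψ m r = ψ n r := by
    intro m n r hr hm hn
    rcases le_total m n with h | h
    · exact hagree m n h r ⟨hr, hm⟩
    · exact ⟨(hagree n m h r ⟨hr, hn⟩).1.symm, (hagree n m h r ⟨hr, hn⟩).2.symm⟩
  refine ⟨fun r => φ ⌈r⌉₊ r, fun r => ψ ⌈r⌉₊ r, h0 _, h1 _, fun r hr => ?_⟩
  have hr' : R / 2 < r := hr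
  have hlt : ∀ x : ℝ, x < R + ⌈x⌉₊ + 1 := fun x => by linarith [Nat.le_ceil x]
  have hev : ∀ᶠ x in 𝓝 r, φ ⌈x⌉₊ x = φ ⌈r⌉₊ x ∧ ψ ⌈x⌉₊ x = ψ ⌈r⌉₊ x := by
    filter_upwards [Ioo_mem_nhds hr' (hlt r)] with x hx
    exact hagree' _ _ x hx.1 (hlt x) hx.2
  have hs := hsol ⌈r⌉₊ r ⟨hr', hlt r⟩
  exact ⟨hs.1.congr_of_eventuallyEq (hev.mono fun x hx => hx.1),
    hs.2.congr_of_eventuallyEq (hev.mono fun x hx => hx.2)⟩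

/-! ### The energy and global forward existence -/

lemma IsRadialSolution.hasDerivAt_energy {f F φ ψ : ℝ → ℝ} {S : Set ℝ}
    (h : IsRadialSolution f φ ψ S) (hF : ∀ s, HasDerivAt F (f s) s) {r : ℝ} (hr : r ∈ S) :
    HasDerivAt (fun r => ψ r ^ 2 / 2 + F (φ r)) (-(ψ r ^ 2 / r)) r := by
  have h1 := (((h r hr).2.pow 2).div_const 2).add ((hF (φ r)).comp r (h r hr).1)
  refine h1.congr_deriv ?_
  push_cast; ring

/-- The energy `φ'²/2 + F(φ)` of a radial solution is nonincreasing. -/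
lemma IsRadialSolution.energy_antitoneOn {f F φ ψ : ℝ → ℝ} {S : Set ℝ}
    (h : IsRadialSolution f φ ψ S) (hF : ∀ s, HasDerivAt F (f s) s) (hS : Convex ℝ S)
    (hpos : ∀ r ∈ S, 0 < r) :
    AntitoneOn (fun r => ψ r ^ 2 / 2 + F (φ r)) S := by
  refine antitoneOn_of_deriv_nonpos hS
    (fun r hr => (h.hasDerivAt_energy hF hr).continuousAt.continuousWithinAt)
    (fun r hr =>
      (h.hasDerivAt_energy hF (interior_subset hr)).differentiableAt.differentiableWithinAt)
    (fun r hr => ?_)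
  rw [(h.hasDerivAt_energy hF (interior_subset hr)).deriv]
  have := hpos r (interior_subset hr)
  rw [neg_nonpos]; positivity

/-- Global forward existence: if the initial energy is below the values of the potential `F` at
`±B`, then the solution exists for all `r ≥ R` and stays in `(-B, B)`. The nonlinearity is
truncated outside `[-B, B]`, and the energy prevents the solution from leaving this interval. -/
lemma exists_radial_forward {f F : ℝ → ℝ} (hf : ContDiff ℝ 1 f) (hF : ∀ s, HasDerivAt F (f s) s)
    {R a b B : ℝ} (hR : 0 < R) (haB : |a| < B) (hB : ∀ s, |s| = B → b ^ 2 / 2 + F a < F s) :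
    ∃ φ ψ : ℝ → ℝ, φ R = a ∧ ψ R = b ∧ IsRadialSolution f φ ψ (Ici R) ∧
      ∀ r, R ≤ r → |φ r| < B := by
  have hB0 : 0 < B := (abs_nonneg a).trans_lt haB
  obtain ⟨L, hL, hLip⟩ := exists_lipschitz_on_Icc hf B
  set c : ℝ → ℝ := fun s => max (-B) (min B s) with hc
  have hcm : ∀ s, c s ∈ Icc (-B) B := fun s =>
    ⟨le_max_left _ _, max_le (by linarith) (min_le_left _ _)⟩
  have hcid : ∀ s, |s| ≤ B → c s = s := fun s hs => by
    rw [abs_le] at hs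
    simp only [hc]; rw [min_eq_right hs.2, max_eq_right hs.1]
  have hcl : ∀ x y, |c x - c y| ≤ |x - y| := fun x y => by
    simp only [hc]
    rw [max_comm _ (min B x), max_comm _ (min B y), min_comm B x, min_comm B y]
    exact (abs_max_sub_max_le_abs _ _ _).trans (abs_inf_sub_inf_le_abs _ _ _)
  have hM : ∀ x, |f (c x)| ≤ |f 0| + L * B := fun x => by
    have h1 := hLip _ (hcm x) 0 ⟨by linarith, by linarith⟩
    have h2 : |c x - 0| ≤ B := by rw [sub_zero]; exact abs_le.mpr (hcm x)
    have h3 := abs_sub_abs_le_abs_sub (f (c x)) (f 0)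
    have h4 := mul_le_mul_of_nonneg_left h2 hL
    linarith
  obtain ⟨φ, ψ, h0, h1, hsol⟩ := exists_radial_global_of_bounded (f := fun s => f (c s)) hL
    (fun x y => (hLip _ (hcm x) _ (hcm y)).trans (mul_le_mul_of_nonneg_left (hcl x y) hL)) hM hR a b
  have hφc : ContinuousOn φ (Ici R) := fun r hr =>
    (hsol r (show R / 2 < r by
      have : R ≤ r := hr; linarith)).1.continuousAt.continuousWithinAt
  have hbd : ∀ r, R ≤ r → |φ r| < B := by
    by_contra! hcon
    obtain ⟨r₁, hr₁, hr₁B⟩ := hcon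
    -- the closed set of exit points has a least element
    set E : Set ℝ := Icc R r₁ ∩ (fun r => |φ r|) ⁻¹' (Ici B) with hE
    have hφc' : ContinuousOn (fun r => |φ r|) (Icc R r₁) := (hφc.mono Icc_subset_Ici_self).abs
    have hEc : IsClosed E := hφc'.preimage_isClosed_of_isClosed isClosed_Icc isClosed_Ici
    have hEcomp : IsCompact E := isCompact_Icc.of_isClosed_subset hEc inter_subset_left
    obtain ⟨r₂, hr₂, hmin⟩ := hEcomp.exists_isLeast ⟨r₁, ⟨hr₁, le_rfl⟩, hr₁B⟩
    have hr₂R : R ≤ r₂ := hr₂.1.1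
    have hlt : ∀ r, R ≤ r → r < r₂ → |φ r| < B := fun r hr hrr => by
      by_contra! hge
      exact absurd (hmin ⟨⟨hr, hrr.le.trans hr₂.1.2⟩, hge⟩) (not_le.mpr hrr)
    have hRr₂ : R < r₂ := by
      rcases hr₂R.lt_or_eq with h | h
      · exact h
      · exfalso
        have := hr₂.2
        rw [← h] at this
        simp only [mem_preimage, h0, mem_Ici] at this
        linarith
    have hle : |φ r₂| ≤ B := by
      have hcl : ContinuousWithinAt (fun r => |φ r|) (Iio r₂) r₂ :=
        ((hsol r₂ (by simp only [mem_Ioi]; linarith)).1.continuousAt.abs).continuousWithinAt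
      refine le_of_tendsto hcl ?_
      filter_upwards [Ioo_mem_nhdsLT hRr₂] with r hr
      exact (hlt r hr.1.le hr.2).le
    have hsol' : IsRadialSolution f φ ψ (Icc R r₂) := fun r hr => by
      have h := hsol r (by simp only [mem_Ioi]; linarith [hr.1])
      have : |φ r| ≤ B := by
        rcases hr.2.lt_or_eq with h | h
        · exact (hlt r hr.1 h).le
        · rw [h]; exact hle
      simpa only [hcid _ this] using h
    have hen := hsol'.energy_antitoneOn hF (convex_Icc _ _) (fun r hr => hR.trans_le hr.1)
      ⟨le_rfl, hr₂R⟩ ⟨hr₂R, le_rfl⟩ hr₂R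
    simp only [h0, h1] at hen
    have := hB (φ r₂) (le_antisymm hle hr₂.2)
    nlinarith [sq_nonneg (ψ r₂)]
  refine ⟨φ, ψ, h0, h1, fun r hr => ?_, hbd⟩
  have h := hsol r (by have : R ≤ r := hr; simp only [mem_Ioi]; linarith)
  simpa only [hcid _ (hbd r hr).le] using h

/-! ### Regularity and gluing -/

/-- Radial solutions for smooth nonlinearities are smooth. -/
lemma IsRadialSolution.contDiffOn {f φ ψ : ℝ → ℝ} {S : Set ℝ} (h : IsRadialSolution f φ ψ S)
    (hS : IsOpen S) (hpos : ∀ r ∈ S, 0 < r) (hf : ContDiff ℝ ∞ f) :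
    ContDiffOn ℝ ∞ φ S ∧ ContDiffOn ℝ ∞ ψ S := by
  have key : ∀ n : ℕ, ContDiffOn ℝ n φ S ∧ ContDiffOn ℝ n ψ S := by
    intro n
    induction n with
    | zero =>
      simp only [Nat.cast_zero, contDiffOn_zero]
      exact ⟨fun r hr => (h r hr).1.continuousAt.continuousWithinAt,
        fun r hr => (h r hr).2.continuousAt.continuousWithinAt⟩
    | succ n ih =>
      have h1 : ContDiffOn ℝ ((n : ℕ) + 1 : WithTop ℕ∞) φ S := by
        rw [contDiffOn_succ_iff_deriv_of_isOpen hS]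
        refine ⟨fun r hr => (h r hr).1.differentiableAt.differentiableWithinAt, by simp, ?_⟩
        exact ih.2.congr fun r hr => (h r hr).1.deriv
      have h2 : ContDiffOn ℝ ((n : ℕ) + 1 : WithTop ℕ∞) ψ S := by
        rw [contDiffOn_succ_iff_deriv_of_isOpen hS]
        refine ⟨fun r hr => (h r hr).2.differentiableAt.differentiableWithinAt, by simp, ?_⟩
        have hf' : ContDiff ℝ n f := hf.of_le (by exact_mod_cast le_top)
        refine ContDiffOn.congr (f := fun r => -ψ r / r - f (φ r)) ?_
          fun r hr => (h r hr).2.deriv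
        exact (ih.2.neg.div contDiffOn_id (fun r hr => (hpos r hr).ne')).sub
          (hf'.comp_contDiffOn ih.1)
      exact ⟨by exact_mod_cast h1, by exact_mod_cast h2⟩
  exact ⟨contDiffOn_infty.mpr fun n => (key n).1, contDiffOn_infty.mpr fun n => (key n).2⟩

lemma HasDerivAt.ite_le {u v : ℝ → ℝ} {d r : ℝ} (hu : HasDerivAt u d r) (hv : HasDerivAt v d r)
    (h : u r = v r) : HasDerivAt (fun x => if x ≤ r then u x else v x) d r := by
  have h1 : HasDerivWithinAt (fun x => if x ≤ r then u x else v x) d (Iic r) r :=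
    hu.hasDerivWithinAt.congr (fun x hx => if_pos hx) (if_pos le_rfl)
  have h2 : HasDerivWithinAt (fun x => if x ≤ r then u x else v x) d (Ici r) r := by
    refine hv.hasDerivWithinAt.congr (fun x hx => ?_) (by simp [h])
    rcases (show r ≤ x from hx).lt_or_eq with h' | h'
    · simp [not_le.mpr h']
    · simp [← h', h]
  have := h1.union h2
  rwa [Iic_union_Ici, hasDerivWithinAt_univ] at this

/-- Two solutions with the same Cauchy data at `R` can be glued there. -/
lemma IsRadialSolution.glue {f u p φ ψ : ℝ → ℝ} {R : ℝ} (h1 : IsRadialSolution f u p (Ioc 0 R))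
    (h2 : IsRadialSolution f φ ψ (Ici R)) (hφ : φ R = u R) (hψ : ψ R = p R) :
    IsRadialSolution f (fun r => if r ≤ R then u r else φ r)
      (fun r => if r ≤ R then p r else ψ r) (Ioi 0) := by
  intro r hr
  rcases lt_trichotomy r R with h | h | h
  · have e : ∀ᶠ x in 𝓝 r, x ≤ R := by filter_upwards [Iio_mem_nhds h] with x hx using le_of_lt hx
    simp only [h.le, if_true]
    exact ⟨(h1 r ⟨hr, h.le⟩).1.congr_of_eventuallyEq (e.mono fun x hx => if_pos hx),
      (h1 r ⟨hr, h.le⟩).2.congr_of_eventuallyEq (e.mono fun x hx => if_pos hx)⟩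
  · subst h
    simp only [le_refl, if_true]
    have a := h1 r ⟨hr, le_rfl⟩
    have b := h2 r self_mem_Ici
    rw [hφ, hψ] at b
    exact ⟨a.1.ite_le b.1 hφ.symm, a.2.ite_le b.2 hψ.symm⟩
  · have e : ∀ᶠ x in 𝓝 r, ¬ x ≤ R := by
      filter_upwards [Ioi_mem_nhds h] with x hx using not_le.mpr hx
    simp only [not_le.mpr h, if_false]
    exact ⟨(h2 r h.le).1.congr_of_eventuallyEq (e.mono fun x hx => if_neg hx),
      (h2 r h.le).2.congr_of_eventuallyEq (e.mono fun x hx => if_neg hx)⟩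

/-- A radial solution with a double zero at `b` vanishes identically to the left of `b`, by
backward uniqueness. -/
lemma IsRadialSolution.eq_zero_of_double_zero {f φ ψ : ℝ → ℝ} {a b : ℝ}
    (h : IsRadialSolution f φ ψ (Icc a b)) (ha : 0 < a) (hab : a ≤ b) (hf : ContDiff ℝ 1 f)
    (hf0 : f 0 = 0) (h0 : φ b = 0) (h1 : ψ b = 0) : φ a = 0 := by
  have hc : ContinuousOn φ (Icc a b) := fun r hr => (h r hr).1.continuousAt.continuousWithinAt
  have hc' : ContinuousOn ψ (Icc a b) := fun r hr => (h r hr).2.continuousAt.continuousWithinAt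
  obtain ⟨B, hB⟩ := isCompact_Icc.exists_bound_of_continuousOn hc
  obtain ⟨L, hL, hLip⟩ := exists_lipschitz_on_Icc hf B
  have hB0 : 0 ≤ B := (norm_nonneg _).trans (hB a ⟨le_rfl, hab⟩)
  have := ODE_solution_unique_of_mem_Icc_left (E := ℝ × ℝ) (v := radialField f)
    (K := (1 + 1 / a + L).toNNReal) (s := fun _ => Prod.fst ⁻¹' (Icc (-B) B))
    (f := fun r => (φ r, ψ r)) (g := fun r => (0, 0)) (a := a) (b := b)
    (fun t ht => lipschitzOnWith_radialField ha ht.1.le hL hLip)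
    (hc.prodMk hc')
    (fun t ht => ((h t (Ioc_subset_Icc_self ht)).1.prodMk
      (h t (Ioc_subset_Icc_self ht)).2).hasDerivWithinAt)
    (fun t ht => abs_le.mp (hB t (Ioc_subset_Icc_self ht)))
    continuousOn_const
    (fun t ht => by
      have : radialField f t (0, 0) = 0 := by simp [radialField, hf0]
      rw [this]; exact hasDerivWithinAt_const _ _ _)
    (fun t ht => by simp [hB0])
    (by simp [h0, h1]) (show a ∈ Icc a b from ⟨le_rfl, hab⟩)
  exact (Prod.ext_iff.mp this).1

/-! ### The profile near the singularity: a fixed point problem for the inverse function -/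

/-- The nonlinear remainder in the equation `h'' + 2 h = N(x, h, h')` for the correction `h` in
`-log r = x² / 2 + 2 log x + 4 / x² - 26 / x⁴ + h(x)`, where `x = u(r)`; here `y` stands for
`x⁻²`. -/
noncomputable def inverseNonlin (x y h p : ℝ) : ℝ :=
  -1 + 2 * y - 24 * y ^ 2 + 520 * y ^ 3
    + (1 + 2 * y - 8 * y ^ 2 + 104 * y ^ 3 + p / x) ^ 3 * exp (-8 * y + 52 * y ^ 2 - 2 * h)
      * (1 - exp (-x ^ 2)) + 2 * h

/-- The coefficients `4` and `-26` of the ansatz make the residual of order `x⁻⁶`. -/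
lemma exists_inverseNonlin_zero_le :
    ∃ C : ℝ, 0 < C ∧ ∀ x : ℝ, 10 ≤ x → |inverseNonlin x (x ^ 2)⁻¹ 0 0| ≤ C * (x ^ 2)⁻¹ ^ 3 := by
  have hPc : ContinuousOn (fun y : ℝ => 928 - 2600 * y + 17808 * y ^ 2 + 52320 * y ^ 3
      - 629248 * y ^ 4 + 4120320 * y ^ 5 - 3344640 * y ^ 6 - 36428288 * y ^ 7 + 317211648 * y ^ 8
      - 818900992 * y ^ 9 + 1520816128 * y ^ 10) (Icc 0 1) := by fun_prop
  obtain ⟨C, hC⟩ := isCompact_Icc.exists_bound_of_continuousOn hPc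
  have hC0 : 0 ≤ C := (norm_nonneg _).trans (hC 0 (by simp))
  refine ⟨C + 5000, by linarith, fun x hx => ?_⟩
  set y : ℝ := (x ^ 2)⁻¹ with hy
  have hx0 : 0 < x ^ 2 := by positivity
  have hy0 : 0 < y := by positivity
  have hy1 : y ≤ 1 / 100 := by
    rw [hy, one_div]; exact inv_anti₀ (by norm_num) (by nlinarith)
  have hyC := hC y ⟨hy0.le, by linarith⟩
  rw [Real.norm_eq_abs] at hyC
  have he : exp (-x ^ 2) ≤ 6 * y ^ 3 := by
    have h1 := Real.pow_div_factorial_le_exp (x ^ 2) hx0.le 3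
    rw [Real.exp_neg, hy, inv_pow, ← div_eq_mul_inv]
    rw [inv_le_comm₀ (exp_pos _) (by positivity), inv_div]
    norm_num [Nat.factorial] at h1
    exact h1
  set z : ℝ := -8 * y + 52 * y ^ 2 with hz
  have hz1 : |z| ≤ 8 * y := by rw [abs_le]; constructor <;> nlinarith
  have hz2 : |z| ≤ 1 := by linarith
  have hr := Real.exp_bound hz2 (n := 3) (by norm_num)
  simp only [Finset.sum_range_succ, Finset.sum_range_zero, Nat.factorial] at hr
  norm_num at hr
  have hr' : |exp z - (1 + z + z ^ 2 / 2)| ≤ 120 * y ^ 3 := by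
    have : |z| ^ 3 ≤ (8 * y) ^ 3 := pow_le_pow_left₀ (abs_nonneg _) hz1 3
    refine hr.trans ?_
    nlinarith [pow_pos hy0 3]
  set A : ℝ := 1 + 2 * y - 8 * y ^ 2 + 104 * y ^ 3 with hA
  have hA0 : 0 ≤ A := by rw [hA]; nlinarith [pow_pos hy0 3]
  have hA1 : A ≤ 2 := by rw [hA]; nlinarith [pow_pos hy0 3, pow_pos hy0 2]
  have hA3 : A ^ 3 ≤ 8 := by
    calc A ^ 3 ≤ 2 ^ 3 := pow_le_pow_left₀ hA0 hA1 3
      _ = 8 := by norm_num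
  have hA30 : 0 ≤ A ^ 3 := by positivity
  have hez : exp z ≤ 3 := by
    calc exp z ≤ exp 1 := exp_le_exp.mpr ((le_abs_self z).trans hz2)
      _ ≤ 3 := by linarith [Real.exp_one_lt_d9]
  have hsplit : inverseNonlin x y 0 0 =
      (A ^ 3 * (1 + z + z ^ 2 / 2) - 1 + 2 * y - 24 * y ^ 2 + 520 * y ^ 3)
      + A ^ 3 * (exp z - (1 + z + z ^ 2 / 2)) - A ^ 3 * exp z * exp (-x ^ 2) := by
    have : -8 * y + 52 * y ^ 2 - 2 * 0 = z := by rw [hz]; ring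
    simp only [inverseNonlin, this]
    rw [hA]; ring
  have hpoly : A ^ 3 * (1 + z + z ^ 2 / 2) - 1 + 2 * y - 24 * y ^ 2 + 520 * y ^ 3
      = y ^ 3 * (928 - 2600 * y + 17808 * y ^ 2 + 52320 * y ^ 3
      - 629248 * y ^ 4 + 4120320 * y ^ 5 - 3344640 * y ^ 6 - 36428288 * y ^ 7 + 317211648 * y ^ 8
      - 818900992 * y ^ 9 + 1520816128 * y ^ 10) := by
    rw [hA, hz]; ring
  rw [hsplit, hpoly]
  have hy3 : 0 < y ^ 3 := by positivity
  refine (abs_sub _ _).trans ?_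
  have b1 := abs_add_le (y ^ 3 * (928 - 2600 * y + 17808 * y ^ 2 + 52320 * y ^ 3
      - 629248 * y ^ 4 + 4120320 * y ^ 5 - 3344640 * y ^ 6 - 36428288 * y ^ 7 + 317211648 * y ^ 8
      - 818900992 * y ^ 9 + 1520816128 * y ^ 10)) (A ^ 3 * (exp z - (1 + z + z ^ 2 / 2)))
  rw [abs_mul, abs_mul, abs_of_pos hy3, abs_of_nonneg hA30] at b1
  have b2 : A ^ 3 * |exp z - (1 + z + z ^ 2 / 2)| ≤ 8 * (120 * y ^ 3) :=
    mul_le_mul hA3 hr' (abs_nonneg _) (by norm_num)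
  have b3 : |A ^ 3 * exp z * exp (-x ^ 2)| ≤ 8 * 3 * (6 * y ^ 3) := by
    rw [abs_of_nonneg (by positivity)]
    exact mul_le_mul (mul_le_mul hA3 hez (exp_pos _).le (by norm_num)) he (exp_pos _).le
      (by norm_num)
  have b4 := mul_le_mul_of_nonneg_left hyC hy3.le
  nlinarith

/-- Bound for the coefficient of `h'` in the Lipschitz estimate: `a₁, a₂` stand for two values of
the factor `1 + 2 y - … + h' / x`, `V` for the exponential and `κ` for `1 - exp (-x²)`, all of which
are `1 + O(y)`. -/
lemma cubic_factor_le {y κ V a₁ a₂ : ℝ} (hy0 : 0 < y) (hy1 : y ≤ 1 / 10000) (hκ1 : κ ≤ 1)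
    (hV0 : 0 ≤ V) (hV : V ≤ 1 + 18 * y) (h₁ : 0 ≤ a₁) (h₁' : a₁ ≤ 1 + 3 * y)
    (h₂ : 0 ≤ a₂) (h₂' : a₂ ≤ 1 + 3 * y) :
    κ * V * (a₁ ^ 2 + a₁ * a₂ + a₂ ^ 2) ≤ 31 / 10 := by
  have hsq : a₁ ^ 2 + a₁ * a₂ + a₂ ^ 2 ≤ 3 + 20 * y := by
    have g1 : a₁ ^ 2 ≤ (1 + 3 * y) ^ 2 := pow_le_pow_left₀ h₁ h₁' 2
    have g2 : a₂ ^ 2 ≤ (1 + 3 * y) ^ 2 := pow_le_pow_left₀ h₂ h₂' 2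
    have g3 : a₁ * a₂ ≤ (1 + 3 * y) * (1 + 3 * y) := mul_le_mul h₁' h₂' h₂ (by linarith)
    nlinarith
  have g1 : κ * V ≤ 1 * (1 + 18 * y) := mul_le_mul hκ1 hV hV0 (by norm_num)
  have g2 := mul_le_mul g1 hsq (by positivity) (by linarith)
  nlinarith

/-- The coefficient of `h` in the Lipschitz estimate is `O(y)`: the linearization in `h` of the
product of the cube and the exponential is cancelled to leading order by the summand `2 h` of the
remainder. -/
lemma abs_one_sub_cubic_factor_le {y κ a Z W : ℝ} (hy0 : 0 < y) (hy1 : y ≤ 1 / 10000)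
    (hκ0 : 1 - y ≤ κ) (hκ1 : κ ≤ 1) (ha : 1 - 3 * y ≤ a) (ha' : a ≤ 1 + 3 * y)
    (hZ : 1 - 16 * y ≤ Z) (hZ' : Z ≤ 1 + 16 * y) (hW : 1 - y ≤ W) (hW' : W ≤ 1 + y) :
    |1 - κ * a ^ 3 * Z * W| ≤ 40 * y := by
  have hκp : 0 ≤ κ := by linarith
  have ha0 : 0 ≤ a := by linarith
  have hZ0 : 0 ≤ Z := by linarith
  have hW0 : 0 ≤ W := by linarith
  have y3' : 0 ≤ y ^ 3 := by positivity
  have y3 : y ^ 3 ≤ y ^ 2 := by nlinarith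
  have y2 : y ^ 2 ≤ y / 10000 := by nlinarith
  have l : 1 - 10 * y ≤ a ^ 3 := by
    have : (1 - 3 * y) ^ 3 ≤ a ^ 3 := pow_le_pow_left₀ (by linarith) ha 3
    nlinarith
  have u : a ^ 3 ≤ 1 + 10 * y := by
    have : a ^ 3 ≤ (1 + 3 * y) ^ 3 := pow_le_pow_left₀ ha0 ha' 3
    nlinarith
  have l1 : 1 - 11 * y ≤ κ * a ^ 3 := by
    have := mul_le_mul hκ0 l (by linarith) hκp
    nlinarith
  have l2 : 1 - 27 * y ≤ κ * a ^ 3 * Z := by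
    have := mul_le_mul l1 hZ (by linarith) (by positivity)
    nlinarith
  have l3 : 1 - 28 * y ≤ κ * a ^ 3 * Z * W := by
    have := mul_le_mul l2 hW (by linarith) (by positivity)
    nlinarith
  have u1 : κ * a ^ 3 ≤ 1 + 10 * y := by
    have := mul_le_mul hκ1 u (by positivity) (by norm_num)
    linarith
  have u2 : κ * a ^ 3 * Z ≤ 1 + 27 * y := by
    have := mul_le_mul u1 hZ' hZ0 (by linarith)
    nlinarith
  have u3 : κ * a ^ 3 * Z * W ≤ 1 + 40 * y := by
    have := mul_le_mul u2 hW' hW0 (by linarith)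
    nlinarith
  rw [abs_le]
  constructor <;> linarith

/-- The remainder is Lipschitz in `(h, h')`, with a constant `O(x⁻²)` in `h` and a constant close
to `3 / x` in `h'`. -/
lemma inverseNonlin_lipschitz {x y h₁ h₂ p₁ p₂ : ℝ} (hx : 100 ≤ x) (hy : y = (x ^ 2)⁻¹)
    (hh₁ : |h₁| ≤ y ^ 2) (hh₂ : |h₂| ≤ y ^ 2) (hp₁ : |p₁| ≤ y ^ 2) (hp₂ : |p₂| ≤ y ^ 2) :
    |inverseNonlin x y h₁ p₁ - inverseNonlin x y h₂ p₂|
      ≤ 1000 * y * |h₁ - h₂| + 31 / 10 / x * |p₁ - p₂| := by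
  have hx0 : 0 < x := by linarith
  have hxx : (10000 : ℝ) ≤ x ^ 2 := by nlinarith
  have hy0 : 0 < y := by rw [hy]; positivity
  have hy1 : y ≤ 1 / 10000 := by
    rw [hy, one_div]; exact inv_anti₀ (by norm_num) hxx
  have hyy : y ^ 2 ≤ y / 10000 := by nlinarith
  set κ : ℝ := 1 - exp (-x ^ 2) with hκ
  have hκ1 : κ ≤ 1 := by rw [hκ]; linarith [exp_pos (-x ^ 2)]
  have hκ0 : 1 - y ≤ κ := by
    have : exp (-x ^ 2) ≤ y := by
      rw [Real.exp_neg, hy]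
      exact inv_anti₀ (by positivity) (by linarith [add_one_le_exp (x ^ 2)])
    rw [hκ]; linarith
  -- the cubic factor is close to one
  have hfac : ∀ p, |p| ≤ y ^ 2 →
      |1 + 2 * y - 8 * y ^ 2 + 104 * y ^ 3 + p / x - 1| ≤ 3 * y := by
    intro p hp
    have h1 : |p / x| ≤ y ^ 2 := by
      rw [abs_div, abs_of_pos hx0]
      exact (div_le_self (abs_nonneg _) (by linarith)).trans hp
    rw [abs_le] at h1 ⊢
    have : 0 ≤ y ^ 3 := by positivity
    have : y ^ 3 ≤ y ^ 2 := by nlinarith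
    constructor <;> nlinarith
  set a₁ := 1 + 2 * y - 8 * y ^ 2 + 104 * y ^ 3 + p₁ / x with ha₁
  set a₂ := 1 + 2 * y - 8 * y ^ 2 + 104 * y ^ 3 + p₂ / x with ha₂
  have f1 := abs_le.mp (hfac p₁ hp₁)
  have f2 := abs_le.mp (hfac p₂ hp₂)
  rw [← ha₁] at f1
  rw [← ha₂] at f2
  set z : ℝ := -8 * y + 52 * y ^ 2 with hz
  have hz1 : |z| ≤ 8 * y := by rw [abs_le]; constructor <;> nlinarith
  have ez1 := abs_le.mp (Real.abs_exp_sub_one_le (x := z) (by linarith))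
  have eh1 := abs_le.mp (Real.abs_exp_sub_one_le (x := z - 2 * h₁) (by
    have := abs_sub z (2 * h₁)
    rw [abs_mul, abs_two] at this
    linarith))
  have ezh : |z - 2 * h₁| ≤ 9 * y := by
    have := abs_sub z (2 * h₁)
    rw [abs_mul, abs_two] at this
    linarith
  set d := h₁ - h₂ with hd
  have hd1 : |d| ≤ 2 * y ^ 2 := by
    have := abs_sub h₁ h₂
    rw [hd]; linarith
  have ha2 := abs_le.mp (Real.abs_exp_sub_one_le (x := -2 * h₂) (by
    rw [abs_mul, abs_neg, abs_two]; linarith))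
  have hm2 : |(-2) * h₂| ≤ 2 * y ^ 2 := by
    rw [abs_mul, abs_neg, abs_two]; linarith
  have hed := Real.abs_exp_sub_one_sub_id_le (x := -2 * d) (by
    rw [abs_mul, abs_neg, abs_two]; linarith)
  have hsplit : inverseNonlin x y h₁ p₁ - inverseNonlin x y h₂ p₂ =
      κ * exp (z - 2 * h₁) * (a₁ ^ 2 + a₁ * a₂ + a₂ ^ 2) * ((p₁ - p₂) / x)
      + (κ * a₂ ^ 3 * exp z * exp (-2 * h₂) * (exp (-2 * d) - 1 - (-2 * d))
      + 2 * d * (1 - κ * a₂ ^ 3 * exp z * exp (-2 * h₂))) := by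
    have e1 : exp (z - 2 * h₁) = exp z * exp (-2 * h₂) * exp (-2 * d) := by
      rw [← exp_add, ← exp_add]; congr 1; rw [hd]; ring
    have e2 : exp (z - 2 * h₂) = exp z * exp (-2 * h₂) := by
      rw [← exp_add]; congr 1; ring
    have e3 : (p₁ - p₂) / x = a₁ - a₂ := by rw [ha₁, ha₂]; ring
    have e4 : (a₁ ^ 2 + a₁ * a₂ + a₂ ^ 2) * (a₁ - a₂) = a₁ ^ 3 - a₂ ^ 3 := by ring
    have e5 : ∀ p h, inverseNonlin x y h p = -1 + 2 * y - 24 * y ^ 2 + 520 * y ^ 3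
        + (1 + 2 * y - 8 * y ^ 2 + 104 * y ^ 3 + p / x) ^ 3 * exp (z - 2 * h) * κ + 2 * h :=
      fun p h => rfl
    rw [e5, e5, e3, ← ha₁, ← ha₂, mul_assoc (κ * _), e4, e1, e2, hd]
    ring
  -- elementary bounds on the factors
  have hκp : 0 ≤ κ := by linarith
  have A1 : 0 ≤ a₁ := by linarith
  have A2 : 0 ≤ a₂ := by linarith
  have A1' : a₁ ≤ 1 + 3 * y := by linarith
  have A2' : a₂ ≤ 1 + 3 * y := by linarith
  have E1 : exp (z - 2 * h₁) ≤ 1 + 18 * y := by linarith only [eh1.2, ezh]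
  have c1 : κ * exp (z - 2 * h₁) * (a₁ ^ 2 + a₁ * a₂ + a₂ ^ 2) ≤ 31 / 10 :=
    cubic_factor_le hy0 hy1 hκ1 (exp_pos _).le E1 A1 A1' A2 A2'
  have c1' : 0 ≤ κ * exp (z - 2 * h₁) * (a₁ ^ 2 + a₁ * a₂ + a₂ ^ 2) := by positivity
  have c2 : |1 - κ * a₂ ^ 3 * exp z * exp (-2 * h₂)| ≤ 40 * y :=
    abs_one_sub_cubic_factor_le hy0 hy1 hκ0 hκ1 (by linarith only [f2.1]) A2'
      (by linarith only [ez1.1, hz1]) (by linarith only [ez1.2, hz1])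
      (by linarith only [ha2.1, hm2, hyy, hy0]) (by linarith only [ha2.2, hm2, hyy, hy0])
  have c3 : |κ * a₂ ^ 3 * exp z * exp (-2 * h₂)| ≤ 2 := by
    have := abs_le.mp c2
    rw [abs_le]; constructor <;> linarith only [this.1, this.2, hy0, hy1]
  have hdd : (-2 * d) ^ 2 ≤ 8 * y ^ 2 * |d| := by
    have : (-2 * d) ^ 2 = 4 * (|d| * |d|) := by rw [abs_mul_abs_self]; ring
    rw [this]
    linarith only [mul_le_mul_of_nonneg_right hd1 (abs_nonneg d)]
  rw [hsplit]
  refine (abs_add_le _ _).trans ?_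
  rw [add_comm]
  refine add_le_add ((abs_add_le _ _).trans ?_) ?_
  · have g1 : |κ * a₂ ^ 3 * exp z * exp (-2 * h₂) * (exp (-2 * d) - 1 - (-2 * d))|
        ≤ 2 * (8 * y ^ 2 * |d|) := by
      rw [abs_mul]
      exact mul_le_mul c3 (hed.trans hdd) (abs_nonneg _) (by norm_num)
    have g2 : |2 * d * (1 - κ * a₂ ^ 3 * exp z * exp (-2 * h₂))| ≤ 2 * |d| * (40 * y) := by
      rw [abs_mul, abs_mul, abs_two]
      exact mul_le_mul_of_nonneg_left c2 (by positivity)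
    have := mul_le_mul_of_nonneg_right hyy (abs_nonneg d)
    linarith only [g1, g2, this, mul_nonneg hy0.le (abs_nonneg d)]
  · rw [abs_mul, abs_of_nonneg c1', abs_div, abs_of_pos hx0]
    calc _ ≤ 31 / 10 * (|p₁ - p₂| / x) := mul_le_mul_of_nonneg_right c1 (by positivity)
      _ = _ := by ring

/-- The contraction principle for continuous functions bounded by one. -/
lemma exists_fixed_of_contracting (Ψ : (ℝ → ℝ) → ℝ → ℝ) {k : ℝ} (hk : k < 1) (hk0 : 0 ≤ k)
    (hc : ∀ γ, Continuous γ → (∀ x, |γ x| ≤ 1) → Continuous (Ψ γ))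
    (hb : ∀ γ, Continuous γ → (∀ x, |γ x| ≤ 1) → ∀ x, |Ψ γ x| ≤ 1)
    (hl : ∀ γ₁ γ₂, Continuous γ₁ → (∀ x, |γ₁ x| ≤ 1) → Continuous γ₂ → (∀ x, |γ₂ x| ≤ 1) →
      ∀ D, (∀ x, |γ₁ x - γ₂ x| ≤ D) → ∀ x, |Ψ γ₁ x - Ψ γ₂ x| ≤ k * D) :
    ∃ γ, Continuous γ ∧ (∀ x, |γ x| ≤ 1) ∧ ∀ x, Ψ γ x = γ x := by
  let B : Set (BoundedContinuousFunction ℝ ℝ) := {γ | ∀ x, |γ x| ≤ 1}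
  have hB : IsClosed B := by
    have : B = ⋂ x, {γ : BoundedContinuousFunction ℝ ℝ | |γ x| ≤ 1} := by
      ext γ; simp [B]
    rw [this]
    refine isClosed_iInter fun x => isClosed_le ?_ continuous_const
    exact (continuous_eval_const x).abs
  have : CompleteSpace B := hB.completeSpace_coe
  have : Nonempty B := ⟨⟨0, fun x => by simp⟩⟩
  let T : B → B := fun γ =>
    ⟨BoundedContinuousFunction.ofNormedAddCommGroup (Ψ γ.1) (hc _ γ.1.continuous γ.2) 1
      (hb _ γ.1.continuous γ.2), hb _ γ.1.continuous γ.2⟩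
  have hT : ContractingWith k.toNNReal T := by
    refine ⟨by rw [Real.toNNReal_lt_one]; exact hk, LipschitzWith.of_dist_le_mul fun γ₁ γ₂ => ?_⟩
    rw [Real.coe_toNNReal _ hk0, Subtype.dist_eq, Subtype.dist_eq,
      BoundedContinuousFunction.dist_le (by positivity)]
    intro x
    exact hl _ _ γ₁.1.continuous γ₁.2 γ₂.1.continuous γ₂.2 _
      (fun x => by rw [← Real.dist_eq]; exact BoundedContinuousFunction.dist_coe_le_dist x) x
  have hfix := hT.fixedPoint_isFixedPt
  set γ := ContractingWith.fixedPoint T hT with hγ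
  refine ⟨γ.1, γ.1.continuous, γ.2, fun x => ?_⟩
  exact congrArg (fun g : B => g.1 x) hfix

/-- The solution of `h'' + 2 h = G` that decays at infinity. -/
noncomputable def decayingSol (G : ℝ → ℝ) (x : ℝ) : ℝ :=
  ∫ s in Ioi x, sin (√2 * (s - x)) / √2 * G s

/-- The derivative of `decayingSol`. -/
noncomputable def decayingSolDeriv (G : ℝ → ℝ) (x : ℝ) : ℝ :=
  -∫ s in Ioi x, cos (√2 * (s - x)) * G s

lemma hasDerivAt_integral_Ioi {F : ℝ → ℝ} (hF : Continuous F)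
    (hint : ∀ x, 0 < x → IntegrableOn F (Ioi x)) {x : ℝ} (hx : 0 < x) :
    HasDerivAt (fun x => ∫ s in Ioi x, F s) (-F x) x := by
  have h1 : HasDerivAt (fun y => (∫ s in Ioi x, F s) - ∫ s in x..y, F s) (-F x) x := by
    simpa using (intervalIntegral.integral_hasDerivAt_right (hF.intervalIntegrable _ _)
      hF.stronglyMeasurable.stronglyMeasurableAtFilter hF.continuousAt).const_sub _
  refine h1.congr_of_eventuallyEq ?_
  filter_upwards [Ioi_mem_nhds hx] with y hy
  rw [← intervalIntegral.integral_interval_add_Ioi (hint x hx) (hint y hy)]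
  ring

section decaying

variable {G : ℝ → ℝ} {A : ℝ}

lemma integrableOn_of_decay (hG : Continuous G) (hA : ∀ s, 1 ≤ s → |G s| ≤ A * (s ^ 5)⁻¹) {x : ℝ}
    {k : ℝ → ℝ} (hk : Continuous k) (hk1 : ∀ s, |k s| ≤ 1) (hx : 0 < x) :
    IntegrableOn (fun s => k s * G s) (Ioi x) := by
  have h1 : IntegrableOn (fun s => k s * G s) (Ioi (max x 1)) := by
    have hr : IntegrableOn (fun s : ℝ => A * s ^ (-5 : ℝ)) (Ioi (max x 1)) :=
      (integrableOn_Ioi_rpow_of_lt (by norm_num) (by positivity)).const_mul A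
    refine hr.mono' (hk.mul hG).aestronglyMeasurable ?_
    refine (ae_restrict_mem measurableSet_Ioi).mono fun s hs => ?_
    have hs1 : 1 ≤ s := (le_max_right x 1).trans (le_of_lt hs)
    have : s ^ (-5 : ℝ) = (s ^ 5)⁻¹ := by
      rw [Real.rpow_neg (by linarith)]; norm_cast
    rw [this, Real.norm_eq_abs, abs_mul]
    exact (mul_le_of_le_one_left (abs_nonneg _) (hk1 s)).trans (hA s hs1)
  have h2 : IntegrableOn (fun s => k s * G s) (Ioc x (max x 1)) :=
    ((hk.mul hG).integrableOn_Icc).mono_set Ioc_subset_Icc_self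
  have := h2.union h1
  rwa [Ioc_union_Ioi_eq_Ioi (le_max_left _ _)] at this

lemma abs_integral_le_of_decay (hA : ∀ s, 1 ≤ s → |G s| ≤ A * (s ^ 5)⁻¹) {x : ℝ}
    {k : ℝ → ℝ} (hk1 : ∀ s, |k s| ≤ 1) (hx : 1 ≤ x) :
    |∫ s in Ioi x, k s * G s| ≤ A * (x ^ 4)⁻¹ / 4 := by
  have hx0 : 0 < x := by linarith
  have hr : IntegrableOn (fun s : ℝ => A * s ^ (-5 : ℝ)) (Ioi x) :=
    (integrableOn_Ioi_rpow_of_lt (by norm_num) hx0).const_mul A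
  have h := norm_integral_le_of_norm_le (f := fun s => k s * G s) hr
    ((ae_restrict_mem measurableSet_Ioi).mono fun s hs => by
      have hs1 : 1 ≤ s := hx.trans (le_of_lt hs)
      have : s ^ (-5 : ℝ) = (s ^ 5)⁻¹ := by
        rw [Real.rpow_neg (by linarith)]; norm_cast
      rw [this, Real.norm_eq_abs, abs_mul]
      exact (mul_le_of_le_one_left (abs_nonneg _) (hk1 s)).trans (hA s hs1))
  rw [Real.norm_eq_abs, integral_const_mul, integral_Ioi_rpow_of_lt (by norm_num) hx0] at h
  refine h.trans (le_of_eq ?_)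
  have : x ^ ((-5 : ℝ) + 1) = (x ^ 4)⁻¹ := by
    rw [show (-5 : ℝ) + 1 = -4 by norm_num, Real.rpow_neg hx0.le]; norm_cast
  rw [this]; ring

lemma abs_decayingSol_le (hA : ∀ s, 1 ≤ s → |G s| ≤ A * (s ^ 5)⁻¹) {x : ℝ}
    (hx : 1 ≤ x) : |decayingSol G x| ≤ A * (x ^ 4)⁻¹ / 4 := by
  refine abs_integral_le_of_decay (k := fun s => sin (√2 * (s - x)) / √2) hA (fun s => ?_) hx
  rw [abs_div, abs_of_pos (by positivity : 0 < √2)]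
  have : (1 : ℝ) ≤ √2 := Real.one_le_sqrt.mpr (by norm_num)
  exact (div_le_self (abs_nonneg _) this).trans (abs_sin_le_one _)

lemma abs_decayingSolDeriv_le (hA : ∀ s, 1 ≤ s → |G s| ≤ A * (s ^ 5)⁻¹)
    {x : ℝ} (hx : 1 ≤ x) : |decayingSolDeriv G x| ≤ A * (x ^ 4)⁻¹ / 4 := by
  rw [decayingSolDeriv, abs_neg]
  exact abs_integral_le_of_decay (k := fun s => cos (√2 * (s - x))) hA
    (fun s => abs_cos_le_one _) hx

lemma hasDerivAt_decayingSol (hG : Continuous G) (hA : ∀ s, 1 ≤ s → |G s| ≤ A * (s ^ 5)⁻¹)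
    {x : ℝ} (hx : 0 < x) :
    HasDerivAt (decayingSol G) (decayingSolDeriv G x) x ∧
      HasDerivAt (decayingSolDeriv G) (G x - 2 * decayingSol G x) x := by
  have hs : ∀ x, 0 < x → IntegrableOn (fun s => sin (√2 * s) * G s) (Ioi x) := fun x hx =>
    integrableOn_of_decay hG hA (by fun_prop) (fun s => abs_sin_le_one _) hx
  have hc : ∀ x, 0 < x → IntegrableOn (fun s => cos (√2 * s) * G s) (Ioi x) := fun x hx =>
    integrableOn_of_decay hG hA (by fun_prop) (fun s => abs_cos_le_one _) hx
  have h2 : √2 ≠ 0 := by positivity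
  have hsq : √2 * √2 = 2 := Real.mul_self_sqrt (by norm_num)
  -- expanding the kernels by the addition formulas separates the variables
  have e1 : ∀ x, 0 < x → decayingSol G x = (cos (√2 * x) * (∫ s in Ioi x, sin (√2 * s) * G s)
      - sin (√2 * x) * ∫ s in Ioi x, cos (√2 * s) * G s) / √2 := by
    intro x hx
    rw [decayingSol, ← integral_const_mul, ← integral_const_mul,
      ← integral_sub ((hs x hx).const_mul _) ((hc x hx).const_mul _), ← integral_div]
    refine integral_congr_ae (Eventually.of_forall fun s => ?_)
    simp only [mul_sub, sin_sub]; ring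
  have e2 : ∀ x, 0 < x → decayingSolDeriv G x =
      -(cos (√2 * x) * (∫ s in Ioi x, cos (√2 * s) * G s)
      + sin (√2 * x) * ∫ s in Ioi x, sin (√2 * s) * G s) := by
    intro x hx
    rw [decayingSolDeriv, ← integral_const_mul, ← integral_const_mul,
      ← integral_add ((hc x hx).const_mul _) ((hs x hx).const_mul _)]
    congr 1
    refine integral_congr_ae (Eventually.of_forall fun s => ?_)
    simp only [mul_sub, cos_sub]; ring
  have dS := hasDerivAt_integral_Ioi (F := fun s => sin (√2 * s) * G s) (by fun_prop) hs hx
  have dC := hasDerivAt_integral_Ioi (F := fun s => cos (√2 * s) * G s) (by fun_prop) hc hx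
  have dlin : HasDerivAt (fun x : ℝ => √2 * x) √2 x := by
    simpa using (hasDerivAt_id x).const_mul √2
  have dsin := dlin.sin
  have dcos := dlin.cos
  have ev : ∀ᶠ y in 𝓝 x, 0 < y := Ioi_mem_nhds hx
  have hcs : cos (√2 * x) ^ 2 = 1 - sin (√2 * x) ^ 2 := by
    linarith [sin_sq_add_cos_sq (√2 * x)]
  constructor
  · refine HasDerivAt.congr_of_eventuallyEq ?_ (ev.mono e1)
    refine (((dcos.mul dS).sub (dsin.mul dC)).div_const _).congr_deriv ?_
    rw [e2 x hx]
    field_simp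
    ring
  · refine HasDerivAt.congr_of_eventuallyEq ?_ (ev.mono e2)
    refine ((dcos.mul dC).add (dsin.mul dS)).neg.congr_deriv ?_
    rw [e1 x hx]
    have : 2 * ((cos (√2 * x) * (∫ s in Ioi x, sin (√2 * s) * G s)
      - sin (√2 * x) * ∫ s in Ioi x, cos (√2 * s) * G s) / √2)
      = √2 * (cos (√2 * x) * (∫ s in Ioi x, sin (√2 * s) * G s)
      - sin (√2 * x) * ∫ s in Ioi x, cos (√2 * s) * G s) := by
      rw [mul_div_assoc', div_eq_iff h2, mul_right_comm, hsq]
    rw [this]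
    linear_combination (G x) * hcs

lemma decayingSol_sub {G₁ G₂ : ℝ → ℝ} {A₁ A₂ : ℝ} (hG₁ : Continuous G₁)
    (hA₁ : ∀ s, 1 ≤ s → |G₁ s| ≤ A₁ * (s ^ 5)⁻¹) (hG₂ : Continuous G₂)
    (hA₂ : ∀ s, 1 ≤ s → |G₂ s| ≤ A₂ * (s ^ 5)⁻¹) {x : ℝ} (hx : 0 < x) :
    decayingSol G₁ x - decayingSol G₂ x = decayingSol (fun s => G₁ s - G₂ s) x ∧
    decayingSolDeriv G₁ x - decayingSolDeriv G₂ x =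
      decayingSolDeriv (fun s => G₁ s - G₂ s) x := by
  have hk : ∀ s, |sin (√2 * (s - x)) / √2| ≤ 1 := fun s => by
    rw [abs_div, abs_of_pos (by positivity : 0 < √2)]
    have : (1 : ℝ) ≤ √2 := Real.one_le_sqrt.mpr (by norm_num)
    exact (div_le_self (abs_nonneg _) this).trans (abs_sin_le_one _)
  constructor
  · rw [decayingSol, decayingSol, decayingSol, ← integral_sub
      (integrableOn_of_decay hG₁ hA₁ (by fun_prop) hk hx)
      (integrableOn_of_decay hG₂ hA₂ (by fun_prop) hk hx)]
    simp only [mul_sub]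
  · rw [decayingSolDeriv, decayingSolDeriv, decayingSolDeriv, ← neg_sub', ← integral_sub
      (integrableOn_of_decay hG₁ hA₁ (by fun_prop) (fun s => abs_cos_le_one _) hx)
      (integrableOn_of_decay hG₂ hA₂ (by fun_prop) (fun s => abs_cos_le_one _) hx)]
    simp only [mul_sub]

end decaying

/-- The correction `h` exists for large `x`: contraction mapping for the weighted source
`γ = x⁵ N(x, h, h')`. -/
lemma exists_inverse_correction :
    ∃ X : ℝ, 100 ≤ X ∧ ∃ h p : ℝ → ℝ, ∀ x, X < x → HasDerivAt h (p x) x ∧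
      HasDerivAt p (inverseNonlin x (x ^ 2)⁻¹ (h x) (p x) - 2 * h x) x ∧
      |h x| ≤ (x ^ 2)⁻¹ ^ 2 ∧ |p x| ≤ (x ^ 2)⁻¹ ^ 2 := by
  obtain ⟨C, hC0, hC⟩ := exists_inverseNonlin_zero_le
  set X : ℝ := max 10000 (10 * C) with hX
  have hX1 : 10000 ≤ X := le_max_left _ _
  have hX2 : 10 * C ≤ X := le_max_right _ _
  -- the source with the weight removed
  let S : (ℝ → ℝ) → ℝ → ℝ := fun γ s => γ s * (max s 1 ^ 5)⁻¹
  have hmax : ∀ s : ℝ, (0 : ℝ) < max s 1 := fun s => by positivity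
  have hSc : ∀ γ, Continuous γ → Continuous (S γ) := fun γ hγ =>
    hγ.mul (Continuous.inv₀ (by fun_prop) (fun s => (pow_pos (hmax s) 5).ne'))
  have hSb : ∀ γ D, (∀ x, |γ x| ≤ D) → ∀ s, 1 ≤ s → |S γ s| ≤ D * (s ^ 5)⁻¹ := by
    intro γ D hγ s hs
    simp only [S, max_eq_left hs]
    rw [abs_mul, abs_of_pos (by positivity : (0 : ℝ) < (s ^ 5)⁻¹)]
    exact mul_le_mul_of_nonneg_right (hγ s) (by positivity)
  let Ψ₀ : (ℝ → ℝ) → ℝ → ℝ := fun γ x =>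
    x ^ 5 * inverseNonlin x (x ^ 2)⁻¹ (decayingSol (S γ) x) (decayingSolDeriv (S γ) x)
  let Ψ : (ℝ → ℝ) → ℝ → ℝ := fun γ x => Ψ₀ γ (max x X)
  have hpw : ∀ x : ℝ, (x ^ 4)⁻¹ = (x ^ 2)⁻¹ ^ 2 := fun x => by rw [inv_pow]; ring_nf
  have hbd : ∀ γ, Continuous γ → (∀ x, |γ x| ≤ 1) → ∀ x, X ≤ x →
      |decayingSol (S γ) x| ≤ (x ^ 2)⁻¹ ^ 2 ∧ |decayingSolDeriv (S γ) x| ≤ (x ^ 2)⁻¹ ^ 2 := by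
    intro γ hγ hγ1 x hx
    have hx4 : 0 ≤ (x ^ 4)⁻¹ := by positivity
    have h1 := abs_decayingSol_le (hSb γ 1 hγ1) (by linarith : 1 ≤ x)
    have h2 := abs_decayingSolDeriv_le (hSb γ 1 hγ1) (by linarith : 1 ≤ x)
    rw [← hpw]
    constructor <;> linarith
  have hlip : ∀ γ₁ γ₂, Continuous γ₁ → (∀ x, |γ₁ x| ≤ 1) → Continuous γ₂ → (∀ x, |γ₂ x| ≤ 1) →
      ∀ D, (∀ x, |γ₁ x - γ₂ x| ≤ D) → ∀ x, X ≤ x → |Ψ₀ γ₁ x - Ψ₀ γ₂ x| ≤ 4 / 5 * D := by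
    intro γ₁ γ₂ h1 h1' h2 h2' D hD x hx
    have hD0 : 0 ≤ D := (abs_nonneg _).trans (hD 0)
    have hx1 : 10000 ≤ x := hX1.trans hx
    have hx0 : 0 < x := by linarith
    obtain ⟨s1, s2⟩ := decayingSol_sub (hSc γ₁ h1) (hSb γ₁ 1 h1') (hSc γ₂ h2) (hSb γ₂ 1 h2') hx0
    have hS12 : (fun s => S γ₁ s - S γ₂ s) = S (fun s => γ₁ s - γ₂ s) := by
      funext s; simp only [S]; ring
    rw [hS12] at s1 s2
    have b1 := abs_decayingSol_le (hSb (fun s => γ₁ s - γ₂ s) D hD) (by linarith : 1 ≤ x)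
    have b2 := abs_decayingSolDeriv_le (hSb (fun s => γ₁ s - γ₂ s) D hD) (by linarith : 1 ≤ x)
    rw [← s1] at b1
    rw [← s2] at b2
    have hQ := inverseNonlin_lipschitz (x := x) (by linarith) rfl (hbd γ₁ h1 h1' x hx).1
      (hbd γ₂ h2 h2' x hx).1 (hbd γ₁ h1 h1' x hx).2 (hbd γ₂ h2 h2' x hx).2
    simp only [Ψ₀]
    rw [← mul_sub, abs_mul, abs_of_pos (by positivity : 0 < x ^ 5)]
    have hy0 : 0 < (x ^ 2)⁻¹ := by positivity
    calc _ ≤ x ^ 5 * (1000 * (x ^ 2)⁻¹ * (D * (x ^ 4)⁻¹ / 4)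
            + 31 / 10 / x * (D * (x ^ 4)⁻¹ / 4)) := by
          refine mul_le_mul_of_nonneg_left (hQ.trans ?_) (by positivity)
          gcongr
      _ = (1000 / x + 31 / 10) / 4 * D := by field_simp
      _ ≤ 4 / 5 * D := by
          refine mul_le_mul_of_nonneg_right ?_ hD0
          have : 1000 / x ≤ 1 / 10 := by rw [div_le_iff₀ hx0]; linarith
          linarith
  have hzero : ∀ x, X ≤ x → |Ψ₀ (fun _ => 0) x| ≤ 1 / 10 := by
    intro x hx
    have hx0 : 0 < x := by linarith
    have z1 : decayingSol (S fun _ => 0) x = 0 := by simp [decayingSol, S]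
    have z2 : decayingSolDeriv (S fun _ => 0) x = 0 := by simp [decayingSolDeriv, S]
    simp only [Ψ₀, z1, z2]
    rw [abs_mul, abs_of_pos (by positivity : 0 < x ^ 5)]
    calc _ ≤ x ^ 5 * (C * (x ^ 2)⁻¹ ^ 3) :=
          mul_le_mul_of_nonneg_left (hC x (by linarith)) (by positivity)
      _ = C / x := by field_simp
      _ ≤ 1 / 10 := by rw [div_le_iff₀ hx0]; linarith
  have hself : ∀ γ, Continuous γ → (∀ x, |γ x| ≤ 1) → ∀ x, X ≤ x → |Ψ₀ γ x| ≤ 1 := by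
    intro γ hγ hγ1 x hx
    have h1 := hlip γ (fun _ => 0) hγ hγ1 continuous_const (by simp) 1 (by simpa using hγ1) x hx
    have h2 := abs_sub_abs_le_abs_sub (Ψ₀ γ x) (Ψ₀ (fun _ => 0) x)
    have := hzero x hx
    linarith
  have hcont : ∀ γ, Continuous γ → (∀ x, |γ x| ≤ 1) → Continuous (Ψ γ) := by
    intro γ hγ hγ1
    have hh : ContinuousOn (decayingSol (S γ)) (Ici X) := fun x hx =>
      (hasDerivAt_decayingSol (hSc γ hγ) (hSb γ 1 hγ1)
        (by have : X ≤ x := hx; linarith)).1.continuousAt.continuousWithinAt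
    have hp : ContinuousOn (decayingSolDeriv (S γ)) (Ici X) := fun x hx =>
      (hasDerivAt_decayingSol (hSc γ hγ) (hSb γ 1 hγ1)
        (by have : X ≤ x := hx; linarith)).2.continuousAt.continuousWithinAt
    have hne : ∀ x ∈ Ici X, x ≠ 0 := fun x hx => by
      have : X ≤ x := hx
      intro h; linarith
    have hne2 : ∀ x ∈ Ici X, x ^ 2 ≠ 0 := fun x hx => pow_ne_zero 2 (hne x hx)
    have hΨ₀ : ContinuousOn (Ψ₀ γ) (Ici X) := by
      simp only [Ψ₀, inverseNonlin]
      have hy : ContinuousOn (fun x : ℝ => (x ^ 2)⁻¹) (Ici X) :=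
        ContinuousOn.inv₀ (by fun_prop) hne2
      have hpx : ContinuousOn (fun x => decayingSolDeriv (S γ) x / x) (Ici X) :=
        hp.div continuousOn_id hne
      fun_prop
    exact hΨ₀.comp_continuous (by fun_prop) (fun x => le_max_right x X)
  obtain ⟨γ, hγc, hγ1, hγ⟩ := exists_fixed_of_contracting Ψ (k := 4 / 5) (by norm_num)
    (by norm_num) hcont (fun γ hγ hγ1 x => hself γ hγ hγ1 _ (le_max_right _ _))
    (fun γ₁ γ₂ h1 h1' h2 h2' D hD x => hlip γ₁ γ₂ h1 h1' h2 h2' D hD _ (le_max_right _ _))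
  refine ⟨X, by linarith, decayingSol (S γ), decayingSolDeriv (S γ), fun x hx => ?_⟩
  have hx0 : 0 < x := by linarith
  have hd := hasDerivAt_decayingSol (hSc γ hγc) (hSb γ 1 hγ1) hx0
  refine ⟨hd.1, ?_, hbd γ hγc hγ1 x hx.le⟩
  have hSx : S γ x =
      inverseNonlin x (x ^ 2)⁻¹ (decayingSol (S γ) x) (decayingSolDeriv (S γ) x) := by
    have h1 := hγ x
    simp only [Ψ, Ψ₀, max_eq_left hx.le] at h1
    simp only [S, max_eq_left (by linarith : (1 : ℝ) ≤ x)]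
    rw [← h1, mul_comm (x ^ 5), mul_assoc, mul_inv_cancel₀ (by positivity), mul_one]
  rw [← hSx]
  exact hd.2

/-! ### Existence of a singular disk solution -/

/-- Inverting `t = x² / 2 + 2 log x + O(x⁻²)`. -/
lemma abs_sub_sqrt_le {x t ρ : ℝ} (hx : 100 ≤ x) (ht : t = x ^ 2 / 2 + 2 * log x + ρ)
    (hρ : |ρ| ≤ 5 * (x ^ 2)⁻¹) :
    x ≤ t ∧ |x - √(2 * t - 2 * log t - 2 * log 2)| ≤ 40 * (t ^ (-(3 / 2) : ℝ) * log t) := by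
  have hx0 : 0 < x := by linarith
  have hx2 : 0 < x ^ 2 := by positivity
  have hxx : 100 * x ≤ x ^ 2 := by nlinarith
  have hy1 : (x ^ 2)⁻¹ ≤ 1 / 10000 := by
    rw [one_div]; exact inv_anti₀ (by norm_num) (by nlinarith)
  have hy0 : 0 < (x ^ 2)⁻¹ := by positivity
  have hl1 : 1 ≤ log x := by
    rw [Real.le_log_iff_exp_le hx0]; linarith [Real.exp_one_lt_d9]
  have hl2 : log x ≤ x - 1 := Real.log_le_sub_one_of_pos hx0
  have hρ' := abs_le.mp hρ
  have hxt : x ≤ t := by rw [ht]; linarith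
  have htx : t ≤ x ^ 2 := by rw [ht]; linarith
  have ht0 : 0 < t := by linarith
  refine ⟨hxt, ?_⟩
  set z : ℝ := (4 * log x + 2 * ρ) * (x ^ 2)⁻¹ with hz
  have hz0 : 0 ≤ z := mul_nonneg (by linarith) hy0.le
  have h2t : 2 * t = x ^ 2 * (1 + z) := by rw [ht, hz]; field_simp; ring
  have hlog2t : log 2 + log t = 2 * log x + log (1 + z) := by
    rw [← log_mul (by norm_num) ht0.ne', h2t, log_mul hx2.ne' (by linarith), log_pow]
    norm_num
  have hlz0 : 0 ≤ log (1 + z) := log_nonneg (by linarith)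
  have hlz1 : log (1 + z) ≤ z := by linarith [Real.log_le_sub_one_of_pos (by linarith : 0 < 1 + z)]
  set q : ℝ := 2 * t - 2 * log t - 2 * log 2 with hq
  have hq1 : q - x ^ 2 = 2 * ρ - 2 * log (1 + z) := by
    rw [hq, ht] at *; linarith
  have hzle : z ≤ 5 * log x * (x ^ 2)⁻¹ := by
    rw [hz]; exact mul_le_mul_of_nonneg_right (by linarith) hy0.le
  have hly : (x ^ 2)⁻¹ ≤ log x * (x ^ 2)⁻¹ := le_mul_of_one_le_left hy0.le hl1
  have hqx : |x ^ 2 - q| ≤ 40 * (log x * (x ^ 2)⁻¹) := by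
    rw [abs_le]; constructor <;> linarith
  have hlx : log x * (x ^ 2)⁻¹ ≤ 1 := by
    rw [← div_eq_mul_inv, div_le_one hx2]; linarith
  have hq0 : 0 ≤ q := by
    have := (abs_le.mp hqx).2
    linarith
  have hsq : √q * √q = q := Real.mul_self_sqrt hq0
  have hfac : (x - √q) * (x + √q) = x ^ 2 - q := by linear_combination -hsq
  have hsum : x ≤ x + √q := by linarith [Real.sqrt_nonneg q]
  have h1 : |x - √q| * x ≤ 40 * (log x * (x ^ 2)⁻¹) := by
    calc |x - √q| * x ≤ |x - √q| * (x + √q) := mul_le_mul_of_nonneg_left hsum (abs_nonneg _)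
      _ = |x ^ 2 - q| := by rw [← hfac, abs_mul, abs_of_pos (by linarith : 0 < x + √q)]
      _ ≤ _ := hqx
  have h2 : |x - √q| ≤ 40 * ((x ^ 3)⁻¹ * log x) := by
    rw [← le_div_iff₀ hx0] at h1
    refine h1.trans (le_of_eq ?_)
    field_simp
  have h3 : (x ^ 3)⁻¹ ≤ t ^ (-(3 / 2) : ℝ) := by
    have : (x ^ 3)⁻¹ = (x ^ 2) ^ (-(3 / 2) : ℝ) := by
      rw [Real.rpow_neg hx2.le, ← Real.rpow_natCast x 2, ← Real.rpow_mul hx0.le]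
      norm_num
    rw [this]
    exact Real.rpow_le_rpow_of_nonpos ht0 htx (by norm_num)
  have h4 : log x ≤ log t := log_le_log hx0 hxt
  refine h2.trans (mul_le_mul_of_nonneg_left (mul_le_mul h3 h4 (by linarith) (by positivity)) ?_)
  norm_num

/-- The nonlinearity of the disk problem. -/
noncomputable def diskNonlin (s : ℝ) : ℝ := s * (exp (s ^ 2) - 1)

/-- The logarithmic radius `t = -log r` as a function of the value `x` of the solution solves the
equation of the inverse function; a solution of the radial equation near the origin results from
inverting it. -/
lemma exists_singular_near_zero :
    ∃ δ : ℝ, 0 < δ ∧ ∃ u ψ : ℝ → ℝ, IsRadialSolution diskNonlin u ψ (Ioo 0 δ) ∧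
      (∀ r ∈ Ioo 0 δ, 0 < u r ∧ ψ r < 0) ∧
      (fun r : ℝ => u r - √(-2 * log r - 2 * log (-log r) - 2 * log 2)) =O[𝓝[>] 0]
      (fun r : ℝ => (-log r) ^ (-(3 / 2) : ℝ) * log (-log r)) := by
  obtain ⟨X, hX, h, p, hhp⟩ := exists_inverse_correction
  let T : ℝ → ℝ := fun x => x ^ 2 / 2 + 2 * log x + (4 * (x ^ 2)⁻¹ - 26 * (x ^ 4)⁻¹ + h x)
  let T₁ : ℝ → ℝ := fun x => x + 2 * x⁻¹ - 8 * (x ^ 3)⁻¹ + 104 * (x ^ 5)⁻¹ + p x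
  let T₂ : ℝ → ℝ := fun x => T₁ x ^ 3 * exp (-2 * T x) * diskNonlin x
  have hT : ∀ x, X < x → HasDerivAt T (T₁ x) x := by
    intro x hx
    have hx0 : x ≠ 0 := by intro h0; linarith
    have hd := ((((hasDerivAt_pow 2 x).div_const 2).add ((hasDerivAt_log hx0).const_mul 2)).add
      (((((hasDerivAt_pow 2 x).inv (pow_ne_zero 2 hx0)).const_mul 4).sub
      (((hasDerivAt_pow 4 x).inv (pow_ne_zero 4 hx0)).const_mul 26)).add (hhp x hx).1))
    refine hd.congr_deriv ?_
    simp only [T₁]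
    push_cast
    field_simp
    ring
  have hT₁ : ∀ x, X < x → HasDerivAt T₁ (T₂ x) x := by
    intro x hx
    have hxp : 0 < x := by linarith
    have hx0 : x ≠ 0 := hxp.ne'
    have hd := (((((hasDerivAt_id x).add ((hasDerivAt_inv hx0).const_mul 2)).sub
      (((hasDerivAt_pow 3 x).inv (pow_ne_zero 3 hx0)).const_mul 8)).add
      (((hasDerivAt_pow 5 x).inv (pow_ne_zero 5 hx0)).const_mul 104)).add (hhp x hx).2.1)
    refine hd.congr_deriv ?_
    have hE : exp (-2 * T x) = exp (-x ^ 2) * (x ^ 4)⁻¹ *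
        exp (-8 * (x ^ 2)⁻¹ + 52 * (x ^ 2)⁻¹ ^ 2 - 2 * h x) := by
      have hx4 : (x ^ 4)⁻¹ = exp (-(4 * log x)) := by
        rw [Real.exp_neg, show 4 * log x = log (x ^ 4) by rw [log_pow]; norm_num,
          exp_log (by positivity)]
      rw [hx4, ← exp_add, ← exp_add]
      congr 1
      simp only [T]
      rw [show (x ^ 4)⁻¹ = (x ^ 2)⁻¹ ^ 2 by rw [inv_pow]; ring_nf]
      ring
    have hA : 1 + 2 * (x ^ 2)⁻¹ - 8 * (x ^ 2)⁻¹ ^ 2 + 104 * (x ^ 2)⁻¹ ^ 3 + p x / x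
        = T₁ x / x := by
      simp only [T₁]; field_simp
    have hexp : exp (-x ^ 2) * (exp (x ^ 2) - 1) = 1 - exp (-x ^ 2) := by
      rw [mul_sub, ← exp_add]; simp
    simp only [T₂, diskNonlin, inverseNonlin]
    rw [hA, hE, ← hexp]
    push_cast
    field_simp
    ring
  have hy : ∀ x, X < x → (x ^ 2)⁻¹ ≤ 1 / 10000 := fun x hx => by
    rw [one_div]; exact inv_anti₀ (by norm_num) (by nlinarith)
  have hT₁pos : ∀ x, X < x → 1 ≤ T₁ x := by
    intro x hx
    have hx0 : 0 < x := by linarith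
    have h1 := abs_le.mp (hhp x hx).2.2.2
    have h2 := hy x hx
    have h3 : 0 < (x ^ 2)⁻¹ := by positivity
    have h4 : (x ^ 3)⁻¹ ≤ 1 := inv_le_one_of_one_le₀ (one_le_pow₀ (by linarith))
    have h5 : 0 < (x ^ 5)⁻¹ := by positivity
    have h6 : 0 < x⁻¹ := by positivity
    simp only [T₁]
    nlinarith
  have hρ : ∀ x, X < x → |4 * (x ^ 2)⁻¹ - 26 * (x ^ 4)⁻¹ + h x| ≤ 5 * (x ^ 2)⁻¹ := by
    intro x hx
    have hx0 : 0 < x := by linarith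
    have h1 := abs_le.mp (hhp x hx).2.2.1
    have h2 := hy x hx
    have h3 : 0 < (x ^ 2)⁻¹ := by positivity
    rw [show (x ^ 4)⁻¹ = (x ^ 2)⁻¹ ^ 2 by rw [inv_pow]; ring_nf]
    rw [abs_le]
    constructor <;> nlinarith
  have hasym : ∀ x, X < x → x ≤ T x ∧ |x - √(2 * T x - 2 * log (T x) - 2 * log 2)|
      ≤ 40 * (T x ^ (-(3 / 2) : ℝ) * log (T x)) := fun x hx =>
    abs_sub_sqrt_le (by linarith) rfl (hρ x hx)
  -- extend `T` linearly to the left to obtain an order isomorphism of the line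
  set x₁ : ℝ := X + 1 with hx₁
  let Te : ℝ → ℝ := fun x => if x ≤ x₁ then T x₁ + (x - x₁) else T x
  have hTcont : ContinuousOn T (Ici x₁) := fun x hx =>
    (hT x (by have : x₁ ≤ x := hx; linarith)).continuousAt.continuousWithinAt
  have hTe_Ici : ∀ x, x₁ ≤ x → Te x = T x := by
    intro x hx
    rcases hx.lt_or_eq with h' | h'
    · simp [Te, not_le.mpr h']
    · simp [Te, ← h']
  have hTe_Iic : ∀ x, x ≤ x₁ → Te x = T x₁ + (x - x₁) := fun x hx => by simp [Te, hx]
  have hTmono : StrictMonoOn T (Ici x₁) := by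
    refine strictMonoOn_of_deriv_pos (convex_Ici _) hTcont fun x hx => ?_
    rw [interior_Ici] at hx
    have hx' : X < x := by have : x₁ < x := hx; linarith
    rw [(hT x hx').deriv]
    linarith [hT₁pos x hx']
  have hTe_mono : StrictMono Te := by
    refine StrictMonoOn.Iic_union_Ici (a := x₁) ?_ ?_
    · intro a ha b hb hab
      rw [hTe_Iic a ha, hTe_Iic b hb]; linarith
    · intro a ha b hb hab
      rw [hTe_Ici a ha, hTe_Ici b hb]; exact hTmono ha hb hab
  have hTe_cont : Continuous Te := by
    rw [← continuousOn_univ, ← Iic_union_Ici (a := x₁)]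
    refine ContinuousOn.union_of_isClosed ?_ ?_ isClosed_Iic isClosed_Ici
    · exact ContinuousOn.congr (f := fun x => T x₁ + (x - x₁)) (by fun_prop)
        fun x hx => hTe_Iic x hx
    · exact hTcont.congr fun x hx => hTe_Ici x hx
  have hTe_surj : Function.Surjective Te := by
    refine hTe_cont.surjective ?_ ?_
    · refine tendsto_atTop_mono' _ ?_ tendsto_id
      filter_upwards [eventually_ge_atTop x₁] with x hx
      rw [hTe_Ici x hx]
      exact (hasym x (by linarith)).1
    · have h1 : Tendsto (fun x => T x₁ + (x - x₁)) atBot atBot :=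
        tendsto_atBot_add_const_left _ _ (tendsto_atBot_add_const_right _ _ tendsto_id)
      refine h1.congr' ?_
      filter_upwards [eventually_le_atBot x₁] with x hx
      rw [hTe_Iic x hx]
  let e : ℝ ≃o ℝ := hTe_mono.orderIsoOfSurjective Te hTe_surj
  have he : ∀ x, e x = Te x := fun x => rfl
  let w : ℝ → ℝ := fun t => e.symm t
  have hwc : Continuous w := e.symm.continuous
  have hw1 : ∀ t, T x₁ < t → x₁ < w t := by
    intro t ht
    have : e.symm (e x₁) < e.symm t := by
      rw [e.symm.lt_iff_lt, he, hTe_Ici x₁ le_rfl]; exact ht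
    simpa using this
  have hw2 : ∀ t, T x₁ < t → T (w t) = t := by
    intro t ht
    rw [← hTe_Ici _ (hw1 t ht).le, ← he]
    exact e.apply_symm_apply t
  have hwd : ∀ t, T x₁ < t → HasDerivAt w (T₁ (w t))⁻¹ t := by
    intro t ht
    have hX' : X < w t := by linarith [hw1 t ht]
    refine HasDerivAt.of_local_left_inverse hwc.continuousAt (hT _ hX')
      (by linarith [hT₁pos _ hX']) ?_
    filter_upwards [Ioi_mem_nhds ht] with s hs using hw2 s hs
  refine ⟨exp (-T x₁), exp_pos _, fun r => w (-log r), fun r => -(r * T₁ (w (-log r)))⁻¹,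
    ?_, ?_, ?_⟩
  · intro r hr
    have hr0 : 0 < r := hr.1
    have ht : T x₁ < -log r := by
      have := (Real.log_lt_iff_lt_exp hr0).mpr hr.2
      linarith
    have hX' : X < w (-log r) := by linarith [hw1 _ ht]
    have hpos := hT₁pos _ hX'
    have hdw : HasDerivAt (fun r => w (-log r)) (-(r * T₁ (w (-log r)))⁻¹) r := by
      refine ((hwd _ ht).comp r (hasDerivAt_log hr0.ne').neg).congr_deriv ?_
      rw [mul_inv]; ring
    refine ⟨hdw, ?_⟩
    have hne : T₁ (w (-log r)) ≠ 0 := by linarith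
    have hdT : HasDerivAt (fun r => T₁ (w (-log r)))
        (T₂ (w (-log r)) * -(r * T₁ (w (-log r)))⁻¹) r :=
      HasDerivAt.comp (h₂ := T₁) (h := fun r => w (-log r)) r (hT₁ _ hX') hdw
    have hd1 : HasDerivAt (fun r => r * T₁ (w (-log r))) _ r := (hasDerivAt_id r).fun_mul hdT
    refine (hd1.fun_inv (mul_ne_zero hr0.ne' hne)).fun_neg.congr_deriv ?_
    have hrexp : exp (-2 * T (w (-log r))) = r ^ 2 := by
      rw [hw2 _ ht, show -2 * -log r = log (r ^ 2) by rw [log_pow]; push_cast; ring,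
        exp_log (by positivity)]
    simp only [id, T₂, hrexp]
    field_simp
    ring
  · intro r hr
    have hr0 : 0 < r := hr.1
    have ht : T x₁ < -log r := by
      have := (Real.log_lt_iff_lt_exp hr0).mpr hr.2
      linarith
    have hX' : X < w (-log r) := by linarith [hw1 _ ht]
    have hpos := hT₁pos _ hX'
    refine ⟨by linarith, ?_⟩
    rw [neg_lt_zero]
    positivity
  · refine IsBigO.of_bound 40 ?_
    filter_upwards [Ioo_mem_nhdsGT (exp_pos (-T x₁))] with r hr
    have hr0 : 0 < r := hr.1
    have ht : T x₁ < -log r := by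
      have := (Real.log_lt_iff_lt_exp hr0).mpr hr.2
      linarith
    have hX' : X < w (-log r) := by linarith [hw1 _ ht]
    have := (hasym _ hX').2
    rw [hw2 _ ht] at this
    rw [Real.norm_eq_abs, Real.norm_eq_abs, show -2 * log r = 2 * -log r by ring]
    exact this.trans (mul_le_mul_of_nonneg_left (le_abs_self _) (by norm_num))

/-- The primitive of the disk nonlinearity that vanishes at zero. -/
noncomputable def diskPotential (s : ℝ) : ℝ := (exp (s ^ 2) - 1 - s ^ 2) / 2

lemma hasDerivAt_diskPotential (s : ℝ) : HasDerivAt diskPotential (diskNonlin s) s := by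
  have h := (((hasDerivAt_pow 2 s).exp.sub_const 1).sub (hasDerivAt_pow 2 s)).div_const 2
  refine h.congr_deriv ?_
  simp only [diskNonlin]; push_cast; ring

lemma contDiff_diskNonlin : ContDiff ℝ ∞ diskNonlin := by
  unfold diskNonlin; fun_prop

lemma pow_four_le_diskPotential (s : ℝ) : s ^ 4 / 4 ≤ diskPotential s := by
  have := Real.quadratic_le_exp_of_nonneg (sq_nonneg s)
  simp only [diskPotential]; nlinarith

lemma diskNonlin_pos {s : ℝ} (hs : 0 < s) : 0 < diskNonlin s := by
  have : 1 < exp (s ^ 2) := Real.one_lt_exp_iff.mpr (by positivity)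
  exact mul_pos hs (by linarith)

lemma IsRadialSolution.hasDerivAt_flux {f φ ψ : ℝ → ℝ} {S : Set ℝ}
    (h : IsRadialSolution f φ ψ S) {r : ℝ} (hr : r ∈ S) (hr0 : 0 < r) :
    HasDerivAt (fun r => r * ψ r) (-(r * f (φ r))) r := by
  refine ((hasDerivAt_id r).mul (h r hr).2).congr_deriv ?_
  simp only [id]; field_simp; ring

/-- A decreasing solution of the disk problem reaches zero: as long as it is positive, the flux
`r v'` is nonincreasing, so that `v` lies below a decreasing multiple of the logarithm. -/
lemma IsRadialSolution.exists_first_zero {v q : ℝ → ℝ} {R : ℝ} (hR : 0 < R)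
    (h : IsRadialSolution diskNonlin v q (Ici R)) (hv : 0 < v R) (hq : q R < 0) :
    ∃ ρ, R < ρ ∧ v ρ = 0 ∧ q ρ < 0 ∧ ∀ r ∈ Ico R ρ, 0 < v r := by
  have hvc : ContinuousOn v (Ici R) := fun r hr => (h r hr).1.continuousAt.continuousWithinAt
  have hflux : ∀ b, (∀ r ∈ Ioo R b, 0 < v r) → AntitoneOn (fun r => r * q r) (Icc R b) := by
    intro b hpos
    refine antitoneOn_of_deriv_nonpos (convex_Icc _ _) (fun r hr => ?_) (fun r hr => ?_)
      (fun r hr => ?_)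
    · exact (h.hasDerivAt_flux hr.1 (hR.trans_le hr.1)).continuousAt.continuousWithinAt
    · rw [interior_Icc] at hr
      exact (h.hasDerivAt_flux hr.1.le
        (hR.trans hr.1)).differentiableAt.differentiableWithinAt
    · rw [interior_Icc] at hr
      have hr0 : 0 < r := hR.trans hr.1
      rw [(h.hasDerivAt_flux hr.1.le hr0).deriv, neg_nonpos]
      exact mul_nonneg hr0.le (diskNonlin_pos (hpos r hr)).le
  have hbelow : ∀ b, R ≤ b → (∀ r ∈ Ioo R b, 0 < v r) →
      v b ≤ v R + R * q R * (log b - log R) := by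
    intro b hb hpos
    have hanti : AntitoneOn (fun r => v r - R * q R * log r) (Icc R b) := by
      have hd : ∀ r, R ≤ r → HasDerivAt (fun r => v r - R * q R * log r)
          (q r - R * q R * r⁻¹) r := fun r hr =>
        (h r hr).1.sub ((hasDerivAt_log (hR.trans_le hr).ne').const_mul _)
      refine antitoneOn_of_deriv_nonpos (convex_Icc _ _) (fun r hr => ?_) (fun r hr => ?_)
        (fun r hr => ?_)
      · exact (hd r hr.1).continuousAt.continuousWithinAt
      · rw [interior_Icc] at hr
        exact (hd r hr.1.le).differentiableAt.differentiableWithinAt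
      · rw [interior_Icc] at hr
        have hr0 : 0 < r := hR.trans hr.1
        rw [(hd r hr.1.le).deriv, sub_nonpos, ← div_eq_mul_inv, le_div_iff₀ hr0, mul_comm]
        exact hflux b hpos ⟨le_rfl, hb⟩ ⟨hr.1.le, hr.2.le⟩ hr.1.le
    have := hanti ⟨le_rfl, hb⟩ ⟨hb, le_rfl⟩ hb
    simp only at this
    linarith
  have hneg : R * q R < 0 := mul_neg_of_pos_of_neg hR hq
  obtain ⟨b, hbR, hvb⟩ : ∃ b, R ≤ b ∧ v b ≤ 0 := by
    by_contra! hcon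
    -- the upper bound vanishes at this radius
    set b := exp (log R + v R / (-(R * q R))) with hb
    have hRb : R ≤ b := by
      rw [hb, ← Real.log_le_iff_le_exp hR]
      have : 0 ≤ v R / (-(R * q R)) := div_nonneg hv.le (by linarith)
      linarith
    have h1 := hbelow b hRb (fun r hr => hcon r hr.1.le)
    have h2 := hcon b hRb
    have h3 : R * q R * (log b - log R) = -v R := by
      rw [hb, log_exp, add_sub_cancel_left]
      rw [div_neg, mul_neg, mul_div_assoc', mul_div_cancel_left₀ _ hneg.ne]
    linarith
  set E : Set ℝ := Icc R b ∩ v ⁻¹' (Iic 0) with hE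
  have hEc : IsClosed E := (hvc.mono Icc_subset_Ici_self).preimage_isClosed_of_isClosed
    isClosed_Icc isClosed_Iic
  obtain ⟨ρ, hρ, hmin⟩ := (isCompact_Icc.of_isClosed_subset hEc inter_subset_left).exists_isLeast
    ⟨b, ⟨hbR, le_rfl⟩, hvb⟩
  have hRρ : R < ρ := by
    rcases hρ.1.1.lt_or_eq with h | h
    · exact h
    · exfalso; have := hρ.2; rw [← h] at this; exact absurd hv (not_lt.mpr this)
  have hpos : ∀ r ∈ Ico R ρ, 0 < v r := by
    intro r hr
    by_contra! hle
    exact absurd (hmin ⟨⟨hr.1, hr.2.le.trans hρ.1.2⟩, hle⟩) (not_le.mpr hr.2)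
  refine ⟨ρ, hRρ, ?_, ?_, hpos⟩
  · refine le_antisymm hρ.2 ?_
    have hcw : ContinuousWithinAt v (Iio ρ) ρ := (h ρ hRρ.le).1.continuousAt.continuousWithinAt
    refine ge_of_tendsto hcw ?_
    filter_upwards [Ioo_mem_nhdsLT hRρ] with r hr using (hpos r ⟨hr.1.le, hr.2⟩).le
  · have h1 : ρ * q ρ ≤ R * q R := hflux ρ (fun r hr => hpos r ⟨hr.1.le, hr.2⟩) ⟨le_rfl, hRρ.le⟩
      ⟨hRρ.le, le_rfl⟩ hRρ.le
    by_contra! hcon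
    have := mul_nonneg (hR.trans hRρ).le hcon
    linarith

theorem exists_singularDiskSolution : ∃ (Rinf : ℝ) (u : ℝ → ℝ), IsSingularDiskSolution Rinf u := by
  obtain ⟨δ, hδ, u₀, ψ₀, hsol₀, hsign, hasym⟩ := exists_singular_near_zero
  set R : ℝ := δ / 2 with hR
  have hR0 : 0 < R := by positivity
  have hRδ : R < δ := by linarith
  obtain ⟨hu₀R, hψ₀R⟩ := hsign R ⟨hR0, hRδ⟩
  set B : ℝ := 1 + |u₀ R| + 4 * (ψ₀ R ^ 2 / 2 + diskPotential (u₀ R)) with hB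
  have hpot : 0 ≤ diskPotential (u₀ R) :=
    le_trans (by positivity) (pow_four_le_diskPotential _)
  have hE0 : 0 ≤ ψ₀ R ^ 2 / 2 + diskPotential (u₀ R) := by positivity
  obtain ⟨φ, ψ, hφR, hψR, hsol, -⟩ := exists_radial_forward (F := diskPotential)
    (contDiff_diskNonlin.of_le (by exact_mod_cast le_top)) hasDerivAt_diskPotential
    (a := u₀ R) (b := ψ₀ R) (B := B) hR0 (by rw [hB]; linarith) (fun s hs => by
      have h1 := pow_four_le_diskPotential s
      have hB1 : 1 + 4 * (ψ₀ R ^ 2 / 2 + diskPotential (u₀ R)) ≤ B := by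
        rw [hB]; linarith [abs_nonneg (u₀ R)]
      have h2 : B ≤ s ^ 4 := by
        have : s ^ 4 = B ^ 4 := by rw [← hs]; exact (Even.pow_abs (by decide) s).symm
        rw [this]
        exact le_self_pow₀ (by linarith) (by norm_num)
      linarith)
  have hglue := (hsol₀.mono (fun r hr => ⟨hr.1, hr.2.trans_lt hRδ⟩ :
    Ioc 0 R ⊆ Ioo 0 δ)).glue hsol hφR hψR
  set v : ℝ → ℝ := fun r => if r ≤ R then u₀ r else φ r with hv
  set q : ℝ → ℝ := fun r => if r ≤ R then ψ₀ r else ψ r with hq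
  have hvR : v R = u₀ R := by simp [hv]
  have hqR : q R = ψ₀ R := by simp [hq]
  have hvc : ContinuousOn v (Ioi 0) := fun r hr =>
    (hglue r hr).1.continuousAt.continuousWithinAt
  obtain ⟨ρ, hRρ, hvρ, -, hpos'⟩ := (hglue.mono (fun r hr => hR0.trans_le hr :
    Ici R ⊆ Ioi 0)).exists_first_zero hR0 (hvR ▸ hu₀R) (hqR ▸ hψ₀R)
  have hpos : ∀ r ∈ Ioo 0 ρ, 0 < v r := by
    intro r hr
    by_cases h : r ≤ R
    · simp only [hv, h, if_true]
      exact (hsign r ⟨hr.1, h.trans_lt hRδ⟩).1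
    · exact hpos' r ⟨(not_le.mp h).le, hr.2⟩
  have hρ0 : 0 < ρ := hR0.trans hRρ
  have hsub : Ioo 0 ρ ⊆ Ioi (0 : ℝ) := fun r hr => hr.1
  refine ⟨ρ, v, hρ0, ((hglue.mono hsub).contDiffOn isOpen_Ioo (fun r hr => hr.1)
    contDiff_diskNonlin).1, fun r hr => ?_, hpos, hvc.mono (fun r hr => hr.1), hvρ, ?_⟩
  · have hd1 : deriv v =ᶠ[𝓝 r] q := by
      filter_upwards [Ioi_mem_nhds hr.1] with s hs using (hglue s hs).1.deriv
    rw [hd1.deriv_eq, hd1.eq_of_nhds, (hglue r hr.1).2.deriv]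
    simp only [diskNonlin]; ring
  · refine hasym.congr' ?_ EventuallyEq.rfl
    filter_upwards [Ioo_mem_nhdsGT hR0] with r hr
    simp only [hv, hr.2.le, if_true]

/-! ### Properties of singular disk solutions -/

namespace IsSingularDiskSolution

variable {Rinf : ℝ} {u : ℝ → ℝ}

lemma isRadialSolution (h : IsSingularDiskSolution Rinf u) :
    IsRadialSolution diskNonlin u (deriv u) (Ioo 0 Rinf) := by
  intro r hr
  have hc : ContDiffAt ℝ ∞ u r := h.smooth.contDiffAt (isOpen_Ioo.mem_nhds hr)
  have hd : ContDiffOn ℝ ∞ (deriv u) (Ioo 0 Rinf) := h.smooth.deriv_of_isOpen isOpen_Ioo (by simp)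
  refine ⟨(hc.differentiableAt (by simp)).hasDerivAt, ?_⟩
  have h2 := ((hd.contDiffAt (isOpen_Ioo.mem_nhds hr)).differentiableAt (by simp)).hasDerivAt
  refine h2.congr_deriv ?_
  have := h.ode r hr
  simp only [diskNonlin]
  linear_combination -this

/-- Two-sided bounds of order `√(-log r)` near the origin. -/
lemma eventually_bounds (h : IsSingularDiskSolution Rinf u) :
    ∃ C : ℝ, ∀ᶠ r in 𝓝[>] (0 : ℝ), √(-log r - 1) - C ≤ u r ∧ u r ≤ √(2 * -log r) + C := by
  obtain ⟨C, hC⟩ := h.asymptotic.bound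
  have hlog : Tendsto (fun r : ℝ => -log r) (𝓝[>] 0) atTop :=
    tendsto_neg_atBot_atTop.comp tendsto_log_nhdsGT_zero
  refine ⟨|C|, ?_⟩
  filter_upwards [hC, hlog.eventually_ge_atTop 1] with r hr ht
  set t := -log r with htdef
  have ht0 : 0 < t := by linarith
  rw [Real.norm_eq_abs, Real.norm_eq_abs, show -2 * log r = 2 * t by rw [htdef]; ring] at hr
  have hlt0 : 0 ≤ log t := log_nonneg ht
  have hb : |t ^ (-(3 / 2) : ℝ) * log t| ≤ 1 := by
    rw [abs_of_nonneg (mul_nonneg (by positivity) hlt0)]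
    have h1 : t ^ (-(3 / 2) : ℝ) ≤ t ^ (-1 : ℝ) :=
      Real.rpow_le_rpow_of_exponent_le ht (by norm_num)
    have h2 : log t ≤ t := (Real.log_le_sub_one_of_pos ht0).trans (by linarith)
    calc _ ≤ t ^ (-1 : ℝ) * t := mul_le_mul h1 h2 hlt0 (by positivity)
      _ = 1 := by rw [Real.rpow_neg_one, inv_mul_cancel₀ ht0.ne']
  have hr' : |u r - √(2 * t - 2 * log t - 2 * log 2)| ≤ |C| :=
    hr.trans ((mul_le_mul_of_nonneg_right (le_abs_self C) (abs_nonneg _)).trans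
      (mul_le_of_le_one_right (abs_nonneg _) hb))
  have hl2 : 0 < log 2 := log_pos (by norm_num)
  have hl2' : log 2 < 0.6931471808 := Real.log_two_lt_d9
  have h1 : √(2 * t - 2 * log t - 2 * log 2) ≤ √(2 * t) := Real.sqrt_le_sqrt (by linarith)
  have h2 : √(t - 1) ≤ √(2 * t - 2 * log t - 2 * log 2) := by
    refine Real.sqrt_le_sqrt ?_
    have := Real.log_le_sub_one_of_pos (by linarith : 0 < t / 2)
    rw [log_div ht0.ne' (by norm_num)] at this
    linarith
  have := abs_le.mp hr'
  constructor <;> linarith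

lemma tendsto_atTop (h : IsSingularDiskSolution Rinf u) : Tendsto u (𝓝[>] 0) atTop := by
  obtain ⟨C, hC⟩ := h.eventually_bounds
  have hlog : Tendsto (fun r : ℝ => -log r) (𝓝[>] 0) atTop :=
    tendsto_neg_atBot_atTop.comp tendsto_log_nhdsGT_zero
  have h1 : Tendsto (fun r : ℝ => √(-log r - 1) - C) (𝓝[>] 0) atTop :=
    tendsto_atTop_add_const_right _ (-C)
      (Real.tendsto_sqrt_atTop.comp (tendsto_atTop_add_const_right _ (-1) hlog))
  exact tendsto_atTop_mono' _ (hC.mono fun r hr => hr.1) h1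

lemma antitoneOn_flux (h : IsSingularDiskSolution Rinf u) :
    AntitoneOn (fun r => r * deriv u r) (Ioo 0 Rinf) := by
  have hd := fun r (hr : r ∈ Ioo 0 Rinf) => h.isRadialSolution.hasDerivAt_flux hr hr.1
  refine antitoneOn_of_deriv_nonpos (convex_Ioo _ _)
    (fun r hr => (hd r hr).continuousAt.continuousWithinAt)
    (fun r hr => (hd r (interior_subset hr)).differentiableAt.differentiableWithinAt)
    (fun r hr => ?_)
  have hr' := interior_subset hr
  rw [(hd r hr').deriv, neg_nonpos]
  exact mul_nonneg hr'.1.le (diskNonlin_pos (h.pos r hr')).le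

/-- A point with `u' ≥ 0` would force `u` to be bounded near the origin. -/
lemma deriv_neg (h : IsSingularDiskSolution Rinf u) {r₀ : ℝ} (hr₀ : r₀ ∈ Ioo 0 Rinf) :
    deriv u r₀ < 0 := by
  by_contra! hcon
  have hmono : MonotoneOn u (Ioc 0 r₀) := by
    have hsub : ∀ r ∈ Ioc 0 r₀, r ∈ Ioo 0 Rinf := fun r hr => ⟨hr.1, hr.2.trans_lt hr₀.2⟩
    refine monotoneOn_of_deriv_nonneg (convex_Ioc _ _)
      (fun r hr => (h.isRadialSolution r (hsub r hr)).1.continuousAt.continuousWithinAt)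
      (fun r hr => (h.isRadialSolution r
        (hsub r (interior_subset hr))).1.differentiableAt.differentiableWithinAt)
      (fun r hr => ?_)
    have hr' := interior_subset hr
    have h1 : r₀ * deriv u r₀ ≤ r * deriv u r := h.antitoneOn_flux (hsub r hr') hr₀ hr'.2
    exact nonneg_of_mul_nonneg_right ((mul_nonneg hr₀.1.le hcon).trans h1) hr'.1
  obtain ⟨r, hr1, hr2⟩ := ((h.tendsto_atTop.eventually_gt_atTop (u r₀)).and
    (Ioo_mem_nhdsGT hr₀.1)).exists
  exact absurd (hmono ⟨hr2.1, hr2.2.le⟩ ⟨hr₀.1, le_rfl⟩ hr2.2.le) (not_le.mpr hr1)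

/-- The flux `r u'` vanishes at the origin: otherwise `u` would grow like `-log r`. This is why the
singularity is invisible to the distributional Laplacian. -/
lemma tendsto_flux (h : IsSingularDiskSolution Rinf u) :
    Tendsto (fun r => r * deriv u r) (𝓝[>] 0) (𝓝 0) := by
  rw [Metric.tendsto_nhds]
  intro ε hε
  obtain ⟨r₁, hr₁, hr₁ε⟩ : ∃ r₁ ∈ Ioo 0 Rinf, -ε < r₁ * deriv u r₁ := by
    by_contra! hcon
    set r₀ := Rinf / 2 with hr₀def
    have hr₀ : r₀ ∈ Ioo 0 Rinf := ⟨by linarith [h.radius_pos], by linarith [h.radius_pos]⟩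
    have hanti : AntitoneOn (fun r => u r + ε * log r) (Ioc 0 r₀) := by
      have hsub : ∀ r ∈ Ioc 0 r₀, r ∈ Ioo 0 Rinf := fun r hr => ⟨hr.1, hr.2.trans_lt hr₀.2⟩
      have hd : ∀ r ∈ Ioc 0 r₀, HasDerivAt (fun r => u r + ε * log r)
          (deriv u r + ε * r⁻¹) r := fun r hr =>
        (h.isRadialSolution r (hsub r hr)).1.add ((hasDerivAt_log hr.1.ne').const_mul _)
      refine antitoneOn_of_deriv_nonpos (convex_Ioc _ _)
        (fun r hr => (hd r hr).continuousAt.continuousWithinAt)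
        (fun r hr => (hd r (interior_subset hr)).differentiableAt.differentiableWithinAt)
        (fun r hr => ?_)
      have hr' := interior_subset hr
      rw [(hd r hr').deriv]
      have h1 := hcon r (hsub r hr')
      have h2 : deriv u r ≤ -ε / r := by rw [le_div_iff₀ hr'.1]; linarith
      calc deriv u r + ε * r⁻¹ ≤ -ε / r + ε * r⁻¹ := by linarith
        _ = 0 := by ring
    obtain ⟨C, hC⟩ := h.eventually_bounds
    have hlog : Tendsto (fun r : ℝ => -log r) (𝓝[>] 0) atTop :=
      tendsto_neg_atBot_atTop.comp tendsto_log_nhdsGT_zero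
    set K := u r₀ + ε * log r₀ with hK
    -- for large `t`, the linear growth `K + ε t` beats `√(2 t) + C`
    set t₀ : ℝ := 1 + (8 / ε ^ 2 + 2 * (|C| + |K|) / ε) with ht₀
    obtain ⟨r, ⟨hr1, hr2⟩, hr3⟩ := ((hC.and (hlog.eventually_ge_atTop t₀)).and
      (Ioo_mem_nhdsGT hr₀.1)).exists
    have h1 : K ≤ u r + ε * log r := hanti ⟨hr3.1, hr3.2.le⟩ ⟨hr₀.1, le_rfl⟩ hr3.2.le
    set t := -log r with ht
    have hε2 : 0 < ε ^ 2 := by positivity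
    have ht1 : 0 < t := by
      have : 0 ≤ 8 / ε ^ 2 + 2 * (|C| + |K|) / ε := by positivity
      linarith
    have h2 : √(2 * t) ≤ ε * t / 2 := by
      rw [Real.sqrt_le_left (by positivity)]
      have : 8 / ε ^ 2 ≤ t := by
        have : 0 ≤ 2 * (|C| + |K|) / ε := by positivity
        linarith
      rw [div_le_iff₀ hε2] at this
      nlinarith
    have h3 : |C| + |K| < ε * t / 2 := by
      have : 2 * (|C| + |K|) / ε < t := by
        have : 0 < 8 / ε ^ 2 := by positivity
        linarith
      rw [div_lt_iff₀ hε] at this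
      linarith
    have h4 : ε * log r = -(ε * t) := by rw [ht]; ring
    linarith [hr1.2, le_abs_self C, neg_abs_le K]
  filter_upwards [Ioo_mem_nhdsGT hr₁.1] with r hr
  have hr' : r ∈ Ioo 0 Rinf := ⟨hr.1, hr.2.trans hr₁.2⟩
  have h1 : r₁ * deriv u r₁ ≤ r * deriv u r := h.antitoneOn_flux hr' hr₁ hr.2.le
  have h2 : r * deriv u r < 0 := mul_neg_of_pos_of_neg hr.1 (h.deriv_neg hr')
  rw [Real.dist_eq, sub_zero, abs_lt]
  constructor <;> linarith

lemma strictAntiOn (h : IsSingularDiskSolution Rinf u) : StrictAntiOn u (Ioc 0 Rinf) := by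
  refine strictAntiOn_of_deriv_neg (convex_Ioc _ _) h.continuousOn fun r hr => ?_
  rw [interior_Ioc] at hr
  exact h.deriv_neg hr

lemma exists_eq_two (h : IsSingularDiskSolution Rinf u) :
    ∃ R ∈ Ioo 0 Rinf, u R = 2 ∧ ∀ r ∈ Ioo 0 Rinf, u r = 2 → r = R := by
  obtain ⟨a, ha1, ha2⟩ := ((h.tendsto_atTop.eventually_gt_atTop 2).and
    (Ioo_mem_nhdsGT h.radius_pos)).exists
  obtain ⟨R, hR, hR2⟩ := intermediate_value_Icc' ha2.2.le
    (h.continuousOn.mono fun r hr => ⟨ha2.1.trans_le hr.1, hr.2⟩)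
    (show (2 : ℝ) ∈ Icc (u Rinf) (u a) from ⟨by rw [h.boundary]; norm_num, ha1.le⟩)
  have hRlt : R < Rinf := by
    refine lt_of_le_of_ne hR.2 fun he => ?_
    rw [he, h.boundary] at hR2; norm_num at hR2
  have hR' : R ∈ Ioo 0 Rinf := ⟨ha2.1.trans_le hR.1, hRlt⟩
  exact ⟨R, hR', hR2, fun r hr hr2 =>
    h.strictAntiOn.injOn ⟨hr.1, hr.2.le⟩ ⟨hR'.1, hR'.2.le⟩ (hr2.trans hR2.symm)⟩

end IsSingularDiskSolution

/-! ### The nonlinearity with mass and its potential -/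

lemma IsCutoff.antitoneOn {χ : ℝ → ℝ} (hχ : IsCutoff χ) : AntitoneOn χ (Ici 0) := by
  have hd : Differentiable ℝ χ := hχ.smooth.differentiable (by simp)
  refine antitoneOn_of_deriv_nonpos (convex_Ici 0) hd.continuous.continuousOn
    hd.differentiableOn fun t ht => ?_
  rw [interior_Ici] at ht
  exact nonpos_of_mul_nonpos_right (hχ.mul_deriv_nonpos t) ht

lemma IsCutoff.monotoneOn {χ : ℝ → ℝ} (hχ : IsCutoff χ) : MonotoneOn χ (Iic 0) := by
  have hd : Differentiable ℝ χ := hχ.smooth.differentiable (by simp)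
  refine monotoneOn_of_deriv_nonneg (convex_Iic 0) hd.continuous.continuousOn
    hd.differentiableOn fun t ht => ?_
  rw [interior_Iic] at ht
  have := hχ.mul_deriv_nonpos t
  by_contra! hcon
  exact absurd (mul_pos_of_neg_of_neg ht hcon) (not_lt.mpr this)

lemma IsCutoff.mem_Icc {χ : ℝ → ℝ} (hχ : IsCutoff χ) (t : ℝ) : χ t ∈ Icc (0 : ℝ) 1 := by
  have h0 : χ 0 = 1 := hχ.eq_one 0 (by simp)
  rcases le_total 0 t with h | h
  · have h1 : χ (max t 2) = 0 := hχ.eq_zero _ ((le_max_right t 2).trans (le_abs_self _))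
    exact ⟨h1 ▸ hχ.antitoneOn h (h.trans (le_max_left _ _)) (le_max_left _ _),
      h0 ▸ hχ.antitoneOn (self_mem_Ici) h h⟩
  · have h1 : χ (min t (-2)) = 0 := hχ.eq_zero _ (by
      rw [abs_of_nonpos ((min_le_left _ _).trans h)]; linarith [min_le_right t (-2)])
    exact ⟨h1 ▸ hχ.monotoneOn ((min_le_left _ _).trans h) h (min_le_left _ _),
      h0 ▸ hχ.monotoneOn h (self_mem_Iic) h⟩

/-- The primitive of `s ↦ χ(s) s` that vanishes at zero. -/
noncomputable def cutoffPotential (χ : ℝ → ℝ) (s : ℝ) : ℝ := ∫ t in (0 : ℝ)..s, χ t * t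

/-- The primitive of `nonlin χ m` that vanishes at zero. -/
noncomputable def massPotential (χ : ℝ → ℝ) (m s : ℝ) : ℝ :=
  diskPotential s - m * cutoffPotential χ s

section cutoff

variable {χ : ℝ → ℝ}

lemma hasDerivAt_cutoffPotential (hχ : IsCutoff χ) (s : ℝ) :
    HasDerivAt (cutoffPotential χ) (χ s * s) s := by
  have hc : Continuous fun t => χ t * t := hχ.smooth.continuous.mul continuous_id
  exact intervalIntegral.integral_hasDerivAt_right (hc.intervalIntegrable _ _)
    hc.stronglyMeasurable.stronglyMeasurableAtFilter hc.continuousAt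

lemma hasDerivAt_massPotential (hχ : IsCutoff χ) (m s : ℝ) :
    HasDerivAt (massPotential χ m) (nonlin χ m s) s := by
  refine ((hasDerivAt_diskPotential s).sub
    ((hasDerivAt_cutoffPotential hχ s).const_mul m)).congr_deriv ?_
  simp only [nonlin, diskNonlin]; ring

lemma contDiff_nonlin (hχ : IsCutoff χ) (m : ℝ) : ContDiff ℝ ∞ (nonlin χ m) := by
  have := hχ.smooth
  unfold nonlin
  fun_prop

lemma cutoffPotential_le (hχ : IsCutoff χ) (s : ℝ) : cutoffPotential χ s ≤ s ^ 2 / 2 := by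
  have hd : ∀ s, HasDerivAt (fun s => s ^ 2 / 2 - cutoffPotential χ s) (s * (1 - χ s)) s :=
    fun s => (((hasDerivAt_pow 2 s).div_const 2).sub
      (hasDerivAt_cutoffPotential hχ s)).congr_deriv (by push_cast; ring)
  have hc : Continuous (fun s => s ^ 2 / 2 - cutoffPotential χ s) :=
    continuous_iff_continuousAt.mpr fun s => (hd s).continuousAt
  have h0 : cutoffPotential χ 0 = 0 := by simp [cutoffPotential]
  rcases le_total 0 s with h | h
  · have hm : MonotoneOn (fun s => s ^ 2 / 2 - cutoffPotential χ s) (Ici 0) := by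
      refine monotoneOn_of_deriv_nonneg (convex_Ici 0) hc.continuousOn
        (fun s _ => (hd s).differentiableAt.differentiableWithinAt) fun s hs => ?_
      rw [interior_Ici] at hs
      rw [(hd s).deriv]
      exact mul_nonneg (le_of_lt hs) (by linarith [(hχ.mem_Icc s).2])
    have := hm (self_mem_Ici) h h
    simp only [h0] at this
    linarith
  · have hm : AntitoneOn (fun s => s ^ 2 / 2 - cutoffPotential χ s) (Iic 0) := by
      refine antitoneOn_of_deriv_nonpos (convex_Iic 0) hc.continuousOn
        (fun s _ => (hd s).differentiableAt.differentiableWithinAt) fun s hs => ?_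
      rw [interior_Iic] at hs
      rw [(hd s).deriv]
      exact mul_nonpos_of_nonpos_of_nonneg (le_of_lt hs) (by linarith [(hχ.mem_Icc s).2])
    have := hm h (self_mem_Iic) h
    simp only [h0] at this
    linarith

lemma half_le_cutoffPotential_two (hχ : IsCutoff χ) : 1 / 2 ≤ cutoffPotential χ 2 := by
  have hc : Continuous fun t => χ t * t := hχ.smooth.continuous.mul continuous_id
  have h1 : ∫ t in (0 : ℝ)..1, χ t * t = 1 / 2 := by
    rw [intervalIntegral.integral_congr (g := fun t => t)]
    · simp [integral_id]
    · intro t ht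
      rw [uIcc_of_le zero_le_one] at ht
      simp only
      rw [hχ.eq_one t (by rw [abs_of_nonneg ht.1]; exact ht.2), one_mul]
  have h2 : 0 ≤ ∫ t in (1 : ℝ)..2, χ t * t :=
    intervalIntegral.integral_nonneg (by norm_num) fun t ht =>
      mul_nonneg (hχ.mem_Icc t).1 (by linarith [ht.1])
  rw [cutoffPotential, ← intervalIntegral.integral_add_adjacent_intervals
    (hc.intervalIntegrable 0 1) (hc.intervalIntegrable 1 2), h1]
  linarith

lemma le_massPotential (hχ : IsCutoff χ) {m : ℝ} (hm : 0 ≤ m) (s : ℝ) :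
    s ^ 4 / 4 - m * (s ^ 2 / 2) ≤ massPotential χ m s := by
  have h1 := mul_le_mul_of_nonneg_left (cutoffPotential_le hχ s) hm
  have h2 := pow_four_le_diskPotential s
  simp only [massPotential]; linarith

lemma massPotential_zero (m : ℝ) : massPotential χ m 0 = 0 := by
  simp [massPotential, diskPotential, cutoffPotential]

/-- On positive values, `nonlin χ m s / s` is strictly increasing. Hence where the potential
is nonnegative, the nonlinearity has already become positive. -/
lemma nonlin_pos_of_massPotential_nonneg (hχ : IsCutoff χ) {m s : ℝ} (hm : 0 ≤ m) (hs : 0 < s)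
    (hF : 0 ≤ massPotential χ m s) : 0 < nonlin χ m s := by
  by_contra! hcon
  have hfac : ∀ t, nonlin χ m t = t * (exp (t ^ 2) - 1 - m * χ t) := fun t => by
    simp only [nonlin]; ring
  rw [hfac] at hcon
  have hcs : exp (s ^ 2) - 1 - m * χ s ≤ 0 := nonpos_of_mul_nonpos_right hcon hs
  have hanti : StrictAntiOn (massPotential χ m) (Icc 0 s) := by
    refine strictAntiOn_of_deriv_neg (convex_Icc 0 s)
      (fun t _ => (hasDerivAt_massPotential hχ m t).continuousAt.continuousWithinAt)
      fun t ht => ?_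
    rw [interior_Icc] at ht
    rw [(hasDerivAt_massPotential hχ m t).deriv, hfac]
    have h1 : exp (t ^ 2) < exp (s ^ 2) :=
      exp_lt_exp.mpr (pow_lt_pow_left₀ ht.2 ht.1.le two_ne_zero)
    have h2 := mul_le_mul_of_nonneg_left (hχ.antitoneOn ht.1.le hs.le ht.2.le) hm
    exact mul_neg_of_pos_of_neg ht.1 (by linarith)
  have := hanti ⟨le_rfl, hs.le⟩ ⟨hs.le, le_rfl⟩ hs
  rw [massPotential_zero] at this
  linarith

lemma nonlin_eq_diskNonlin (hχ : IsCutoff χ) (m : ℝ) {s : ℝ} (hs : 2 ≤ s) :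
    nonlin χ m s = diskNonlin s := by
  simp [nonlin, diskNonlin, hχ.eq_zero s (hs.trans (le_abs_self s))]

end cutoff

/-! ### The family of shooting solutions -/

/-- A family of solutions, parametrized by the mass `m ≥ 0`, with common Cauchy data
`(2, b)` at `R`, and with a bound on `[R, ∞)` that is locally uniform in `m`. -/
structure IsShootingFamily (χ : ℝ → ℝ) (R b : ℝ) (φ ψ : ℝ → ℝ → ℝ) : Prop where
  sol : ∀ m, 0 ≤ m → IsRadialSolution (nonlin χ m) (φ m) (ψ m) (Ioi 0)
  init : ∀ m, 0 ≤ m → φ m R = 2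
  init_deriv : ∀ m, 0 ≤ m → ψ m R = b
  bound : ∃ B, ∀ m, 0 ≤ m → ∀ r, R ≤ r → |φ m r| ≤ B + 2 * m

/-- For every mass, the potential at height `B = 3 + 2 E₀ + 2 m` exceeds an upper bound `E₀` of the
initial energy, which gives global existence. -/
lemma exists_shooting {χ : ℝ → ℝ} (hχ : IsCutoff χ) {R : ℝ} (hR : 0 < R) (b : ℝ) {m : ℝ}
    (hm : 0 ≤ m) :
    ∃ φ ψ : ℝ → ℝ, φ R = 2 ∧ ψ R = b ∧ IsRadialSolution (nonlin χ m) φ ψ (Ici R) ∧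
      ∀ r, R ≤ r → |φ r| < 3 + 2 * (b ^ 2 / 2 + diskPotential 2) + 2 * m := by
  have hpot : 0 ≤ diskPotential 2 := le_trans (by positivity) (pow_four_le_diskPotential 2)
  set E₀ : ℝ := b ^ 2 / 2 + diskPotential 2 with hE₀
  have hE : 0 ≤ E₀ := by positivity
  refine exists_radial_forward ((contDiff_nonlin hχ m).of_le (by exact_mod_cast le_top))
    (hasDerivAt_massPotential hχ m) hR ?_ fun s hs => ?_
  · rw [abs_of_pos two_pos]; linarith
  · have h1 := le_massPotential hχ hm s
    have h2 : massPotential χ m 2 ≤ diskPotential 2 := by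
      have := mul_nonneg hm (by linarith [half_le_cutoffPotential_two hχ] :
        0 ≤ cutoffPotential χ 2)
      simp only [massPotential]; linarith
    set B : ℝ := 3 + 2 * E₀ + 2 * m with hB
    have hs2 : s ^ 2 = B ^ 2 := by rw [← hs, sq_abs]
    have hs4 : s ^ 4 = B ^ 2 * B ^ 2 := by rw [← hs2]; ring
    rw [hs4, hs2] at h1
    have hB3 : 3 ≤ B := by linarith
    have h3 : 3 * B ≤ B ^ 2 := by nlinarith
    have h4 : 9 / 4 * (2 * E₀ + 3) ≤ B ^ 2 / 4 * (B ^ 2 - 2 * m) := by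
      refine mul_le_mul (by nlinarith) (by linarith) (by linarith) (by positivity)
    nlinarith

/-- The shooting solutions extending a singular disk solution. -/
lemma IsSingularDiskSolution.exists_shootingFamily {Rinf : ℝ} {u χ : ℝ → ℝ}
    (hu : IsSingularDiskSolution Rinf u) (hχ : IsCutoff χ) {R : ℝ} (hR : R ∈ Ioo 0 Rinf)
    (huR : u R = 2) :
    ∃ φ ψ, IsShootingFamily χ R (deriv u R) φ ψ ∧
      ∀ m, 0 ≤ m → ∀ r ∈ Ioc 0 R, φ m r = u r ∧ ψ m r = deriv u r := by
  have hinner : ∀ m, IsRadialSolution (nonlin χ m) u (deriv u) (Ioc 0 R) := by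
    intro m r hr
    have h := hu.isRadialSolution r ⟨hr.1, hr.2.trans_lt hR.2⟩
    have h2 : 2 ≤ u r := huR ▸ hu.strictAntiOn.antitoneOn ⟨hr.1, hr.2.trans hR.2.le⟩
      ⟨hR.1, hR.2.le⟩ hr.2
    rwa [← nonlin_eq_diskNonlin hχ m h2] at h
  have hex : ∀ m, ∃ φ ψ : ℝ → ℝ, 0 ≤ m → φ R = 2 ∧ ψ R = deriv u R ∧
      IsRadialSolution (nonlin χ m) φ ψ (Ici R) ∧
      ∀ r, R ≤ r → |φ r| < 3 + 2 * (deriv u R ^ 2 / 2 + diskPotential 2) + 2 * m := by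
    intro m
    by_cases hm : 0 ≤ m
    · obtain ⟨φ, ψ, h⟩ := exists_shooting hχ hR.1 (deriv u R) hm
      exact ⟨φ, ψ, fun _ => h⟩
    · exact ⟨0, 0, fun h => absurd h hm⟩
  choose φ ψ hφ using hex
  refine ⟨fun m r => if r ≤ R then u r else φ m r, fun m r => if r ≤ R then deriv u r else ψ m r,
    ⟨fun m hm => ?_, fun m hm => by simp [huR], fun m hm => by simp,
      ⟨3 + 2 * (deriv u R ^ 2 / 2 + diskPotential 2), fun m hm r hr => ?_⟩⟩,
    fun m hm r hr => by simp [hr.2]⟩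
  · obtain ⟨h0, h1, h2, -⟩ := hφ m hm
    exact (hinner m).glue h2 (by rw [h0, huR]) h1
  · obtain ⟨h0, h1, h2, h3⟩ := hφ m hm
    rcases hr.lt_or_eq with h | h
    · simp only [not_le.mpr h, if_false]; exact (h3 r hr).le
    · subst h
      have := (h3 R le_rfl).le
      rw [h0] at this
      simpa [huR] using this

/-- A solution of negative energy cannot reach zero, since zeros have nonnegative energy. -/
lemma IsRadialSolution.energy_pos_preserved {f F φ ψ : ℝ → ℝ} {a : ℝ} (ha : 0 < a)
    (h : IsRadialSolution f φ ψ (Ici a)) (hF : ∀ s, HasDerivAt F (f s) s) (hF0 : F 0 = 0)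
    (hE : ψ a ^ 2 / 2 + F (φ a) < 0) (hφ : 0 < φ a) : ∀ r, a ≤ r → 0 < φ r := by
  intro r hr
  by_contra! hcon
  have hc : ContinuousOn φ (Icc a r) := fun s hs =>
    (h s hs.1).1.continuousAt.continuousWithinAt
  obtain ⟨s, hs, hs0⟩ := intermediate_value_Icc' hr hc ⟨hcon, hφ.le⟩
  have := h.energy_antitoneOn hF (convex_Ici a) (fun r hr => ha.trans_le hr) self_mem_Ici
    (show s ∈ Ici a from hs.1) hs.1
  simp only [hs0, hF0] at this
  nlinarith [sq_nonneg (ψ s)]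

namespace IsShootingFamily

variable {χ : ℝ → ℝ} {R b : ℝ} {φ ψ : ℝ → ℝ → ℝ}

/-- Continuous dependence on the mass, uniformly on bounded intervals. -/
lemma eventually_close (h : IsShootingFamily χ R b φ ψ) (hχ : IsCutoff χ) (hR : 0 < R)
    {m₀ : ℝ} (hm₀ : 0 ≤ m₀) (r₁ : ℝ) {ε : ℝ} (hε : 0 < ε) :
    ∃ δ, 0 < δ ∧ ∀ m, 0 ≤ m → |m - m₀| < δ → ∀ r ∈ Icc R r₁,
      |φ m r - φ m₀ r| < ε ∧ |ψ m r - ψ m₀ r| < ε := by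
  obtain ⟨B, hB⟩ := h.bound
  set D : ℝ := |B| + 2 * (m₀ + 1) with hD
  have hD0 : 0 < D := by positivity
  obtain ⟨L, hL, hLip⟩ := exists_lipschitz_on_Icc
    ((contDiff_nonlin hχ m₀).of_le (by exact_mod_cast le_top)) D
  set K := exp ((1 + 1 / R + L) * (r₁ - R)) with hK
  have hK0 : 0 < K := exp_pos _
  refine ⟨min 1 (ε / (D * K)), by positivity, fun m hm hmm r hr => ?_⟩
  have hm1 : |m - m₀| < 1 := hmm.trans_le (min_le_left _ _)
  have hm2 : |m - m₀| < ε / (D * K) := hmm.trans_le (min_le_right _ _)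
  have hmem : ∀ m', 0 ≤ m' → m' ≤ m₀ + 1 → ∀ s ∈ Ico R r₁, φ m' s ∈ Icc (-D) D := by
    intro m' hm' hm'' s hs
    have := (hB m' hm' s hs.1).trans (show B + 2 * m' ≤ D by rw [hD]; linarith [le_abs_self B])
    exact abs_le.mp this
  have hpos : ∀ s, R ≤ s → s ∈ Ioi (0 : ℝ) := fun s hs => hR.trans_le hs
  have key := radial_gronwall (f := nonlin χ m₀) (g := nonlin χ m) (φ := φ m₀) (ψ := ψ m₀)
    (φ' := φ m) (ψ' := ψ m) (b := r₁) (ε := |m - m₀| * D) hR hL hLip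
    (fun x hx => by
      have : nonlin χ m x - nonlin χ m₀ x = -((m - m₀) * (χ x * x)) := by
        simp only [nonlin]; ring
      rw [this, abs_neg, abs_mul]
      refine mul_le_mul_of_nonneg_left ?_ (abs_nonneg _)
      rw [abs_mul, abs_of_nonneg (hχ.mem_Icc x).1]
      exact (mul_le_of_le_one_left (abs_nonneg _) (hχ.mem_Icc x).2).trans (abs_le.mpr hx))
    (fun s hs => (h.sol m₀ hm₀ s (hpos s hs.1)).1.continuousAt.continuousWithinAt)
    (fun s hs => (h.sol m₀ hm₀ s (hpos s hs.1)).2.continuousAt.continuousWithinAt)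
    (fun s hs => (h.sol m hm s (hpos s hs.1)).1.continuousAt.continuousWithinAt)
    (fun s hs => (h.sol m hm s (hpos s hs.1)).2.continuousAt.continuousWithinAt)
    (fun s hs => (h.sol m₀ hm₀ s (hpos s hs.1)).1.hasDerivWithinAt)
    (fun s hs => (h.sol m₀ hm₀ s (hpos s hs.1)).2.hasDerivWithinAt)
    (fun s hs => (h.sol m hm s (hpos s hs.1)).1.hasDerivWithinAt)
    (fun s hs => (h.sol m hm s (hpos s hs.1)).2.hasDerivWithinAt)
    (hmem m₀ hm₀ (by linarith)) (hmem m hm (by linarith [(abs_lt.mp hm1).2]))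
    (by rw [h.init m₀ hm₀, h.init m hm]) (by rw [h.init_deriv m₀ hm₀, h.init_deriv m hm])
    (by positivity) r hr
  have hlt : |m - m₀| * D * K < ε := by
    rw [lt_div_iff₀ (by positivity)] at hm2
    linarith
  rw [abs_sub_comm (φ m r), abs_sub_comm (ψ m r)]
  exact ⟨key.1.trans_lt hlt, key.2.trans_lt hlt⟩

lemma tendsto (h : IsShootingFamily χ R b φ ψ) (hχ : IsCutoff χ) (hR : 0 < R)
    {m₀ : ℝ} (hm₀ : 0 ≤ m₀) {r : ℝ} (hr : R ≤ r) :
    Tendsto (fun m => φ m r) (𝓝[Ici 0] m₀) (𝓝 (φ m₀ r)) ∧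
    Tendsto (fun m => ψ m r) (𝓝[Ici 0] m₀) (𝓝 (ψ m₀ r)) := by
  constructor
  all_goals
    rw [Metric.tendsto_nhdsWithin_nhds]
    intro ε hε
    obtain ⟨δ, hδ, hclose⟩ := h.eventually_close hχ hR hm₀ r hε
    refine ⟨δ, hδ, fun m hm hmd => ?_⟩
    rw [Real.dist_eq] at hmd ⊢
  · exact (hclose m hm hmd r ⟨hr, le_rfl⟩).1
  · exact (hclose m hm hmd r ⟨hr, le_rfl⟩).2

lemma solIci (h : IsShootingFamily χ R b φ ψ) (hR : 0 < R) {m : ℝ} (hm : 0 ≤ m) {a : ℝ}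
    (ha : R ≤ a) : IsRadialSolution (nonlin χ m) (φ m) (ψ m) (Ici a) :=
  (h.sol m hm).mono fun _ hr => hR.trans_le (ha.trans hr)

/-- For large masses the initial energy is negative, which keeps the solution positive. -/
lemma positiveMasses_nonempty (h : IsShootingFamily χ R b φ ψ) (hχ : IsCutoff χ) (hR : 0 < R) :
    (positiveMasses R φ).Nonempty := by
  have hpot : 0 ≤ diskPotential 2 := le_trans (by positivity) (pow_four_le_diskPotential 2)
  set m : ℝ := 2 * (b ^ 2 / 2 + diskPotential 2) + 1 with hm
  have hm0 : 0 < m := by positivity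
  refine ⟨m, hm0, fun r hr => ?_⟩
  refine (h.solIci hR hm0.le le_rfl).energy_pos_preserved hR (hasDerivAt_massPotential hχ m)
    (massPotential_zero m) ?_ ?_ r hr.le
  · rw [h.init m hm0.le, h.init_deriv m hm0.le]
    have := mul_le_mul_of_nonneg_left (half_le_cutoffPotential_two hχ) hm0.le
    simp only [massPotential]
    linarith
  · rw [h.init m hm0.le]; norm_num

/-- For `m = 0` the solution crosses zero transversally; so it does for small masses. -/
lemma criticalMass_pos (h : IsShootingFamily χ R b φ ψ) (hχ : IsCutoff χ) (hR : 0 < R)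
    (hb : b < 0) : 0 < criticalMass R φ := by
  have h0 : IsRadialSolution diskNonlin (φ 0) (ψ 0) (Ici R) := by
    have e : nonlin χ 0 = diskNonlin := by funext s; simp [nonlin, diskNonlin]
    exact e ▸ h.solIci hR le_rfl le_rfl
  obtain ⟨ρ, hρ, hρ0, hρ', -⟩ := h0.exists_first_zero hR (by rw [h.init 0 le_rfl]; norm_num)
    (by rw [h.init_deriv 0 le_rfl]; exact hb)
  obtain ⟨r₁, hr₁, hneg⟩ : ∃ r₁, R < r₁ ∧ φ 0 r₁ < 0 := by
    have hd := (h0 ρ hρ.le).1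
    have := eventually_nhdsWithin_sign_eq_of_deriv_neg (by rw [hd.deriv]; exact hρ') hρ0
    have h2 : ∀ᶠ x in 𝓝[>] ρ, SignType.sign (φ 0 x) = SignType.sign (ρ - x) :=
      this.filter_mono nhdsWithin_le_nhds
    obtain ⟨x, hx, hx'⟩ := (h2.and self_mem_nhdsWithin).exists
    have hx'' : ρ < x := hx'
    refine ⟨x, hρ.trans hx'', ?_⟩
    rw [sign_neg (by linarith : ρ - x < 0)] at hx
    exact sign_eq_neg_one_iff.mp hx
  obtain ⟨δ, hδ, hclose⟩ := h.eventually_close hχ hR le_rfl r₁ (ε := -φ 0 r₁) (by linarith)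
  refine hδ.trans_le (le_csInf (h.positiveMasses_nonempty hχ hR) fun m hm => ?_)
  by_contra! hlt
  have h1 := (hclose m hm.1.le (by rw [sub_zero, abs_of_pos hm.1]; exact hlt) r₁
    ⟨hr₁.le, le_rfl⟩).1
  have h2 := hm.2 r₁ hr₁
  have := (abs_lt.mp h1).2
  linarith

lemma bddBelow_positiveMasses : BddBelow (positiveMasses R φ) := ⟨0, fun _ hm => hm.1.le⟩

/-- At the critical mass the solution is nonnegative as a limit of positive solutions. A zero would
be a double zero, hence it cannot occur. -/
lemma critical_pos (h : IsShootingFamily χ R b φ ψ) (hχ : IsCutoff χ) (hR : 0 < R)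
    (hb : b < 0) {r : ℝ} (hr : R ≤ r) : 0 < φ (criticalMass R φ) r := by
  set M := criticalMass R φ with hM
  have hM0 : 0 < M := h.criticalMass_pos hχ hR hb
  have hsol := h.solIci hR hM0.le le_rfl
  have hnonneg : ∀ r, R ≤ r → 0 ≤ φ M r := by
    intro r hr
    by_contra! hneg
    have hRr : R < r := by
      refine lt_of_le_of_ne hr fun he => ?_
      rw [← he, h.init M hM0.le] at hneg; norm_num at hneg
    obtain ⟨δ, hδ, hclose⟩ := h.eventually_close hχ hR hM0.le r (ε := -φ M r) (by linarith)
    obtain ⟨m, hm, hmM⟩ := exists_lt_of_csInf_lt (h.positiveMasses_nonempty hχ hR)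
      (show sInf (positiveMasses R φ) < M + δ by rw [← criticalMass, ← hM]; linarith)
    have hle : M ≤ m := csInf_le bddBelow_positiveMasses hm
    have h1 := (hclose m hm.1.le (by rw [abs_of_nonneg (by linarith)]; linarith) r
      ⟨hr, le_rfl⟩).1
    have h2 := hm.2 r hRr
    have := (abs_lt.mp h1).2
    linarith
  refine lt_of_le_of_ne (hnonneg r hr) fun he => ?_
  -- an interior zero would be a minimum, hence a double zero
  have hRr : R < r := by
    refine lt_of_le_of_ne hr fun he' => ?_
    rw [← he', h.init M hM0.le] at he; norm_num at he
  have hmin : IsLocalMin (φ M) r := by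
    filter_upwards [Ioi_mem_nhds hRr] with s hs
    rw [← he]; exact hnonneg s (le_of_lt hs)
  have hψ : ψ M r = 0 := hmin.hasDerivAt_eq_zero (hsol r hr).1
  have := (hsol.mono (Icc_subset_Ici_self : Icc R r ⊆ Ici R)).eq_zero_of_double_zero hR hr
    ((contDiff_nonlin hχ M).of_le (by exact_mod_cast le_top)) (by simp [nonlin]) he.symm hψ
  rw [h.init M hM0.le] at this
  norm_num at this

/-- At the critical mass the energy stays nonnegative: otherwise slightly smaller masses
would be positive as well. -/
lemma critical_energy_nonneg (h : IsShootingFamily χ R b φ ψ) (hχ : IsCutoff χ) (hR : 0 < R)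
    (hb : b < 0) {r : ℝ} (hr : R ≤ r) :
    0 ≤ ψ (criticalMass R φ) r ^ 2 / 2 +
      massPotential χ (criticalMass R φ) (φ (criticalMass R φ) r) := by
  set M := criticalMass R φ with hM
  have hM0 : 0 < M := h.criticalMass_pos hχ hR hb
  by_contra! hneg
  have hc : ContinuousOn (φ M) (Icc R r) := fun s hs =>
    (h.sol M hM0.le s (hR.trans_le hs.1)).1.continuousAt.continuousWithinAt
  obtain ⟨s₀, hs₀, hmin⟩ := isCompact_Icc.exists_isMinOn ⟨R, le_rfl, hr⟩ hc
  have hpos : 0 < φ M s₀ := h.critical_pos hχ hR hb hs₀.1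
  obtain ⟨δ, hδ, hclose⟩ := h.eventually_close hχ hR hM0.le r hpos
  have hE : Tendsto (fun m => ψ m r ^ 2 / 2 + massPotential χ m (φ m r)) (𝓝[Ici 0] M)
      (𝓝 (ψ M r ^ 2 / 2 + massPotential χ M (φ M r))) := by
    obtain ⟨t1, t2⟩ := h.tendsto hχ hR hM0.le hr
    have d1 : ContinuousAt diskPotential (φ M r) := (hasDerivAt_diskPotential _).continuousAt
    have d2 : ContinuousAt (cutoffPotential χ) (φ M r) :=
      (hasDerivAt_cutoffPotential hχ _).continuousAt
    exact ((t2.pow 2).div_const 2).add ((d1.tendsto.comp t1).sub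
      ((tendsto_id.mono_left nhdsWithin_le_nhds).mul (d2.tendsto.comp t1)))
  have hE' := hE.eventually (gt_mem_nhds hneg)
  rw [nhdsWithin_eq_nhds.mpr (Ici_mem_nhds hM0)] at hE'
  have hleft : ∀ᶠ m in 𝓝[<] M, ψ m r ^ 2 / 2 + massPotential χ m (φ m r) < 0 :=
    hE'.filter_mono nhdsWithin_le_nhds
  obtain ⟨m, hm, hm1, hm2⟩ := (hleft.and
    (Ioo_mem_nhdsLT (show max 0 (M - δ) < M from max_lt hM0 (by linarith)))).exists
  have hm0 : 0 < m := (le_max_left _ _).trans_lt hm1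
  have hmδ : M - δ < m := (le_max_right _ _).trans_lt hm1
  have hclose' : ∀ s ∈ Icc R r, 0 < φ m s := by
    intro s hs
    have h1 := (abs_lt.mp (hclose m hm0.le (by rw [abs_lt]; constructor <;> linarith) s hs).1).1
    have h2 : φ M s₀ ≤ φ M s := hmin hs
    linarith
  have hmem : m ∈ positiveMasses R φ := by
    refine ⟨hm0, fun s hs => ?_⟩
    rcases le_total s r with hsr | hsr
    · exact hclose' s ⟨hs.le, hsr⟩
    · exact (h.solIci hR hm0.le hr).energy_pos_preserved (hR.trans_le hr)
        (hasDerivAt_massPotential hχ m) (massPotential_zero m) hm (hclose' r ⟨hr, le_rfl⟩) s hsr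
  exact absurd (csInf_le bddBelow_positiveMasses hmem) (not_le.mpr hm2)

/-- At the first critical point the energy is purely potential, so the nonlinearity would be
positive there and the point a strict local maximum, which is impossible. -/
lemma critical_deriv_neg (h : IsShootingFamily χ R b φ ψ) (hχ : IsCutoff χ) (hR : 0 < R)
    (hb : b < 0) {r : ℝ} (hr : R ≤ r) : ψ (criticalMass R φ) r < 0 := by
  set M := criticalMass R φ with hM
  have hM0 : 0 < M := h.criticalMass_pos hχ hR hb
  have hsol := h.solIci hR hM0.le le_rfl
  by_contra! hcon
  have hc : ContinuousOn (ψ M) (Icc R r) := fun s hs =>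
    (hsol s hs.1).2.continuousAt.continuousWithinAt
  have hEc : IsClosed (Icc R r ∩ (ψ M) ⁻¹' (Ici 0)) :=
    hc.preimage_isClosed_of_isClosed isClosed_Icc isClosed_Ici
  obtain ⟨ρ, hρ, hmin⟩ := (isCompact_Icc.of_isClosed_subset hEc inter_subset_left).exists_isLeast
    ⟨r, ⟨hr, le_rfl⟩, hcon⟩
  have hRρ : R < ρ := by
    refine lt_of_le_of_ne hρ.1.1 fun he => ?_
    have := hρ.2
    rw [← he, mem_preimage, h.init_deriv M hM0.le] at this
    exact absurd hb (not_lt.mpr this)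
  have hneg : ∀ s, R ≤ s → s < ρ → ψ M s < 0 := by
    intro s hs hsρ
    by_contra! hge
    exact absurd (hmin ⟨⟨hs, hsρ.le.trans hρ.1.2⟩, hge⟩) (not_le.mpr hsρ)
  have hzero : ψ M ρ = 0 := by
    refine le_antisymm ?_ hρ.2
    have hcw : ContinuousWithinAt (ψ M) (Iio ρ) ρ :=
      (hsol ρ hRρ.le).2.continuousAt.continuousWithinAt
    refine le_of_tendsto hcw ?_
    filter_upwards [Ioo_mem_nhdsLT hRρ] with s hs using (hneg s hs.1.le hs.2).le
  have hE := h.critical_energy_nonneg hχ hR hb hRρ.le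
  rw [← hM, hzero] at hE
  have hf : 0 < nonlin χ M (φ M ρ) := nonlin_pos_of_massPotential_nonneg hχ hM0.le
    (h.critical_pos hχ hR hb hRρ.le) (by simpa using hE)
  have hd := (hsol ρ hRρ.le).2
  have hev := eventually_nhdsWithin_sign_eq_of_deriv_neg (f := ψ M) (x₀ := ρ)
    (by rw [hd.deriv, hzero]; simpa using hf) hzero
  have hev' : ∀ᶠ x in 𝓝[<] ρ, SignType.sign (ψ M x) = SignType.sign (ρ - x) :=
    hev.filter_mono nhdsWithin_le_nhds
  obtain ⟨x, hx, hx'⟩ := (hev'.and (Ioo_mem_nhdsLT hRρ)).exists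
  rw [sign_pos (by linarith [hx'.2] : 0 < ρ - x)] at hx
  have h1 := sign_eq_one_iff.mp hx
  linarith [hneg x hx'.1.le hx'.2]

end IsShootingFamily

/-! ### Shooting solutions as initial value problems -/

lemma IsRadialSolution.isShootingSolution {χ u φ ψ : ℝ → ℝ} {R m : ℝ} (hχ : IsCutoff χ)
    (h : IsRadialSolution (nonlin χ m) φ ψ (Ioi 0)) (hR : 0 < R)
    (heq : ∀ r ∈ Ioc 0 R, φ r = u r) (hderiv : ψ R = deriv u R) :
    IsShootingSolution χ u R m φ := by
  have hsm := (h.contDiffOn isOpen_Ioi (fun r hr => hr) (contDiff_nonlin hχ m)).1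
  refine ⟨heq, (hsm.mono fun r hr => hR.trans_le hr).of_le (by exact_mod_cast le_top),
    (hsm.mono fun r hr => hR.trans hr).of_le
      (WithTop.coe_le_coe.mpr (le_top : (2 : ℕ∞) ≤ ⊤)), ?_, fun r hr => ?_⟩
  · rw [← hderiv]
    exact (h R hR).1.hasDerivWithinAt.derivWithin (uniqueDiffWithinAt_Ici R)
  · have hr0 : 0 < r := hR.trans hr
    have hd : deriv φ =ᶠ[𝓝 r] ψ := by
      filter_upwards [Ioi_mem_nhds hr0] with s hs using (h s hs).1.deriv
    rw [hd.deriv_eq, hd.eq_of_nhds, (h r hr0).2.deriv]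
    ring

/-- A shooting solution satisfies the first order system from the right at every `r ≥ R`,
including `r = R`. -/
lemma IsShootingSolution.hasDerivWithinAt {χ u φ : ℝ → ℝ} {R m : ℝ} (hχ : IsCutoff χ)
    (h : IsShootingSolution χ u R m φ) (hR : 0 < R) :
    ContinuousOn (derivWithin φ (Ici R)) (Ici R) ∧
    (∀ r, R ≤ r → HasDerivWithinAt φ (derivWithin φ (Ici R) r) (Ici r) r) ∧
    ∀ r, R ≤ r → HasDerivWithinAt (derivWithin φ (Ici R))
      (-derivWithin φ (Ici R) r / r - nonlin χ m (φ r)) (Ici r) r := by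
  set p := derivWithin φ (Ici R) with hp
  have hpc : ContinuousOn p (Ici R) :=
    h.c1.continuousOn_derivWithin (uniqueDiffOn_Ici R) le_rfl
  have hφc : ContinuousOn φ (Ici R) := h.c1.continuousOn
  have hpd : ∀ r, R < r → p =ᶠ[𝓝 r] deriv φ := fun r hr => by
    filter_upwards [Ioi_mem_nhds hr] with s hs
    exact derivWithin_of_mem_nhds (Ici_mem_nhds hs)
  have hd2 : ∀ r, R < r → HasDerivAt p (-p r / r - nonlin χ m (φ r)) r := by
    intro r hr
    have h1 : ContDiffAt ℝ 2 φ r := h.c2.contDiffAt (Ioi_mem_nhds hr)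
    have h3 : ContDiffOn ℝ 1 (deriv φ) (Ioi R) := h.c2.deriv_of_isOpen isOpen_Ioi (by norm_num)
    have h2 : DifferentiableAt ℝ (deriv φ) r :=
      (h3.contDiffAt (Ioi_mem_nhds hr)).differentiableAt (by simp)
    refine (h2.hasDerivAt.congr_of_eventuallyEq (hpd r hr)).congr_deriv ?_
    have := h.ode r hr
    rw [(hpd r hr).eq_of_nhds]
    linear_combination -this
  refine ⟨hpc, fun r hr => ?_, fun r hr => ?_⟩
  · exact ((h.c1.differentiableOn (by simp) r hr).hasDerivWithinAt).mono (Ici_subset_Ici.mpr hr)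
  · rcases hr.lt_or_eq with hr' | hr'
    · exact (hd2 r hr').hasDerivWithinAt
    · subst hr'
      refine hasDerivWithinAt_Ici_of_tendsto_deriv (s := Ioi R)
        (fun s hs => (hd2 s hs).differentiableAt.differentiableWithinAt)
        ((hpc R self_mem_Ici).mono Ioi_subset_Ici_self) self_mem_nhdsWithin ?_
      have hlim : ContinuousWithinAt (fun s => -p s / s - nonlin χ m (φ s)) (Ioi R) R := by
        have c1 := (hpc R self_mem_Ici).mono Ioi_subset_Ici_self
        have c2 := (hφc R self_mem_Ici).mono Ioi_subset_Ici_self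
        have c3 : ContinuousAt (nonlin χ m) (φ R) :=
          (contDiff_nonlin hχ m).continuous.continuousAt
        exact (c1.neg.div continuousWithinAt_id hR.ne').sub (c3.comp_continuousWithinAt c2)
      refine hlim.tendsto.congr' ?_
      filter_upwards [self_mem_nhdsWithin] with s hs using (hd2 s hs).deriv.symm

/-- Uniqueness of shooting solutions; regularity up to `R` from the right suffices for Grönwall's
inequality. -/
lemma IsShootingSolution.eqOn {χ u φ φ' : ℝ → ℝ} {R m : ℝ} (hχ : IsCutoff χ) (hR : 0 < R)
    (h : IsShootingSolution χ u R m φ) (h' : IsShootingSolution χ u R m φ') :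
    EqOn φ φ' (Ioi 0) := by
  intro r hr
  rcases le_total r R with hrR | hrR
  · rw [h.eq_inner r ⟨hr, hrR⟩, h'.eq_inner r ⟨hr, hrR⟩]
  obtain ⟨c1, d1, d2⟩ := h.hasDerivWithinAt hχ hR
  obtain ⟨c1', d1', d2'⟩ := h'.hasDerivWithinAt hχ hR
  have hc : ContinuousOn φ (Icc R r) := h.c1.continuousOn.mono Icc_subset_Ici_self
  have hc' : ContinuousOn φ' (Icc R r) := h'.c1.continuousOn.mono Icc_subset_Ici_self
  obtain ⟨B, hB⟩ := isCompact_Icc.exists_bound_of_continuousOn hc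
  obtain ⟨B', hB'⟩ := isCompact_Icc.exists_bound_of_continuousOn hc'
  obtain ⟨L, hL, hLip⟩ := exists_lipschitz_on_Icc
    ((contDiff_nonlin hχ m).of_le (by exact_mod_cast le_top)) (max B B')
  have key := radial_gronwall (f := nonlin χ m) (g := nonlin χ m) (ε := 0) hR hL hLip
    (fun x _ => by simp) hc (c1.mono Icc_subset_Ici_self) hc' (c1'.mono Icc_subset_Ici_self)
    (fun s hs => d1 s hs.1) (fun s hs => d2 s hs.1) (fun s hs => d1' s hs.1)
    (fun s hs => d2' s hs.1)
    (fun s hs => abs_le.mp ((hB s (Ico_subset_Icc_self hs)).trans (le_max_left _ _)))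
    (fun s hs => abs_le.mp ((hB' s (Ico_subset_Icc_self hs)).trans (le_max_right _ _)))
    (by rw [h.eq_inner R ⟨hR, le_rfl⟩, h'.eq_inner R ⟨hR, le_rfl⟩])
    (by rw [h.initial_deriv, h'.initial_deriv]) le_rfl r ⟨hrR, le_rfl⟩
  have := key.1
  rw [zero_mul] at this
  exact sub_eq_zero.mp (abs_nonpos_iff.mp this)

/-! ### Behaviour of the critical solution at infinity -/

lemma exists_tendsto_of_antitoneOn {g : ℝ → ℝ} {a c : ℝ} (hg : AntitoneOn g (Ici a))
    (hc : ∀ r, a ≤ r → c ≤ g r) : ∃ ℓ, c ≤ ℓ ∧ Tendsto g atTop (𝓝 ℓ) := by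
  have hanti : Antitone fun r => g (max a r) := fun x y hxy =>
    hg (show a ≤ max a x from le_max_left _ _) (show a ≤ max a y from le_max_left _ _)
      (max_le_max_left a hxy)
  have hb : BddBelow (range fun r => g (max a r)) :=
    ⟨c, by rintro _ ⟨r, rfl⟩; exact hc _ (le_max_left _ _)⟩
  have ht := tendsto_atTop_ciInf hanti hb
  refine ⟨_, le_ciInf fun r => hc _ (le_max_left _ _), ht.congr' ?_⟩
  filter_upwards [eventually_ge_atTop a] with r hr
  rw [max_eq_right hr]

/-- If a function and its derivative both converge at infinity, then the derivative tends to
zero. -/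
lemma eq_zero_of_tendsto_deriv {g g' : ℝ → ℝ} {a ℓ c : ℝ}
    (hd : ∀ r, a ≤ r → HasDerivAt g (g' r) r) (hg : Tendsto g atTop (𝓝 ℓ))
    (hg' : Tendsto g' atTop (𝓝 c)) : c = 0 := by
  have hmvt : ∀ r, ∃ ξ, r ≤ ξ ∧ (a ≤ r → g' ξ = g (r + 1) - g r) := by
    intro r
    by_cases hr : a ≤ r
    · obtain ⟨ξ, hξ, h⟩ := exists_hasDerivAt_eq_slope g g' (show r < r + 1 by linarith)
        (fun s hs => (hd s (hr.trans hs.1)).continuousAt.continuousWithinAt)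
        (fun s hs => hd s (hr.trans hs.1.le))
      exact ⟨ξ, hξ.1.le, fun _ => by rw [h]; simp⟩
    · exact ⟨r, le_rfl, fun h => absurd h hr⟩
  choose ξ hξ hξ' using hmvt
  have h1 : Tendsto (fun r => g' (ξ r)) atTop (𝓝 c) :=
    hg'.comp (tendsto_atTop_mono hξ tendsto_id)
  have h2 : Tendsto (fun r => g (r + 1) - g r) atTop (𝓝 (ℓ - ℓ)) :=
    (hg.comp (tendsto_atTop_add_const_right _ 1 tendsto_id)).sub hg
  rw [sub_self] at h2
  refine tendsto_nhds_unique h1 (h2.congr' ?_)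
  filter_upwards [eventually_ge_atTop a] with r hr using (hξ' r hr).symm

namespace IsShootingFamily

variable {χ : ℝ → ℝ} {R b : ℝ} {φ ψ : ℝ → ℝ → ℝ}

lemma critical_strictAntiOn (h : IsShootingFamily χ R b φ ψ) (hχ : IsCutoff χ) (hR : 0 < R)
    (hb : b < 0) : StrictAntiOn (φ (criticalMass R φ)) (Ici R) := by
  have hsol := h.solIci hR (h.criticalMass_pos hχ hR hb).le le_rfl
  refine strictAntiOn_of_deriv_neg (convex_Ici R)
    (fun r hr => (hsol r hr).1.continuousAt.continuousWithinAt) fun r hr => ?_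
  have hr' := interior_subset hr
  rw [(hsol r hr').1.deriv]
  exact h.critical_deriv_neg hχ hR hb hr'

/-- The limit `ℓ` at infinity is an equilibrium of nonnegative energy, so it is zero. -/
lemma critical_tendsto_zero (h : IsShootingFamily χ R b φ ψ) (hχ : IsCutoff χ) (hR : 0 < R)
    (hb : b < 0) : Tendsto (φ (criticalMass R φ)) atTop (𝓝 0) ∧
      Tendsto (ψ (criticalMass R φ)) atTop (𝓝 0) := by
  set M := criticalMass R φ with hM
  have hM0 : 0 < M := h.criticalMass_pos hχ hR hb
  have hsol := h.solIci hR hM0.le le_rfl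
  obtain ⟨ℓ, hℓ, hφ⟩ := exists_tendsto_of_antitoneOn
    (h.critical_strictAntiOn hχ hR hb).antitoneOn
    (fun r hr => (h.critical_pos hχ hR hb hr).le)
  rw [← hM] at hφ
  obtain ⟨E, hE, hEt⟩ := exists_tendsto_of_antitoneOn
    (hsol.energy_antitoneOn (hasDerivAt_massPotential hχ M) (convex_Ici R)
      (fun r hr => hR.trans_le hr)) (fun r hr => h.critical_energy_nonneg hχ hR hb hr)
  have hFc : ContinuousAt (massPotential χ M) ℓ := (hasDerivAt_massPotential hχ M ℓ).continuousAt
  have hfc : ContinuousAt (nonlin χ M) ℓ := (contDiff_nonlin hχ M).continuous.continuousAt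
  have hFt : Tendsto (fun r => massPotential χ M (φ M r)) atTop (𝓝 (massPotential χ M ℓ)) :=
    hFc.tendsto.comp hφ
  -- `φ'` converges because it is negative and its square does
  have hψ : Tendsto (ψ M) atTop (𝓝 (-√(2 * (E - massPotential χ M ℓ)))) := by
    have h1 := ((hEt.sub hFt).const_mul 2).sqrt.neg
    refine h1.congr' ?_
    filter_upwards [eventually_ge_atTop R] with r hr
    have h2 : 2 * (ψ M r ^ 2 / 2 + massPotential χ M (φ M r) - massPotential χ M (φ M r))
        = (-ψ M r) ^ 2 := by ring
    rw [h2, Real.sqrt_sq (by linarith [h.critical_deriv_neg hχ hR hb hr]), neg_neg]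
  have hκ := eq_zero_of_tendsto_deriv (fun r hr => (hsol r hr).1) hφ hψ
  rw [hκ] at hψ
  have hEF : E ≤ massPotential χ M ℓ := by
    have := neg_eq_zero.mp hκ
    rw [Real.sqrt_eq_zero'] at this
    linarith
  have hψ' : Tendsto (fun r => -ψ M r / r - nonlin χ M (φ M r)) atTop
      (𝓝 (0 - nonlin χ M ℓ)) := by
    refine Tendsto.sub ?_ (hfc.tendsto.comp hφ)
    have := hψ.neg.mul tendsto_inv_atTop_zero
    simpa [div_eq_mul_inv] using this
  have hf := eq_zero_of_tendsto_deriv (fun r hr => (hsol r hr).2) hψ hψ'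
  have hℓ0 : ℓ = 0 := by
    by_contra hne
    have := nonlin_pos_of_massPotential_nonneg hχ hM0.le (lt_of_le_of_ne hℓ (Ne.symm hne))
      (hE.trans hEF)
    linarith
  exact ⟨hℓ0 ▸ hφ, hψ⟩

/-- Exponential decay. Where `φ` is small, `φ'' ≥ m φ`, so that `φ'² - m φ²` is nonincreasing;
as it tends to zero it is nonnegative, that is `φ' ≤ -√m φ`. By convexity, `|φ'(r)| ≤ φ(r - 1)`. -/
lemma critical_decay (h : IsShootingFamily χ R b φ ψ) (hχ : IsCutoff χ) (hR : 0 < R)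
    (hb : b < 0) {m : ℝ} (hm : m ∈ Ioo 0 (criticalMass R φ)) :
    ∃ C : ℝ, 0 < C ∧ ∀ r, R ≤ r →
      φ (criticalMass R φ) r + |ψ (criticalMass R φ) r| ≤ C * exp (-√m * r) := by
  set M := criticalMass R φ with hM
  have hM0 : 0 < M := h.criticalMass_pos hχ hR hb
  have hsol := h.solIci hR hM0.le le_rfl
  obtain ⟨hφ, hψ⟩ := h.critical_tendsto_zero hχ hR hb
  rw [← hM] at hφ hψ
  have hpos : ∀ r, R ≤ r → 0 < φ M r := fun r hr => h.critical_pos hχ hR hb hr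
  have hneg : ∀ r, R ≤ r → ψ M r < 0 := fun r hr => h.critical_deriv_neg hχ hR hb hr
  have hsmall : ∀ᶠ r in atTop, φ M r ≤ 1 ∧ exp (φ M r ^ 2) - 1 ≤ M - m := by
    have h1 : Tendsto (fun r => exp (φ M r ^ 2) - 1) atTop (𝓝 0) := by
      have := ((hφ.pow 2).rexp).sub_const 1
      simpa using this
    filter_upwards [hφ.eventually (ge_mem_nhds zero_lt_one),
      h1.eventually (ge_mem_nhds (by linarith [hm.2] : 0 < M - m))] with r hr1 hr2
    exact ⟨hr1, hr2⟩
  obtain ⟨r₀, hr₀⟩ := (hsmall.and (eventually_ge_atTop R)).exists_forall_of_atTop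
  have hRr₀ : R ≤ r₀ := (hr₀ r₀ le_rfl).2
  have hsol' : ∀ r, r₀ ≤ r → HasDerivAt (φ M) (ψ M r) r ∧
      HasDerivAt (ψ M) (-ψ M r / r - nonlin χ M (φ M r)) r := fun r hr =>
    hsol r (hRr₀.trans hr)
  have hconv : ∀ r, r₀ ≤ r → m * φ M r ≤ -ψ M r / r - nonlin χ M (φ M r) := by
    intro r hr
    obtain ⟨⟨h1, h2⟩, h3⟩ := hr₀ r hr
    have hp := hpos r h3
    have h4 : nonlin χ M (φ M r) = φ M r * (exp (φ M r ^ 2) - 1 - M) := by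
      simp only [nonlin]
      rw [hχ.eq_one _ (by rw [abs_of_pos hp]; exact h1)]; ring
    have h5 : 0 ≤ -ψ M r / r := div_nonneg (by linarith [hneg r h3]) (hR.le.trans h3)
    rw [h4]
    nlinarith
  have hW : ∀ r, r₀ ≤ r → m * φ M r ^ 2 ≤ ψ M r ^ 2 := by
    have hd : ∀ r, r₀ ≤ r → HasDerivAt (fun r => ψ M r ^ 2 - m * φ M r ^ 2)
        (2 * ψ M r * (-ψ M r / r - nonlin χ M (φ M r) - m * φ M r)) r := fun r hr => by
      refine (((hsol' r hr).2.pow 2).sub (((hsol' r hr).1.pow 2).const_mul m)).congr_deriv ?_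
      push_cast; ring
    have hanti : AntitoneOn (fun r => ψ M r ^ 2 - m * φ M r ^ 2) (Ici r₀) := by
      refine antitoneOn_of_deriv_nonpos (convex_Ici r₀)
        (fun r hr => (hd r hr).continuousAt.continuousWithinAt)
        (fun r hr => (hd r (interior_subset hr)).differentiableAt.differentiableWithinAt)
        fun r hr => ?_
      have hr' := interior_subset hr
      rw [(hd r hr').deriv]
      have h1 := hneg r (hRr₀.trans hr')
      have h2 := hconv r hr'
      exact mul_nonpos_of_nonpos_of_nonneg (by linarith) (by linarith)
    have hlim : Tendsto (fun r => ψ M r ^ 2 - m * φ M r ^ 2) atTop (𝓝 0) := by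
      have := (hψ.pow 2).sub ((hφ.pow 2).const_mul m)
      simpa using this
    intro r hr
    have : 0 ≤ ψ M r ^ 2 - m * φ M r ^ 2 := by
      refine le_of_tendsto hlim ?_
      filter_upwards [eventually_ge_atTop r] with s hs
      exact hanti hr (hr.trans hs) hs
    linarith
  have hm0 : 0 ≤ √m := Real.sqrt_nonneg m
  have hgrad : ∀ r, r₀ ≤ r → √m * φ M r + ψ M r ≤ 0 := by
    intro r hr
    have h1 := hpos r (hRr₀.trans hr)
    have h2 := hneg r (hRr₀.trans hr)
    have h3 : (√m * φ M r) ^ 2 ≤ (-ψ M r) ^ 2 := by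
      rw [mul_pow, Real.sq_sqrt hm.1.le, neg_sq]; exact hW r hr
    have := abs_le_of_sq_le_sq' h3 (by linarith)
    linarith [this.2]
  set K : ℝ := exp (√m * r₀) * φ M r₀ with hK
  have hK0 : 0 < K := mul_pos (exp_pos _) (hpos r₀ hRr₀)
  have hφle : ∀ r, r₀ ≤ r → φ M r ≤ K * exp (-√m * r) := by
    have hd : ∀ r, r₀ ≤ r → HasDerivAt (fun r => exp (√m * r) * φ M r)
        (exp (√m * r) * (√m * φ M r + ψ M r)) r := fun r hr => by
      have h1 : HasDerivAt (fun r => √m * r) √m r := by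
        simpa using (hasDerivAt_id r).const_mul √m
      refine (h1.exp.mul (hsol' r hr).1).congr_deriv ?_
      ring
    have hanti : AntitoneOn (fun r => exp (√m * r) * φ M r) (Ici r₀) := by
      refine antitoneOn_of_deriv_nonpos (convex_Ici r₀)
        (fun r hr => (hd r hr).continuousAt.continuousWithinAt)
        (fun r hr => (hd r (interior_subset hr)).differentiableAt.differentiableWithinAt)
        fun r hr => ?_
      have hr' := interior_subset hr
      rw [(hd r hr').deriv]
      exact mul_nonpos_of_nonneg_of_nonpos (exp_pos _).le (hgrad r hr')
    intro r hr
    have h1 : exp (√m * r) * φ M r ≤ K := hanti self_mem_Ici hr hr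
    rw [neg_mul, Real.exp_neg, ← div_eq_mul_inv, le_div_iff₀ (exp_pos _)]
    linarith
  have hψle : ∀ r, r₀ + 1 ≤ r → |ψ M r| ≤ φ M (r - 1) := by
    intro r hr
    have hmono : MonotoneOn (ψ M) (Ici r₀) := by
      refine monotoneOn_of_deriv_nonneg (convex_Ici r₀)
        (fun r hr => (hsol' r hr).2.continuousAt.continuousWithinAt)
        (fun r hr => (hsol' r (interior_subset hr)).2.differentiableAt.differentiableWithinAt)
        fun r hr => ?_
      have hr' := interior_subset hr
      rw [(hsol' r hr').2.deriv]
      exact (mul_nonneg hm.1.le (hpos r (hRr₀.trans hr')).le).trans (hconv r hr')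
    obtain ⟨ξ, hξ, hξ'⟩ := exists_hasDerivAt_eq_slope (φ M) (ψ M) (show r - 1 < r by linarith)
      (fun s hs => (hsol' s (by linarith [hs.1])).1.continuousAt.continuousWithinAt)
      (fun s hs => (hsol' s (by linarith [hs.1])).1)
    have h1 : ψ M ξ ≤ ψ M r := hmono (show r₀ ≤ ξ by linarith [hξ.1])
      (show r₀ ≤ r by linarith) hξ.2.le
    rw [hξ', sub_sub_cancel, div_one] at h1
    rw [abs_of_neg (hneg r (by linarith))]
    linarith [hpos r (by linarith)]
  have hcont : ContinuousOn (fun r => φ M r + |ψ M r|) (Icc R (r₀ + 1)) := fun r hr =>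
    ((hsol r hr.1).1.continuousAt.add (hsol r hr.1).2.continuousAt.abs).continuousWithinAt
  obtain ⟨D, hD⟩ := isCompact_Icc.exists_bound_of_continuousOn hcont
  have hD0 : 0 ≤ D := (norm_nonneg _).trans (hD R ⟨le_rfl, by linarith⟩)
  refine ⟨D * exp (√m * (r₀ + 1)) + (K + K * exp √m), by positivity, fun r hr => ?_⟩
  have he : 0 < exp (-√m * r) := exp_pos _
  rw [add_mul]
  rcases le_total r (r₀ + 1) with hle | hle
  · have h1 := hD r ⟨hr, hle⟩
    have h2 : φ M r + |ψ M r| ≤ D := (le_abs_self _).trans h1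
    have h3 : 1 ≤ exp (√m * (r₀ + 1)) * exp (-√m * r) := by
      rw [← exp_add]
      refine one_le_exp ?_
      nlinarith
    have h4 : D ≤ D * exp (√m * (r₀ + 1)) * exp (-√m * r) := by
      rw [mul_assoc]; exact le_mul_of_one_le_right hD0 h3
    have h5 : 0 ≤ (K + K * exp √m) * exp (-√m * r) := by positivity
    linarith
  · have h1 := hφle r (by linarith)
    have h2 := (hψle r hle).trans (hφle (r - 1) (by linarith))
    have h3 : exp (-√m * (r - 1)) = exp √m * exp (-√m * r) := by
      rw [← exp_add]; congr 1; ring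
    rw [h3] at h2
    have h5 : 0 ≤ D * exp (√m * (r₀ + 1)) * exp (-√m * r) := by positivity
    nlinarith

end IsShootingFamily

/-! ### The Laplacian: integration by parts and radial functions -/

lemma laplacian_eq_sum_fderiv {E ι : Type*} [NormedAddCommGroup E] [InnerProductSpace ℝ E]
    [FiniteDimensional ℝ E] [Fintype ι] (v : OrthonormalBasis ι ℝ E) (g : E → ℝ) (x : E) :
    (Δ g) x = ∑ i, fderiv ℝ (fderiv ℝ g) x (v i) (v i) := by
  rw [InnerProductSpace.laplacian_eq_iteratedFDeriv_orthonormalBasis g v]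
  simp [iteratedFDeriv_two_apply]

lemma ContDiff.continuous_laplacian {E : Type*} [NormedAddCommGroup E] [InnerProductSpace ℝ E]
    [FiniteDimensional ℝ E] {g : E → ℝ} (hg : ContDiff ℝ 2 g) : Continuous (Δ g) := by
  have hg1 : ContDiff ℝ 1 (fderiv ℝ g) := hg.fderiv_right (by norm_num)
  have hg2 : Continuous (fderiv ℝ (fderiv ℝ g)) := hg1.continuous_fderiv (by simp)
  rw [funext (laplacian_eq_sum_fderiv (stdOrthonormalBasis ℝ E) g)]
  fun_prop

lemma HasCompactSupport.laplacian {E : Type*} [NormedAddCommGroup E] [InnerProductSpace ℝ E]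
    [FiniteDimensional ℝ E] {g : E → ℝ} (hg : HasCompactSupport g) : HasCompactSupport (Δ g) := by
  rw [funext (laplacian_eq_sum_fderiv (stdOrthonormalBasis ℝ E) g)]
  exact ((hg.fderiv ℝ).fderiv ℝ).comp_left (g := fun L : E →L[ℝ] E →L[ℝ] ℝ =>
    ∑ i, L (stdOrthonormalBasis ℝ E i) (stdOrthonormalBasis ℝ E i)) (by simp)

/-- Green's formula against a compactly supported function. -/
lemma integral_mul_laplacian_eq {E : Type*} [NormedAddCommGroup E] [InnerProductSpace ℝ E]
    [FiniteDimensional ℝ E] [MeasurableSpace E] [BorelSpace E] {A g : E → ℝ}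
    (hA : ContDiff ℝ 2 A) (hg : ContDiff ℝ 2 g) (hc : HasCompactSupport g) :
    ∫ x, A x * (Δ g) x = ∫ x, (Δ A) x * g x := by
  set v := stdOrthonormalBasis ℝ E
  have hA1 : ContDiff ℝ 1 (fderiv ℝ A) := hA.fderiv_right (by norm_num)
  have hg1 : ContDiff ℝ 1 (fderiv ℝ g) := hg.fderiv_right (by norm_num)
  have hA2 : Continuous (fderiv ℝ (fderiv ℝ A)) := hA1.continuous_fderiv (by simp)
  have hg2 : Continuous (fderiv ℝ (fderiv ℝ g)) := hg1.continuous_fderiv (by simp)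
  have hcA := hA.continuous
  have hcg := hg.continuous
  have hcA1 := hA1.continuous
  have hcg1 := hg1.continuous
  have hs1 : HasCompactSupport (fderiv ℝ g) := hc.fderiv ℝ
  have hs2 : HasCompactSupport (fderiv ℝ (fderiv ℝ g)) := hs1.fderiv ℝ
  have hs1' : ∀ i, HasCompactSupport fun x => fderiv ℝ g x (v i) := fun i =>
    hs1.comp_left (g := fun L : E →L[ℝ] ℝ => L (v i)) (by simp)
  have hs2' : ∀ i, HasCompactSupport fun x => fderiv ℝ (fderiv ℝ g) x (v i) (v i) := fun i =>
    hs2.comp_left (g := fun L : E →L[ℝ] E →L[ℝ] ℝ => L (v i) (v i)) (by simp)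
  have dd : ∀ (h : E → ℝ), ContDiff ℝ 1 (fderiv ℝ h) → ∀ i x,
      fderiv ℝ (fun y => fderiv ℝ h y (v i)) x (v i) = fderiv ℝ (fderiv ℝ h) x (v i) (v i) := by
    intro h hh i x
    rw [fderiv_clm_apply ((hh.differentiable (by simp)) x) (differentiableAt_const _)]
    simp
  have i1 : ∀ i, Integrable fun x => A x * fderiv ℝ (fderiv ℝ g) x (v i) (v i) := fun i =>
    (by fun_prop : Continuous _).integrable_of_hasCompactSupport (hs2' i).mul_left
  have i2 : ∀ i, Integrable fun x => fderiv ℝ A x (v i) * fderiv ℝ g x (v i) := fun i =>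
    (by fun_prop : Continuous _).integrable_of_hasCompactSupport (hs1' i).mul_left
  have i3 : ∀ i, Integrable fun x => fderiv ℝ (fderiv ℝ A) x (v i) (v i) * g x := fun i =>
    (by fun_prop : Continuous _).integrable_of_hasCompactSupport hc.mul_left
  have i4 : ∀ i, Integrable fun x => A x * fderiv ℝ g x (v i) := fun i =>
    (by fun_prop : Continuous _).integrable_of_hasCompactSupport (hs1' i).mul_left
  have i5 : ∀ i, Integrable fun x => fderiv ℝ A x (v i) * g x := fun i =>
    (by fun_prop : Continuous _).integrable_of_hasCompactSupport hc.mul_left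
  simp_rw [laplacian_eq_sum_fderiv v, Finset.mul_sum, Finset.sum_mul]
  rw [integral_finsetSum _ fun i _ => i1 i, integral_finsetSum _ fun i _ => i3 i]
  refine Finset.sum_congr rfl fun i _ => ?_
  have e1 := integral_mul_fderiv_eq_neg_fderiv_mul_of_integrable (μ := volume) (f := A)
    (g := fun x => fderiv ℝ g x (v i)) (v := v i) (i2 i) (by simpa only [dd g hg1] using i1 i)
    (i4 i) (fun x _ => hA.differentiable (by simp) x)
    (fun x _ => (hg1.clm_apply contDiff_const).differentiable (by simp) x)
  have e2 := integral_mul_fderiv_eq_neg_fderiv_mul_of_integrable (μ := volume)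
    (f := fun x => fderiv ℝ A x (v i)) (g := g) (v := v i)
    (by simpa only [dd A hA1] using i3 i) (i2 i)
    (i5 i) (fun x _ => (hA1.clm_apply contDiff_const).differentiable (by simp) x)
    (fun x _ => hg.differentiable (by simp) x)
  simp only [dd g hg1] at e1
  simp only [dd A hA1] at e2
  rw [e1, e2, neg_neg]

lemma hasFDerivAt_comp_norm {E : Type*} [NormedAddCommGroup E] [InnerProductSpace ℝ E]
    {ξ : ℝ → ℝ} {c : ℝ} {x : E} (hx : x ≠ 0) (h : HasDerivAt ξ c ‖x‖) :
    HasFDerivAt (fun y : E => ξ ‖y‖) ((c / ‖x‖) • innerSL ℝ x) x := by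
  have hx' : ‖x‖ ≠ 0 := norm_ne_zero_iff.mpr hx
  have h1 : HasFDerivAt (fun y : E => √(‖y‖ ^ 2)) ((1 / (2 * √(‖x‖ ^ 2))) • (2 • innerSL ℝ x)) x :=
    (hasStrictFDerivAt_norm_sq x).hasFDerivAt.sqrt (by positivity)
  simp only [sqrt_sq (norm_nonneg _)] at h1
  refine (h.comp_hasFDerivAt x h1).congr_fderiv ?_
  ext y
  simp
  field_simp

/-- The Laplacian of a radial function on the plane is `ξ'' + ξ' / r`. -/
lemma laplacian_comp_norm {ξ p : ℝ → ℝ} {q : ℝ} {x : Plane} (hx : x ≠ 0)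
    (h : ∀ r, 0 < r → HasDerivAt ξ (p r) r) (hp : HasDerivAt p q ‖x‖) :
    (Δ fun y : Plane => ξ ‖y‖) x = q + p ‖x‖ / ‖x‖ := by
  have hx' : ‖x‖ ≠ 0 := norm_ne_zero_iff.mpr hx
  have h1 : fderiv ℝ (fun y : Plane => ξ ‖y‖) =ᶠ[𝓝 x] fun y => (p ‖y‖ / ‖y‖) • innerSL ℝ y := by
    filter_upwards [isOpen_compl_singleton.mem_nhds hx] with y hy
    exact (hasFDerivAt_comp_norm hy (h _ (norm_pos_iff.mpr hy))).fderiv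
  have h2 : HasDerivAt (fun r => p r / r) ((q * ‖x‖ - p ‖x‖ * 1) / ‖x‖ ^ 2) ‖x‖ :=
    hp.div (hasDerivAt_id _) hx'
  have h3 := (hasFDerivAt_comp_norm hx h2).smul (innerSL ℝ (E := Plane)).hasFDerivAt
  rw [laplacian_eq_sum_fderiv (EuclideanSpace.basisFun (Fin 2) ℝ), h1.fderiv_eq]
  have hn : ‖x‖ ^ 2 = x 0 ^ 2 + x 1 ^ 2 := by
    rw [EuclideanSpace.norm_sq_eq]; simp
  rw [show fderiv ℝ (fun y : Plane => (p ‖y‖ / ‖y‖) • innerSL ℝ y) x = _ from h3.fderiv]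
  have hin : ∀ y z : Plane, innerSL ℝ y z = y 0 * z 0 + y 1 * z 1 := fun y z => by
    rw [innerSL_apply_apply, PiLp.inner_apply]
    simp [mul_comm]
  simp [hin]
  field_simp
  rw [hn]
  ring

/-! ### Smooth truncations -/

/-- The smooth truncation at height `k`: the identity for `s ≤ k`, constant for `s ≥ k + 1`. -/
noncomputable def truncation (k s : ℝ) : ℝ :=
  k + ∫ t in (0 : ℝ)..(s - k), smoothTransition (1 - t)

lemma hasDerivAt_truncation (k s : ℝ) :
    HasDerivAt (truncation k) (smoothTransition (1 - (s - k))) s := by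
  have hc : Continuous fun t : ℝ => smoothTransition (1 - t) :=
    smoothTransition.continuous.comp (by fun_prop)
  have h1 : HasDerivAt (fun v : ℝ => ∫ t in (0 : ℝ)..v, smoothTransition (1 - t))
      (smoothTransition (1 - (s - k))) (s - k) :=
    (hc.integral_hasStrictDerivAt 0 (s - k)).hasDerivAt
  exact (h1.comp_sub_const s k).const_add k

lemma contDiff_truncation (k : ℝ) : ContDiff ℝ ∞ (truncation k) := by
  rw [contDiff_infty_iff_deriv]
  refine ⟨fun s => (hasDerivAt_truncation k s).differentiableAt, ?_⟩
  rw [show deriv (truncation k) = fun s => smoothTransition (1 - (s - k)) from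
    funext fun s => (hasDerivAt_truncation k s).deriv]
  exact smoothTransition.contDiff.comp (by fun_prop)

lemma truncation_of_le {k s : ℝ} (h : s ≤ k) : truncation k s = s := by
  have : ∫ t in (0 : ℝ)..(s - k), smoothTransition (1 - t) = ∫ t in (0 : ℝ)..(s - k), (1 : ℝ) := by
    refine intervalIntegral.integral_congr fun t ht => ?_
    rw [uIcc_of_ge (by linarith)] at ht
    exact smoothTransition.one_of_one_le (by linarith [ht.2])
  rw [truncation, this]
  simp

lemma truncation_of_ge {k s : ℝ} (h : k + 1 ≤ s) : truncation k s = truncation k (k + 1) := by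
  have hc : Continuous fun t : ℝ => smoothTransition (1 - t) :=
    smoothTransition.continuous.comp (by fun_prop)
  have : ∫ t in (1 : ℝ)..(s - k), smoothTransition (1 - t) = 0 := by
    refine (intervalIntegral.integral_congr (g := fun _ => (0 : ℝ)) fun t ht => ?_).trans (by simp)
    rw [uIcc_of_le (by linarith)] at ht
    exact smoothTransition.zero_of_nonpos (by linarith [ht.1])
  rw [truncation, truncation, add_sub_cancel_left,
    ← intervalIntegral.integral_add_adjacent_intervals (hc.intervalIntegrable 0 1)
    (hc.intervalIntegrable 1 (s - k)), this, add_zero]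

lemma abs_truncation_le {k s : ℝ} (hk : 0 ≤ k) (hs : 0 ≤ s) : |truncation k s| ≤ s := by
  rcases le_total s k with h | h
  · rw [truncation_of_le h, abs_of_nonneg hs]
  have hc : Continuous fun t : ℝ => smoothTransition (1 - t) :=
    smoothTransition.continuous.comp (by fun_prop)
  have h0 : 0 ≤ ∫ t in (0 : ℝ)..(s - k), smoothTransition (1 - t) :=
    intervalIntegral.integral_nonneg (by linarith) fun t _ => smoothTransition.nonneg _
  have h1 : ∫ t in (0 : ℝ)..(s - k), smoothTransition (1 - t) ≤ ∫ t in (0 : ℝ)..(s - k), (1 : ℝ) :=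
    intervalIntegral.integral_mono_on (by linarith) (hc.intervalIntegrable _ _) (by simp)
      fun t _ => smoothTransition.le_one _
  rw [intervalIntegral.integral_const, smul_eq_mul, mul_one, sub_zero] at h1
  rw [truncation, abs_of_nonneg (by linarith)]
  linarith

lemma deriv_smoothTransition_eq_zero {t : ℝ} (h : t ∉ Icc (0 : ℝ) 1) :
    deriv smoothTransition t = 0 := by
  rw [mem_Icc, not_and_or, not_le, not_le] at h
  rcases h with h | h
  · have : smoothTransition =ᶠ[𝓝 t] fun _ => 0 := by
      filter_upwards [Iio_mem_nhds h] with s hs using smoothTransition.zero_of_nonpos (le_of_lt hs)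
    rw [this.deriv_eq, deriv_const]
  · have : smoothTransition =ᶠ[𝓝 t] fun _ => 1 := by
      filter_upwards [Ioi_mem_nhds h] with s hs using smoothTransition.one_of_one_le (le_of_lt hs)
    rw [this.deriv_eq, deriv_const]

lemma exists_abs_deriv_smoothTransition_le : ∃ C, 0 ≤ C ∧ ∀ t, |deriv smoothTransition t| ≤ C := by
  have hc : Continuous (deriv smoothTransition) :=
    (smoothTransition.contDiff (n := 1)).continuous_deriv (by simp)
  obtain ⟨C, hC⟩ := (isCompact_Icc (a := (0 : ℝ)) (b := 1)).exists_bound_of_continuousOn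
    hc.continuousOn
  have hC0 : 0 ≤ C := (norm_nonneg _).trans (hC 0 ⟨le_rfl, zero_le_one⟩)
  refine ⟨C, hC0, fun t => ?_⟩
  by_cases h : t ∈ Icc (0 : ℝ) 1
  · exact hC t h
  · rw [deriv_smoothTransition_eq_zero h, abs_zero]
    exact hC0

/-! ### Integrability of radial functions on the plane -/

lemma aestronglyMeasurable_comp_norm {h : ℝ → ℝ} (hc : ContinuousOn h (Ioi 0)) :
    AEStronglyMeasurable (fun x : Plane => h ‖x‖) volume := by
  rw [← restrict_compl_singleton (μ := volume) (0 : Plane)]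
  refine ContinuousOn.aestronglyMeasurable ?_ (measurableSet_singleton _).compl
  exact hc.comp continuous_norm.continuousOn fun x hx => norm_pos_iff.mpr hx

lemma locallyIntegrable_comp_norm {h : ℝ → ℝ} {r₀ : ℝ} (hc : ContinuousOn h (Ioi 0))
    (hr₀ : 0 < r₀) (hi : IntegrableOn (fun r => r * h r) (Ioc 0 r₀)) :
    LocallyIntegrable (fun x : Plane => h ‖x‖) volume := by
  intro x
  refine ⟨Metric.ball 0 (‖x‖ + 1), Metric.isOpen_ball.mem_nhds (by simp), ?_⟩
  rw [integrableOn_fun_norm_addHaar]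
  have h2 : IntegrableOn (fun r => r * h r) (Icc r₀ (‖x‖ + 1)) := by
    refine ContinuousOn.integrableOn_Icc (continuousOn_id.mul (hc.mono fun r hr => ?_))
    exact hr₀.trans_le hr.1
  refine ((hi.union h2).mono_set fun r hr => ?_).congr_fun (fun r _ => by simp) measurableSet_Ioo
  rcases le_total r r₀ with h' | h'
  · exact Or.inl ⟨hr.1, h'⟩
  · exact Or.inr ⟨h', hr.2.le⟩

namespace IsRadialSolution

variable {f φ ψ : ℝ → ℝ}

lemma continuousOn (h : IsRadialSolution f φ ψ (Ioi 0)) :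
    ContinuousOn φ (Ioi 0) ∧ ContinuousOn ψ (Ioi 0) :=
  ⟨fun r hr => (h r hr).1.continuousAt.continuousWithinAt,
    fun r hr => (h r hr).2.continuousAt.continuousWithinAt⟩

/-- The nonlinear term is integrable near the singularity, since it is the derivative of the
flux `-r φ'`, which is bounded and monotone. -/
lemma integrableOn_nonlinearity (h : IsRadialSolution f φ ψ (Ioi 0)) {r₀ : ℝ}
    (hfp : ∀ r ∈ Ioc 0 r₀, 0 ≤ f (φ r))
    (hflux : Tendsto (fun r => r * ψ r) (𝓝[>] 0) (𝓝 0)) :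
    IntegrableOn (fun r => r * f (φ r)) (Ioc 0 r₀) := by
  refine intervalIntegral.integrableOn_deriv_of_nonneg (g := fun r => -(r * ψ r))
    (fun r hr => ?_) (fun r hr => ?_) (fun r hr => mul_nonneg hr.1.le (hfp r ⟨hr.1, hr.2.le⟩))
  · rcases hr.1.eq_or_lt with h0 | h0
    · subst h0
      have : ContinuousWithinAt (fun r => -(r * ψ r)) (Ioi 0) 0 := by
        have := hflux.neg
        simpa [ContinuousWithinAt] using this
      exact (continuousWithinAt_Ioi_iff_Ici.mp this).mono Icc_subset_Ici_self
    · exact (continuousAt_id.mul (h r h0).2.continuousAt).neg.continuousWithinAt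
  · exact (h.hasDerivAt_flux (mem_Ioi.mpr hr.1) hr.1).neg.congr_deriv (neg_neg _)

/-- A vanishing flux forces at most logarithmic growth, so that `r φ` is integrable near the
singularity. -/
lemma exists_integrableOn_profile (h : IsRadialSolution f φ ψ (Ioi 0))
    (hpos : ∀ r, 0 < r → 0 < φ r) (hflux : Tendsto (fun r => r * ψ r) (𝓝[>] 0) (𝓝 0)) :
    ∃ r₀, 0 < r₀ ∧ IntegrableOn (fun r => r * φ r) (Ioc 0 r₀) := by
  have h1 : ∀ᶠ r in 𝓝[>] (0 : ℝ), -1 < r * ψ r := hflux.eventually (lt_mem_nhds (by norm_num))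
  obtain ⟨r₀, hr₀, hsub⟩ := mem_nhdsGT_iff_exists_Ioc_subset.mp h1
  have hr₀ : (0 : ℝ) < r₀ := hr₀
  refine ⟨r₀, hr₀, ?_⟩
  have hmono : MonotoneOn (fun r => φ r + log r) (Ioc 0 r₀) := by
    refine monotoneOn_of_deriv_nonneg (convex_Ioc 0 r₀) (fun r hr => ?_) (fun r hr => ?_)
      (fun r hr => ?_)
    · exact ((h r hr.1).1.continuousAt.add (continuousAt_log hr.1.ne')).continuousWithinAt
    · rw [interior_Ioc] at hr
      exact ((h r hr.1).1.add (hasDerivAt_log hr.1.ne')).differentiableAt.differentiableWithinAt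
    · rw [interior_Ioc] at hr
      have hr0 : 0 < r := hr.1
      rw [show deriv (fun r => φ r + log r) r = ψ r + r⁻¹ from
        ((h r hr.1).1.add (hasDerivAt_log hr.1.ne')).deriv]
      have h2 : -1 < r * ψ r := hsub ⟨hr.1, hr.2.le⟩
      have : ψ r + r⁻¹ = (r * ψ r + 1) / r := by field_simp
      rw [this]
      exact div_nonneg (by linarith) hr0.le
  have hb : IntegrableOn (fun r => r * (φ r₀ + log r₀) - r * log r) (Ioc 0 r₀) := by
    have : Continuous fun r : ℝ => r * (φ r₀ + log r₀) - r * log r :=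
      (continuous_id.mul continuous_const).sub continuous_mul_log
    exact (this.continuousOn.integrableOn_Icc).mono_set Ioc_subset_Icc_self
  refine hb.mono' ?_ ?_
  · exact (continuousOn_id.mul (h.continuousOn.1.mono fun r hr => hr.1)).aestronglyMeasurable
      measurableSet_Ioc
  · filter_upwards [ae_restrict_mem measurableSet_Ioc] with r hr
    have hr0 : 0 < r := hr.1
    have := hmono hr ⟨hr₀, le_rfl⟩ hr.2
    simp only at this
    rw [norm_of_nonneg (mul_nonneg hr0.le (hpos r hr0).le), ← mul_sub]
    exact mul_le_mul_of_nonneg_left (by linarith) hr0.le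

/-- On the shell `a ≤ |x| ≤ b` the Dirichlet integral of the solution is controlled by its
oscillation times the maximal flux. -/
lemma integral_shell_le (h : IsRadialSolution f φ ψ (Ioi 0)) (hψ : ∀ r, 0 < r → ψ r < 0)
    {a b ε : ℝ} (ha : 0 < a) (hab : a ≤ b) (hε : ∀ r ∈ Icc a b, |r * ψ r| ≤ ε) :
    Integrable (fun x : Plane => (Icc a b).indicator (fun r => ψ r ^ 2) ‖x‖) ∧
    ∫ x : Plane, (Icc a b).indicator (fun r => ψ r ^ 2) ‖x‖
      ≤ 2 * volume.real (Metric.ball (0 : Plane) 1) * (ε * (φ a - φ b)) := by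
  have hcψ : ContinuousOn ψ (Icc a b) := h.continuousOn.2.mono fun r hr => ha.trans_le hr.1
  have hind : ∀ r, r ^ (Module.finrank ℝ Plane - 1) • (Icc a b).indicator (fun r => ψ r ^ 2) r
      = (Icc a b).indicator (fun r => r * ψ r ^ 2) r := by
    intro r
    by_cases hr : r ∈ Icc a b <;> simp [hr]
  have hsub : Icc a b ⊆ Ioi 0 := fun r hr => ha.trans_le hr.1
  have hint : IntegrableOn (fun r => r * ψ r ^ 2) (Icc a b) :=
    (continuousOn_id.mul (hcψ.pow 2)).integrableOn_Icc
  constructor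
  · rw [integrable_fun_norm_addHaar]
    simp_rw [hind]
    exact ((integrable_indicator_iff measurableSet_Icc).mpr hint).integrableOn
  · rw [integral_fun_norm_addHaar]
    simp_rw [hind]
    rw [setIntegral_indicator measurableSet_Icc, inter_eq_right.mpr hsub]
    have h1 : ∫ r in Icc a b, r * ψ r ^ 2 ≤ ∫ r in Icc a b, ε * (-ψ r) := by
      refine setIntegral_mono_on hint (continuousOn_const.mul hcψ.neg).integrableOn_Icc
        measurableSet_Icc fun r hr => ?_
      have hneg := hψ r (hsub hr)
      have h2 := (neg_le_abs _).trans (hε r hr)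
      nlinarith
    have h2 : ∫ r in Icc a b, ε * (-ψ r) = ε * (φ a - φ b) := by
      rw [integral_Icc_eq_integral_Ioc, ← intervalIntegral.integral_of_le hab,
        intervalIntegral.integral_const_mul, intervalIntegral.integral_neg,
        intervalIntegral.integral_eq_sub_of_hasDerivAt (f := φ)]
      · ring
      · intro r hr
        rw [uIcc_of_le hab] at hr
        exact (h r (hsub hr)).1
      · exact ContinuousOn.intervalIntegrable (by rwa [uIcc_of_le hab])
    have hV : 0 ≤ volume.real (Metric.ball (0 : Plane) 1) := measureReal_nonneg
    have hd : Module.finrank ℝ Plane = 2 := by simp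
    rw [hd, nsmul_eq_mul, smul_eq_mul, mul_assoc]
    push_cast
    gcongr
    exact h1.trans h2.le

end IsRadialSolution

/-! ### Radial solutions on the whole plane -/

/-- The truncation at height `k` of a radial profile with `φ(r) → ∞` as `r → 0`. For `r ≤ 0` it is
given the constant value of the truncation above `k + 1`, so that it is constant near the origin. -/
noncomputable def truncatedProfile (φ : ℝ → ℝ) (k r : ℝ) : ℝ :=
  if 0 < r then truncation k (φ r) else truncation k (k + 1)

namespace IsRadialSolution

variable {f φ ψ : ℝ → ℝ}

lemma laplacian_eq (h : IsRadialSolution f φ ψ (Ioi 0)) {x : Plane} (hx : x ≠ 0) :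
    (Δ fun y : Plane => φ ‖y‖) x = -f (φ ‖x‖) := by
  rw [laplacian_comp_norm hx (fun r hr => (h r hr).1) (h _ (norm_pos_iff.mpr hx)).2]
  ring

lemma strictAntiOn_of_neg (h : IsRadialSolution f φ ψ (Ioi 0)) (hψ : ∀ r, 0 < r → ψ r < 0) :
    StrictAntiOn φ (Ioi 0) := by
  refine strictAntiOn_of_deriv_neg (convex_Ioi 0) h.continuousOn.1 fun r hr => ?_
  rw [interior_Ioi] at hr
  rw [(h r hr).1.deriv]
  exact hψ r hr

lemma contDiff_truncatedProfile (h : IsRadialSolution f φ ψ (Ioi 0)) (hf : ContDiff ℝ ∞ f)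
    (h0 : Tendsto φ (𝓝[>] 0) atTop) (k : ℝ) :
    ContDiff ℝ 2 fun x : Plane => truncatedProfile φ k ‖x‖ := by
  rw [contDiff_iff_contDiffAt]
  intro x
  rcases eq_or_ne x 0 with rfl | hx
  · -- near the origin the truncated function is constant, since `φ → ∞`
    obtain ⟨r₀, hr₀, hsub⟩ := mem_nhdsGT_iff_exists_Ioo_subset.mp
      (h0.eventually (eventually_ge_atTop (k + 1)))
    refine (contDiffAt_const (c := truncation k (k + 1))).congr_of_eventuallyEq ?_
    filter_upwards [Metric.ball_mem_nhds (0 : Plane) hr₀] with y hy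
    rw [mem_ball_zero_iff] at hy
    unfold truncatedProfile
    split_ifs with hy0
    · exact truncation_of_ge (hsub ⟨hy0, hy⟩)
    · rfl
  · have hx' : ‖x‖ ∈ Ioi (0 : ℝ) := norm_pos_iff.mpr hx
    have hφ := (h.contDiffOn isOpen_Ioi (fun r hr => hr) hf).1.contDiffAt (Ioi_mem_nhds hx')
    have h1 : ContDiffAt ℝ ∞ (fun y : Plane => truncation k (φ ‖y‖)) x :=
      (contDiff_truncation k).contDiffAt.comp x (hφ.comp x (contDiffAt_norm ℝ hx))
    refine (h1.of_le (WithTop.coe_le_coe.mpr (le_top : (2 : ℕ∞) ≤ ⊤))).congr_of_eventuallyEq ?_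
    filter_upwards [isOpen_compl_singleton.mem_nhds hx] with y hy
    exact if_pos (norm_pos_iff.mpr hy)

lemma laplacian_truncatedProfile (h : IsRadialSolution f φ ψ (Ioi 0)) (k : ℝ) {x : Plane}
    (hx : x ≠ 0) :
    (Δ fun y : Plane => truncatedProfile φ k ‖y‖) x =
      -(deriv smoothTransition (1 - (φ ‖x‖ - k)) * ψ ‖x‖ ^ 2
        + smoothTransition (1 - (φ ‖x‖ - k)) * f (φ ‖x‖)) := by
  have hx' : 0 < ‖x‖ := norm_pos_iff.mpr hx
  have hd : ∀ r, 0 < r → HasDerivAt (truncatedProfile φ k)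
      (smoothTransition (1 - (φ r - k)) * ψ r) r := by
    intro r hr
    refine ((hasDerivAt_truncation k (φ r)).comp r (h r hr).1).congr_of_eventuallyEq ?_
    filter_upwards [Ioi_mem_nhds hr] with s hs using if_pos hs
  have hσ : HasDerivAt smoothTransition (deriv smoothTransition (1 - (φ ‖x‖ - k)))
      (1 - (φ ‖x‖ - k)) :=
    ((smoothTransition.contDiff (n := 1)).differentiable (by simp) _).hasDerivAt
  have h1 := (hσ.comp ‖x‖ (((h _ hx').1.sub_const k).const_sub 1)).mul (h _ hx').2
  rw [laplacian_comp_norm hx hd h1]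
  simp only [Function.comp]
  field_simp
  ring

/-- A radial solution with a singularity of vanishing flux at the origin solves the equation in
the sense of distributions on the whole plane. The truncations of the solution are `C²`, and
their Laplacians differ from the truncated nonlinearity by a term that is supported in a shell
shrinking to the origin and has mass at most a multiple of the maximal flux there. -/
lemma isDistributionalSolution (h : IsRadialSolution f φ ψ (Ioi 0)) (hf : ContDiff ℝ ∞ f)
    (hpos : ∀ r, 0 < r → 0 < φ r) (hψ : ∀ r, 0 < r → ψ r < 0)
    (h0 : Tendsto φ (𝓝[>] 0) atTop) (hinf : Tendsto φ atTop (𝓝 0))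
    (hflux : Tendsto (fun r => r * ψ r) (𝓝[>] 0) (𝓝 0)) {r₀ : ℝ} (hr₀ : 0 < r₀)
    (hfp : ∀ r ∈ Ioc 0 r₀, 0 ≤ f (φ r)) :
    IsDistributionalSolution f fun x : Plane => φ ‖x‖ := by
  obtain ⟨hcφ, hcψ⟩ := h.continuousOn
  have hcf : ContinuousOn (fun r => f (φ r)) (Ioi 0) :=
    hf.continuous.comp_continuousOn hcφ
  obtain ⟨r₁, hr₁, hi₁⟩ := h.exists_integrableOn_profile hpos hflux
  have hL1 := locallyIntegrable_comp_norm hcφ hr₁ hi₁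
  have hL2 := locallyIntegrable_comp_norm hcf hr₀ (h.integrableOn_nonlinearity hfp hflux)
  refine ⟨hL1, hL2, fun g hg hgc => ?_⟩
  have hg2 : ContDiff ℝ 2 g := hg.of_le (WithTop.coe_le_coe.mpr (le_top : (2 : ℕ∞) ≤ ⊤))
  have hanti := h.strictAntiOn_of_neg hψ
  have hI1 : Integrable fun x : Plane => φ ‖x‖ * (Δ g) x :=
    hL1.integrable_smul_right_of_hasCompactSupport hg2.continuous_laplacian hgc.laplacian
  have hI2 : Integrable fun x : Plane => f (φ ‖x‖) * g x :=
    hL2.integrable_smul_right_of_hasCompactSupport hg.continuous hgc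
  have hne : ∀ᵐ x : Plane, x ≠ 0 := by
    simp [ae_iff, measure_singleton]
  have hmeas : ∀ k : ℝ, AEStronglyMeasurable
      (fun x : Plane => smoothTransition (1 - (φ ‖x‖ - k))) volume := fun k =>
    aestronglyMeasurable_comp_norm (h := fun r => smoothTransition (1 - (φ r - k)))
      (smoothTransition.continuous.comp_continuousOn
        (continuousOn_const.sub (hcφ.sub continuousOn_const)))
  -- convergence of the left hand sides
  have lim1 : Tendsto (fun k : ℕ => ∫ x : Plane, truncatedProfile φ k ‖x‖ * (Δ g) x) atTop
      (𝓝 (∫ x : Plane, φ ‖x‖ * (Δ g) x)) := by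
    refine tendsto_integral_of_dominated_convergence (fun x => ‖φ ‖x‖ * (Δ g) x‖)
      (fun k => ?_) hI1.norm (fun k => ?_) ?_
    · exact ((h.contDiff_truncatedProfile hf h0 k).continuous.mul
        hg2.continuous_laplacian).aestronglyMeasurable
    · filter_upwards [hne] with x hx
      have hx' : 0 < ‖x‖ := norm_pos_iff.mpr hx
      rw [norm_mul, norm_mul, truncatedProfile, if_pos hx', norm_eq_abs, norm_of_nonneg
        (hpos _ hx').le]
      exact mul_le_mul_of_nonneg_right (abs_truncation_le (Nat.cast_nonneg k) (hpos _ hx').le)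
        (norm_nonneg _)
    · filter_upwards [hne] with x hx
      have hx' : 0 < ‖x‖ := norm_pos_iff.mpr hx
      refine tendsto_const_nhds.congr' ?_
      filter_upwards [eventually_ge_atTop ⌈φ ‖x‖⌉₊] with k hk
      rw [truncatedProfile, if_pos hx', truncation_of_le (Nat.ceil_le.mp hk)]
  -- convergence of the truncated nonlinearity
  have hdom : ∀ (k : ℝ) (x : Plane), ‖smoothTransition (1 - (φ ‖x‖ - k)) * (f (φ ‖x‖) * g x)‖
      ≤ ‖f (φ ‖x‖) * g x‖ := fun k x => by
    rw [norm_mul, norm_of_nonneg (smoothTransition.nonneg _)]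
    exact mul_le_of_le_one_left (norm_nonneg _) (smoothTransition.le_one _)
  have lim2 : Tendsto (fun k : ℕ => ∫ x : Plane,
      smoothTransition (1 - (φ ‖x‖ - k)) * (f (φ ‖x‖) * g x)) atTop
      (𝓝 (∫ x : Plane, f (φ ‖x‖) * g x)) := by
    refine tendsto_integral_of_dominated_convergence (fun x => ‖f (φ ‖x‖) * g x‖)
      (fun k => (hmeas k).mul hI2.aestronglyMeasurable) hI2.norm
      (fun k => ae_of_all _ (hdom k)) (ae_of_all _ fun x => ?_)
    refine tendsto_const_nhds.congr' ?_
    filter_upwards [eventually_ge_atTop ⌈φ ‖x‖⌉₊] with k hk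
    have := Nat.ceil_le.mp hk
    rw [smoothTransition.one_of_one_le (by linarith), one_mul]
  -- the error term
  obtain ⟨C, hC0, hC⟩ := exists_abs_deriv_smoothTransition_le
  obtain ⟨G, hG⟩ := hg.continuous.bounded_above_of_compact_support hgc
  have hG0 : 0 ≤ G := (norm_nonneg _).trans (hG 0)
  set V := 2 * volume.real (Metric.ball (0 : Plane) 1) with hV
  have hV0 : 0 ≤ V := by positivity
  have hsurj : ∀ s, 0 < s → ∃ r, 0 < r ∧ φ r = s := by
    intro s hs
    obtain ⟨p, hp, hp0⟩ := ((h0.eventually (eventually_gt_atTop s)).and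
      self_mem_nhdsWithin).exists
    obtain ⟨q, hq, hq0⟩ := ((hinf.eventually (gt_mem_nhds hs)).and (eventually_gt_atTop p)).exists
    have hp0 : 0 < p := hp0
    obtain ⟨r, hr, hrs⟩ := intermediate_value_Icc' hq0.le
      (hcφ.mono fun r hr => hp0.trans_le hr.1) ⟨hq.le, hp.le⟩
    exact ⟨r, hp0.trans_le hr.1, hrs⟩
  have lim3 : Tendsto (fun k : ℕ => -(∫ x : Plane, truncatedProfile φ k ‖x‖ * (Δ g) x)
      - ∫ x : Plane, smoothTransition (1 - (φ ‖x‖ - k)) * (f (φ ‖x‖) * g x)) atTop (𝓝 0) := by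
    rw [Metric.tendsto_atTop]
    intro ε' hε'
    set ε := ε' / (C * G * V + 1) with hε
    have hden : 0 < C * G * V + 1 := by positivity
    have hε0 : 0 < ε := by positivity
    obtain ⟨δ, hδ, hδsub⟩ := mem_nhdsGT_iff_exists_Ioc_subset.mp
      (hflux.eventually (Metric.ball_mem_nhds 0 hε0))
    have hδ : 0 < δ := hδ
    refine ⟨⌈φ δ⌉₊ + 1, fun k hk => ?_⟩
    have hkδ : φ δ ≤ k := (Nat.ceil_le.mp ((Nat.le_succ _).trans hk))
    have hk0 : (0 : ℝ) < k := (hpos δ hδ).trans_le hkδ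
    obtain ⟨a, ha, hφa⟩ := hsurj (k + 1) (by linarith)
    obtain ⟨b, hb, hφb⟩ := hsurj k hk0
    have hab : a ≤ b := (hanti.le_iff_ge hb ha).mp (by linarith)
    have hbδ : b ≤ δ := (hanti.le_iff_ge hδ hb).mp (by linarith)
    obtain ⟨hsi, hsl⟩ := h.integral_shell_le hψ ha hab (ε := ε) fun r hr => by
      have : r * ψ r ∈ Metric.ball (0 : ℝ) ε := hδsub ⟨ha.trans_le hr.1, hr.2.trans hbδ⟩
      rw [mem_ball_zero_iff] at this
      exact this.le
    rw [← hV, hφa, hφb, add_sub_cancel_left, mul_one] at hsl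
    have hA := h.contDiff_truncatedProfile hf h0 k
    have hΔA : Integrable fun x : Plane =>
        -((Δ fun y : Plane => truncatedProfile φ k ‖y‖) x * g x) :=
      ((hA.continuous_laplacian.mul hg.continuous).integrable_of_hasCompactSupport
        hgc.mul_left).neg
    have hσi : Integrable fun x : Plane =>
        smoothTransition (1 - (φ ‖x‖ - k)) * (f (φ ‖x‖) * g x) :=
      hI2.mono ((hmeas k).mul hI2.aestronglyMeasurable) (ae_of_all _ (hdom k))
    rw [integral_mul_laplacian_eq hA hg2 hgc, ← integral_neg, ← integral_sub hΔA hσi,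
      dist_zero_right]
    have hbound : ∀ᵐ x : Plane, ‖-((Δ fun y : Plane => truncatedProfile φ k ‖y‖) x * g x)
        - smoothTransition (1 - (φ ‖x‖ - k)) * (f (φ ‖x‖) * g x)‖
        ≤ C * G * (Icc a b).indicator (fun r => ψ r ^ 2) ‖x‖ := by
      filter_upwards [hne] with x hx
      have hx' : 0 < ‖x‖ := norm_pos_iff.mpr hx
      rw [h.laplacian_truncatedProfile k hx]
      rw [show ∀ p q s t u : ℝ, -(-(p * q + s * t) * u) - s * (t * u) = p * u * q from
        fun p q s t u => by ring]
      by_cases hxs : ‖x‖ ∈ Icc a b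
      · rw [indicator_of_mem hxs, norm_mul, norm_mul, norm_of_nonneg (sq_nonneg (ψ ‖x‖))]
        gcongr
        · exact hC _
        · exact hG x
      · rw [indicator_of_notMem hxs, deriv_smoothTransition_eq_zero]
        · simp
        · intro hmem
          refine hxs ⟨(hanti.le_iff_ge hx' ha).mp ?_, (hanti.le_iff_ge hb hx').mp ?_⟩
          · linarith [hmem.1]
          · linarith [hmem.2]
    refine (norm_integral_le_of_norm_le (hsi.const_mul (C * G)) hbound).trans_lt ?_
    rw [integral_const_mul]
    calc C * G * _ ≤ C * G * (V * ε) := by gcongr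
      _ = (C * G * V) * ε := by ring
      _ < (C * G * V + 1) * ε := by gcongr; linarith
      _ = ε' := by rw [hε]; field_simp
  have := tendsto_nhds_unique lim3 (lim1.neg.sub lim2)
  linarith

end IsRadialSolution

/-! ### The critical shooting solution -/

lemma IsRadialSolution.isPositiveSingularSolution {f φ ψ : ℝ → ℝ}
    (h : IsRadialSolution f φ ψ (Ioi 0)) (hf : ContDiff ℝ ∞ f)
    (hpos : ∀ r, 0 < r → 0 < φ r) (hψ : ∀ r, 0 < r → ψ r < 0)
    (h0 : Tendsto φ (𝓝[>] 0) atTop) (hinf : Tendsto φ atTop (𝓝 0))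
    (hflux : Tendsto (fun r => r * ψ r) (𝓝[>] 0) (𝓝 0)) {r₀ : ℝ} (hr₀ : 0 < r₀)
    (hfp : ∀ r ∈ Ioc 0 r₀, 0 ≤ f (φ r)) :
    IsPositiveSingularSolution f fun x : Plane => φ ‖x‖ where
  smooth x hx := by
    have hx' : ‖x‖ ∈ Ioi (0 : ℝ) := norm_pos_iff.mpr hx
    have hφ := (h.contDiffOn isOpen_Ioi (fun r hr => hr) hf).1.contDiffAt (Ioi_mem_nhds hx')
    exact (hφ.comp x (contDiffAt_norm ℝ hx)).contDiffWithinAt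
  classical x hx := by rw [h.laplacian_eq hx, neg_neg]
  distributional := h.isDistributionalSolution hf hpos hψ h0 hinf hflux hr₀ hfp
  pos x hx := hpos _ (norm_pos_iff.mpr hx)
  singular := h0.comp tendsto_norm_nhdsNE_zero
  decay := hinf.comp tendsto_norm_cocompact_atTop

theorem theorem2p8 :
    -- a singular solution on some disk exists
    (∃ (Rinf : ℝ) (u : ℝ → ℝ), IsSingularDiskSolution Rinf u) ∧
    -- and for every such solution and every cut-off function
    ∀ (Rinf : ℝ) (u : ℝ → ℝ), IsSingularDiskSolution Rinf u →
      -- there is a unique radius `R` at which `u = 2`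
      ∃ R ∈ Ioo 0 Rinf, u R = 2 ∧ (∀ r ∈ Ioo 0 Rinf, u r = 2 → r = R) ∧
        ∀ χ : ℝ → ℝ, IsCutoff χ →
          -- the shooting solutions `φ m` exist and are unique for all masses `m ≥ 0`
          ∃ φ : ℝ → ℝ → ℝ,
            (∀ m, 0 ≤ m → IsShootingSolution χ u R m (φ m) ∧
              ∀ ψ, IsShootingSolution χ u R m ψ → EqOn ψ (φ m) (Ioi 0)) ∧
            -- the critical mass is well defined and positive
            (positiveMasses R φ).Nonempty ∧
            0 < criticalMass R φ ∧
            -- the critical shooting solution is a positive radial singular solution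
            IsPositiveSingularSolution (nonlin χ (criticalMass R φ))
              (fun x : Plane => φ (criticalMass R φ) ‖x‖) ∧
            -- it is strictly radially decreasing
            StrictAntiOn (φ (criticalMass R φ)) (Ioi 0) ∧
            -- exponential decay
            ∀ m ∈ Ioo 0 (criticalMass R φ), ∃ C : ℝ, 0 < C ∧ ∀ r, R ≤ r →
              φ (criticalMass R φ) r + |deriv (φ (criticalMass R φ)) r|
                ≤ C * exp (-√m * r) := by
  refine ⟨exists_singularDiskSolution, fun Rinf u hu => ?_⟩
  obtain ⟨R, hR, huR, huniq⟩ := hu.exists_eq_two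
  refine ⟨R, hR, huR, huniq, fun χ hχ => ?_⟩
  have hR0 : 0 < R := hR.1
  have hb : deriv u R < 0 := hu.deriv_neg hR
  obtain ⟨φ, ψ, hfam, hinner⟩ := hu.exists_shootingFamily hχ hR huR
  have hshoot : ∀ m, 0 ≤ m → IsShootingSolution χ u R m (φ m) := fun m hm =>
    (hfam.sol m hm).isShootingSolution hχ hR0 (fun r hr => (hinner m hm r hr).1)
      (hinner m hm R ⟨hR0, le_rfl⟩).2
  have hM0 := hfam.criticalMass_pos hχ hR0 hb
  have hin := hinner _ hM0.le
  have hsol := hfam.sol _ hM0.le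
  have hIoc : ∀ᶠ r in 𝓝[>] (0 : ℝ), r ∈ Ioc 0 R := Ioc_mem_nhdsGT hR0
  have hψ : ∀ r, 0 < r → ψ (criticalMass R φ) r < 0 := fun r hr => by
    rcases le_total r R with h | h
    · rw [(hin r ⟨hr, h⟩).2]
      exact hu.deriv_neg ⟨hr, h.trans_lt hR.2⟩
    · exact hfam.critical_deriv_neg hχ hR0 hb h
  have hpos : ∀ r, 0 < r → 0 < φ (criticalMass R φ) r := fun r hr => by
    rcases le_total r R with h | h
    · rw [(hin r ⟨hr, h⟩).1]
      exact hu.pos r ⟨hr, h.trans_lt hR.2⟩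
    · exact hfam.critical_pos hχ hR0 hb h
  have hanti := hsol.strictAntiOn_of_neg hψ
  refine ⟨φ, fun m hm => ⟨hshoot m hm, fun v hv => hv.eqOn hχ hR0 (hshoot m hm)⟩,
    hfam.positiveMasses_nonempty hχ hR0, hM0, ?_, hanti, fun m hm => ?_⟩
  · refine hsol.isPositiveSingularSolution (contDiff_nonlin hχ _) hpos hψ ?_
      (hfam.critical_tendsto_zero hχ hR0 hb).1 ?_ hR0 fun r hr => ?_
    · refine hu.tendsto_atTop.congr' ?_
      filter_upwards [hIoc] with r hr using (hin r hr).1.symm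
    · refine hu.tendsto_flux.congr' ?_
      filter_upwards [hIoc] with r hr
      rw [(hin r hr).2]
    · -- inside the disk of radius `R` the solution is at least `2`, out of reach of the cut-off
      have h2 : 2 ≤ φ (criticalMass R φ) r :=
        hfam.init _ hM0.le ▸ hanti.antitoneOn hr.1 hR0 hr.2
      rw [nonlin_eq_diskNonlin hχ _ h2, diskNonlin]
      exact mul_nonneg (by linarith) (sub_nonneg.mpr (one_le_exp (sq_nonneg _)))
  · obtain ⟨C, hC, hdecay⟩ := hfam.critical_decay hχ hR0 hb hm
    refine ⟨C, hC, fun r hr => ?_⟩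
    rw [(hsol r (hR0.trans_le hr)).1.deriv]
    exact hdecay r hr
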